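/- Let $M$ be an oriented smooth eight-manifold (Hausdorff, second countable) with a Riemannian metric $g$ and a topological $\mathrm{Spin}(7)$-structure whose associated metric is $g$. That is, $\Omega\in\Omega^4(M)$ is a smooth admissible four-form inducing $g$: for every $p\in M$ there is an oriented isomorphism $f\colon T_pM\to\mathbb{R}^8$ that pulls back the Euclidean inner product to $g_p$ and pulls back $$\Omega_0=dx_{1234}+dx_{1256}+dx_{1278}+dx_{1357}-dx_{1368}-dx_{1458}-dx_{1467}-dx_{2358}-dx_{2367}-dx_{2457}+dx_{2468}+dx_{3456}+dx_{3478}+dx_{5678}$$ to $\Omega_p$. Suppose that $S^1$ acts smoothly and freely on $M$ and that $\Omega$ is $S^1$-invariant. Let $X_p=\frac{d}{dt}\big|_{t=0}e^{it}\cdot p$ be the infinitesimal generator and $\pi\colon M\to M/S^1$ the projection. For a nowhere vanishing vector field $w$ on $M$ let $\phi_3^{w}$ be the three-form on $M$ that restricts to $(\iota_w\Omega)|_{w^\perp}$ on $w^\perp$ and annihilates $w$. Call a three-form on an oriented seven-manifold positive if at every point $q$ it is the pullback of $$\phi_0=dx_{123}+dx_{145}+dx_{167}+dx_{246}-dx_{257}-dx_{347}-dx_{356}$$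 under some oriented isomorphism $T_q\to\mathbb{R}^7$; its associated metric is the pullback of the Euclidean one under that isomorphism. A smooth positive three-form, together with its associated metric, is what is called a $G_2$-structure. Then $M/S^1$ with the quotient topology is Hausdorff and second countable and has a smooth seven-manifold structure for which $\pi$ is a submersion. For any such structure the following hold. 1. There is a unique orientation of $M/S^1$ such that, whenever $X_p,w_1,\dots,w_7$ is a positive basis of $T_pM$, the vectors $d\pi(w_1),\dots,d\pi(w_7)$ form a positive basis of $T_{\pi(p)}(M/S^1)$. Positivity on $M/S^1$ refers to this orientation. 2. There is a unique three-form $\psi_3^{X}$ on $M/S^1$ with $\pi^*\psi_3^{X}=\phi_3^{X}$; it is smooth and positive. 3. For the unit vector field $v=X/\|X\|$ there is a unique three-form $\psi_3$ on $M/S^1$ with $\pi^*\psi_3=\phi_3^{v}$; it is smooth and positive. Its associated metric $h$ is smooth, so that $(\psi_3,h)$ is a canonical $G_2$-structure on $M/S^1$, and $\pi\colon(M,g)\to(M/S^1,h)$ is a Riemannian submersion. (If $\|X\|\equiv 1$, then $\psi_3=\psi_3^{X}$.) -/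

import Mathlib

open scoped Manifold ContDiff Topology

noncomputable section

namespace GTwoQuotient

/-! ### Linear algebra -/

section LinearAlgebra

variable {V : Type*} [AddCommGroup V] [Module ℝ V] [TopologicalSpace V]

/-- The standard `n`-dimensional Euclidean space. -/
abbrev Euc (n : ℕ) := EuclideanSpace ℝ (Fin n)

/-- The elementary form `dx_{i_1} ∧ ... ∧ dx_{i_k}` on `ℝⁿ`; its value on `v_1, ..., v_k` is the
determinant of the matrix of the coordinates `(v_a)_{i_b}`. Indices start at `0`. -/
def dx {n k : ℕ} (i : Fin k → Fin n) : Euc n [⋀^Fin k]→L[ℝ] ℝ where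
  toMultilinearMap := ((Matrix.detRowAlternating (n := Fin k) (R := ℝ)).compLinearMap
    (LinearMap.pi fun b => (EuclideanSpace.proj (i b) : Euc n →L[ℝ] ℝ).toLinearMap)).toMultilinearMap
  cont := by
    change Continuous fun v : Fin k → Euc n => Matrix.det (Matrix.of fun a b => v a (i b))
    fun_prop
  map_eq_zero_of_eq' v a b h hab :=
    ((Matrix.detRowAlternating (n := Fin k) (R := ℝ)).compLinearMap
      (LinearMap.pi fun b => (EuclideanSpace.proj (i b) : Euc n →L[ℝ] ℝ).toLinearMap)
      ).map_eq_zero_of_eq v h hab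

theorem dx_apply {n k : ℕ} (i : Fin k → Fin n) (v : Fin k → Euc n) :
    dx i v = Matrix.det (Matrix.of fun a b => v a (i b)) := rfl

/-- The three-form
`dx₁₂₃ + dx₁₄₅ + dx₁₆₇ + dx₂₄₆ - dx₂₅₇ - dx₃₄₇ - dx₃₅₆` on `ℝ⁷`
(coordinates numbered from `0` in the code). -/
def phi0 : Euc 7 [⋀^Fin 3]→L[ℝ] ℝ :=
  dx ![0, 1, 2] + dx ![0, 3, 4] + dx ![0, 5, 6] + dx ![1, 3, 5]
    - dx ![1, 4, 6] - dx ![2, 3, 6] - dx ![2, 4, 5]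

/-- The four-form
`dx₁₂₃₄ + dx₁₂₅₆ + dx₁₂₇₈ + dx₁₃₅₇ - dx₁₃₆₈ - dx₁₄₅₈ - dx₁₄₆₇ - dx₂₃₅₈ - dx₂₃₆₇ - dx₂₄₅₇
+ dx₂₄₆₈ + dx₃₄₅₆ + dx₃₄₇₈ + dx₅₆₇₈` on `ℝ⁸` (coordinates numbered from `0` in the code). -/
def Omega0 : Euc 8 [⋀^Fin 4]→L[ℝ] ℝ :=
  dx ![0, 1, 2, 3] + dx ![0, 1, 4, 5] + dx ![0, 1, 6, 7] + dx ![0, 2, 4, 6]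
    - dx ![0, 2, 5, 7] - dx ![0, 3, 4, 7] - dx ![0, 3, 5, 6]
    - dx ![1, 2, 4, 7] - dx ![1, 2, 5, 6] - dx ![1, 3, 4, 6]
    + dx ![1, 3, 5, 7] + dx ![2, 3, 4, 5] + dx ![2, 3, 6, 7] + dx ![4, 5, 6, 7]

/-- `f : V ≃ ℝⁿ` carries the orientation `o` of `V` to the standard orientation of `ℝⁿ`. -/
def IsOriented {n : ℕ} (o : Orientation ℝ V (Fin n)) (f : V ≃L[ℝ] Euc n) : Prop :=
  Orientation.map (Fin n) f.toLinearEquiv o =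
    (EuclideanSpace.basisFun (Fin n) ℝ).toBasis.orientation

/-- A three-form on an oriented seven-dimensional vector space is positive if it corresponds to
`phi0` under some oriented isomorphism with `ℝ⁷`. -/
def IsPositive (o : Orientation ℝ V (Fin 7)) (φ : V [⋀^Fin 3]→L[ℝ] ℝ) : Prop :=
  ∃ f : V ≃L[ℝ] Euc 7, IsOriented o f ∧
    φ = phi0.compContinuousLinearMap (f : V →L[ℝ] Euc 7)

/-- `φ` is a positive three-form on the oriented space `V` and `B` is its associated inner
product: some oriented isomorphism with `ℝ⁷` carries `φ` to `phi0` and `B` to the standard inner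
product (which is fixed by the stabilizer of `phi0`). -/
def IsPositiveWithMetric (o : Orientation ℝ V (Fin 7)) (φ : V [⋀^Fin 3]→L[ℝ] ℝ)
    (B : V →L[ℝ] V →L[ℝ] ℝ) : Prop :=
  ∃ f : V ≃L[ℝ] Euc 7, IsOriented o f ∧
    φ = phi0.compContinuousLinearMap (f : V →L[ℝ] Euc 7) ∧
    ∀ a b, B a b = inner ℝ (f a) (f b)

/-- `Ω` is an admissible four-form on the oriented space `V` and `B` is its associated inner
product: some oriented isomorphism with `ℝ⁸` carries `Ω` to `Omega0` and `B` to the standard inner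
product (which is fixed by the stabilizer of `Omega0`). -/
def IsAdmissibleWithMetric (o : Orientation ℝ V (Fin 8)) (Ω : V [⋀^Fin 4]→L[ℝ] ℝ)
    (B : V →L[ℝ] V →L[ℝ] ℝ) : Prop :=
  ∃ f : V ≃L[ℝ] Euc 8, IsOriented o f ∧
    Ω = Omega0.compContinuousLinearMap (f : V →L[ℝ] Euc 8) ∧
    ∀ a b, B a b = inner ℝ (f a) (f b)

/-- The contraction `ι_v η = η(v, ·, ..., ·)`. -/
def contract {k : ℕ} (v : V) (η : V [⋀^Fin (k + 1)]→L[ℝ] ℝ) : V [⋀^Fin k]→L[ℝ] ℝ where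
  toMultilinearMap := (η.toAlternatingMap.curryLeft v).toMultilinearMap
  cont := by
    change Continuous fun w : Fin k → V => η (Matrix.vecCons v w)
    exact η.cont.comp (continuous_const.matrixVecCons continuous_id)
  map_eq_zero_of_eq' w a b h hab := (η.toAlternatingMap.curryLeft v).map_eq_zero_of_eq w h hab

theorem contract_apply {k : ℕ} (v : V) (η : V [⋀^Fin (k + 1)]→L[ℝ] ℝ) (w : Fin k → V) :
    contract v η w = η (Matrix.vecCons v w) := rfl

variable [IsTopologicalAddGroup V] [ContinuousSMul ℝ V]

/-- The `B`-orthogonal projection of `V` onto `v^⊥`, `a ↦ a - (B(v,a) / B(v,v)) v`, for `v ≠ 0`. -/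
def orthProj (B : V →L[ℝ] V →L[ℝ] ℝ) (v : V) : V →L[ℝ] V :=
  ContinuousLinearMap.id ℝ V - ((B v v)⁻¹ • B v).smulRight v

/-- For `v ≠ 0`: the extension to `V` of the three-form `(ι_v Ω)|_{v^⊥}` that annihilates `v`. -/
def contractExtended (B : V →L[ℝ] V →L[ℝ] ℝ) (v : V) (Ω : V [⋀^Fin 4]→L[ℝ] ℝ) :
    V [⋀^Fin 3]→L[ℝ] ℝ :=
  (contract v Ω).compContinuousLinearMap (orthProj B v)

end LinearAlgebra

/-! ### Forms, orientations and metrics on manifolds -/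

section Manifolds

/-- A (not necessarily smooth) differential `k`-form on the `n`-manifold `M`. -/
abbrev DForm (n k : ℕ) (M : Type*) [TopologicalSpace M] [ChartedSpace (Euc n) M] :=
  ∀ p : M, TangentSpace (𝓡 n) p [⋀^Fin k]→L[ℝ] ℝ

/-- The form `η` written in the chart at `x₀`, as a function on `ℝⁿ` with values in the `k`-forms
of the vector space `ℝⁿ`. -/
def DForm.inChart {n k : ℕ} {M : Type*} [TopologicalSpace M] [ChartedSpace (Euc n) M]
    (η : DForm n k M) (x₀ : M) (y : Euc n) : Euc n [⋀^Fin k]→L[ℝ] ℝ :=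
  (η ((extChartAt (𝓡 n) x₀).symm y)).compContinuousLinearMap
    (mfderiv 𝓘(ℝ, Euc n) (𝓡 n) (extChartAt (𝓡 n) x₀).symm y)

/-- A form is smooth if its coefficients in all charts are smooth. -/
def DForm.IsSmooth {n k : ℕ} {M : Type*} [TopologicalSpace M] [ChartedSpace (Euc n) M]
    (η : DForm n k M) : Prop :=
  ∀ x₀ : M, ContDiffOn ℝ ∞ (η.inChart x₀) (extChartAt (𝓡 n) x₀).target

/-- The pullback `F^* η` of a form. -/
def DForm.pullback {m n k : ℕ} {M N : Type*} [TopologicalSpace M] [ChartedSpace (Euc m) M]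
    [TopologicalSpace N] [ChartedSpace (Euc n) N] (F : M → N) (η : DForm n k N) : DForm m k M :=
  fun p => (η (F p)).compContinuousLinearMap (mfderiv (𝓡 m) (𝓡 n) F p)

/-- An orientation of a smooth `n`-manifold: an orientation of every tangent space which, near
every point, is constant in the local trivialization of the tangent bundle given by a chart. -/
@[ext]
structure MOrientation (n : ℕ) (M : Type*) [TopologicalSpace M] [ChartedSpace (Euc n) M]
    [IsManifold (𝓡 n) ∞ M] where
  /-- The orientation of the tangent space at `p`. -/
  at_ (p : M) : Orientation ℝ (TangentSpace (𝓡 n) p) (Fin n)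
  locallyConstant (x₀ : M) : ∃ o₀ : Orientation ℝ (Euc n) (Fin n), ∀ᶠ x in 𝓝 x₀,
    ∀ hx : x ∈ (trivializationAt (Euc n) (TangentSpace (𝓡 n) : M → Type _) x₀).baseSet,
      Orientation.map (Fin n) ((trivializationAt (Euc n) (TangentSpace (𝓡 n) : M → Type _)
        x₀).continuousLinearEquivAt ℝ x hx).toLinearEquiv (at_ x) = o₀

/-- Smooth Riemannian metrics on a smooth `n`-manifold. -/
abbrev RMetric (n : ℕ) (M : Type*) [TopologicalSpace M] [ChartedSpace (Euc n) M]
    [IsManifold (𝓡 n) ∞ M] :=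
  Bundle.ContMDiffRiemannianMetric (𝓡 n) ∞ (Euc n) (TangentSpace (𝓡 n) : M → Type _)

/-- `F : (M, g) → (N, h)` is a Riemannian submersion: it is smooth, its differentials are
surjective, and `dF_p` restricted to the orthogonal complement of `ker dF_p` is isometric. -/
structure IsRiemannianSubmersion {m n : ℕ} {M N : Type*}
    [TopologicalSpace M] [ChartedSpace (Euc m) M] [IsManifold (𝓡 m) ∞ M]
    [TopologicalSpace N] [ChartedSpace (Euc n) N] [IsManifold (𝓡 n) ∞ N]
    (g : RMetric m M) (h : RMetric n N) (F : M → N) : Prop where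
  smooth : ContMDiff (𝓡 m) (𝓡 n) ∞ F
  surjective (p : M) : Function.Surjective (mfderiv (𝓡 m) (𝓡 n) F p)
  isometric (p : M) (a b : TangentSpace (𝓡 m) p)
    (ha : ∀ c, mfderiv (𝓡 m) (𝓡 n) F p c = 0 → g.inner p a c = 0)
    (hb : ∀ c, mfderiv (𝓡 m) (𝓡 n) F p c = 0 → g.inner p b c = 0) :
    h.inner (F p) (mfderiv (𝓡 m) (𝓡 n) F p a) (mfderiv (𝓡 m) (𝓡 n) F p b) = g.inner p a b

/-- The contraction with a vector field `v`, restricted to `v^⊥` and extended by `0` on `v`. -/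
def contractField {M : Type*} [TopologicalSpace M] [ChartedSpace (Euc 8) M]
    [IsManifold (𝓡 8) ∞ M] (g : RMetric 8 M) (v : ∀ p : M, TangentSpace (𝓡 8) p)
    (Ω : DForm 8 4 M) : DForm 8 3 M :=
  fun p => contractExtended (g.inner p) (v p) (Ω p)

/-- The vector field `v / ‖v‖`. -/
def normalizeField {n : ℕ} {M : Type*} [TopologicalSpace M] [ChartedSpace (Euc n) M]
    [IsManifold (𝓡 n) ∞ M] (g : RMetric n M) (v : ∀ p : M, TangentSpace (𝓡 n) p) (p : M) :
    TangentSpace (𝓡 n) p :=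
  (Real.sqrt (g.inner p (v p) (v p)))⁻¹ • v p

end Manifolds

/-! ### Circle actions -/

section CircleAction

variable (M : Type*) [TopologicalSpace M] [ChartedSpace (Euc 8) M] [MulAction Circle M]

/-- The orbit space `M / S¹`, which carries the quotient topology. -/
abbrev OrbitSpace := MulAction.orbitRel.Quotient Circle M

/-- The projection `π : M → M / S¹`. -/
def proj (p : M) : OrbitSpace M := Quotient.mk _ p

variable {M}

/-- The infinitesimal generator of the action, `p ↦ d/dt|_{t=0} (e^{it} • p)`.
(The derivative lies in the tangent space at `e^{i0} • p`, which is `p`.) -/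
def generator (p : M) : TangentSpace (𝓡 8) p :=
  mfderiv 𝓘(ℝ, ℝ) (𝓡 8) (fun t : ℝ => Circle.exp t • p) 0 (1 : ℝ)

/-- `o'` is the orientation of `M / S¹` induced by the orientation `o` of `M` and the generator
`X`: if `X, w₁, ..., w₇` is a positive basis of `T_p M`, then `dπ w₁, ..., dπ w₇` is a positive
basis of the tangent space of `M / S¹` at `π p`. -/
def IsInducedOrientation [IsManifold (𝓡 8) ∞ M] [ChartedSpace (Euc 7) (OrbitSpace M)]
    [IsManifold (𝓡 7) ∞ (OrbitSpace M)] (o : MOrientation 8 M)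
    (o' : MOrientation 7 (OrbitSpace M)) : Prop :=
  ∀ (p : M) (b : Module.Basis (Fin 8) ℝ (TangentSpace (𝓡 8) p))
    (c : Module.Basis (Fin 7) ℝ (TangentSpace (𝓡 7) (proj M p))),
    b 0 = generator p → b.orientation = o.at_ p →
    (∀ i : Fin 7, c i = mfderiv (𝓡 8) (𝓡 7) (proj M) p (b i.succ)) →
    c.orientation = o'.at_ (proj M p)

end CircleAction

end GTwoQuotient

end

open GTwoQuotient

/-!
The argument has three parts.

*Linear algebra of `Spin(7)`.* Multiplications by imaginary octonions scale `Omega0`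
(`Omega0_octMul`). Composites of two of them provide, for every vector `v ≠ 0`, a rotation that fixes
`Omega0` and moves `v` to the first axis (`exists_rotation_fixing_Omega0`). Contracting `Omega0` with the
first basis vector gives `phi0` in the other seven coordinates (`Omega0_first`), so an isomorphism
`f : T_p M ≃ ℝ⁸` adapted to the generator `X` of the action descends to an isomorphism of the tangent
space of the orbit space with `ℝ⁷` that carries `phi0` to `ι_X Ω / ‖X‖` and is isometric on `X^⊥`
(`exists_quotient_frame`). The form `Ω` determines the metric, since the stabilizer of `Omega0` is
orthogonal (`inner_map_of_fixes_Omega0`). This is proved from the singular value decomposition: the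
contractions of `Omega0` with three members of an orthonormal basis are unit vectors, which is too rigid
for singular values other than `1`.

*Descent.* The action preserves `Ω`, hence the metric (`metric_smul`), the generator, and by
connectedness of the circle the orientation (`map_smulEquiv_orientation`). As `ι_X Ω` annihilates `X`, the
extension by `0` of its restriction to `X^⊥` is `ι_X Ω` itself, and the forms to be descended are the
invariant forms `ι_X Ω` and `ι_X Ω / ‖X‖`. The orientation, these forms, and the metric
`g(a, b) - g(X, a) g(X, b) / g(X, X)` are defined on the orbit space pointwise, through any point of the
orbit; their smoothness is checked along local sections of the projection, which exist by the normal form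
of submersions (`exists_chart_section`).

*The orbit space as a manifold.* By the inverse function theorem the map `(y, t) ↦ exp (it) • s y`, for a
slice `s` transverse to the orbit of `p`, is the inverse of a chart near `p`. By freeness and compactness
of the circle a small slice meets each orbit at most once (`eventually_eq_of_smul_eq`). The slices are
then the charts of the orbit space, and the projection is `(y, t) ↦ y` in these coordinates
(`exists_quotient_manifold`).
-/

noncomputable section

namespace GTwoQuotient

open Bundle

/-! ### Octonions -/

/-- Two alternating maps agree as soon as they agree on all strictly increasing tuples of members of
a basis. -/
theorem alternatingMap_ext_strictMono {E F : Type*} [AddCommGroup E] [Module ℝ E] [AddCommGroup F]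
    [Module ℝ F] {n k : ℕ} (b : Module.Basis (Fin n) ℝ E) {f g : E [⋀^Fin k]→ₗ[ℝ] F}
    (h : ∀ w : Fin k → Fin n, StrictMono w → f (b ∘ w) = g (b ∘ w)) : f = g := by
  refine Module.Basis.ext_alternating b fun v hv => ?_
  have hs : StrictMono (v ∘ Tuple.sort v) :=
    (Tuple.monotone_sort v).strictMono_of_injective (hv.comp (Tuple.sort v).injective)
  have key := h _ hs
  have e : (b ∘ v ∘ Tuple.sort v) = (fun i => b (v i)) ∘ Tuple.sort v := rfl
  rw [e, AlternatingMap.map_perm, AlternatingMap.map_perm] at key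
  rcases Int.units_eq_one_or (Equiv.Perm.sign (Tuple.sort v)) with hσ | hσ <;>
    simpa [hσ] using key

/-- The standard basis vectors of `ℝⁿ`. -/
abbrev stdB (n : ℕ) : Module.Basis (Fin n) ℝ (Euc n) := (EuclideanSpace.basisFun (Fin n) ℝ).toBasis

theorem det_fin_four (A : Matrix (Fin 4) (Fin 4) ℝ) : A.det =
    A 0 0 * (A 1 1 * (A 2 2 * A 3 3 - A 2 3 * A 3 2) - A 1 2 * (A 2 1 * A 3 3 - A 2 3 * A 3 1)
        + A 1 3 * (A 2 1 * A 3 2 - A 2 2 * A 3 1))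
      - A 0 1 * (A 1 0 * (A 2 2 * A 3 3 - A 2 3 * A 3 2) - A 1 2 * (A 2 0 * A 3 3 - A 2 3 * A 3 0)
        + A 1 3 * (A 2 0 * A 3 2 - A 2 2 * A 3 0))
      + A 0 2 * (A 1 0 * (A 2 1 * A 3 3 - A 2 3 * A 3 1) - A 1 1 * (A 2 0 * A 3 3 - A 2 3 * A 3 0)
        + A 1 3 * (A 2 0 * A 3 1 - A 2 1 * A 3 0))
      - A 0 3 * (A 1 0 * (A 2 1 * A 3 2 - A 2 2 * A 3 1) - A 1 1 * (A 2 0 * A 3 2 - A 2 2 * A 3 0)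
        + A 1 2 * (A 2 0 * A 3 1 - A 2 1 * A 3 0)) := by
  simp [Matrix.det_succ_row_zero, Fin.sum_univ_succ, Fin.succAbove]
  ring

/-- Octonion multiplication on `ℝ⁸`, with the structure constants on the imaginary part
given by `phi0`. -/
def octMul (u a : Euc 8) : Euc 8 := !₂[
  u 0 * a 0 - u 1 * a 1 - u 2 * a 2 - u 3 * a 3 - u 4 * a 4 - u 5 * a 5 - u 6 * a 6 - u 7 * a 7,
  u 1 * a 0 + u 0 * a 1 - u 3 * a 2 + u 2 * a 3 - u 5 * a 4 + u 4 * a 5 - u 7 * a 6 + u 6 * a 7,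
  u 2 * a 0 + u 3 * a 1 + u 0 * a 2 - u 1 * a 3 - u 6 * a 4 + u 7 * a 5 + u 4 * a 6 - u 5 * a 7,
  u 3 * a 0 - u 2 * a 1 + u 1 * a 2 + u 0 * a 3 + u 7 * a 4 + u 6 * a 5 - u 5 * a 6 - u 4 * a 7,
  u 4 * a 0 + u 5 * a 1 + u 6 * a 2 - u 7 * a 3 + u 0 * a 4 - u 1 * a 5 - u 2 * a 6 + u 3 * a 7,
  u 5 * a 0 - u 4 * a 1 - u 7 * a 2 - u 6 * a 3 + u 1 * a 4 + u 0 * a 5 + u 3 * a 6 + u 2 * a 7,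
  u 6 * a 0 + u 7 * a 1 - u 4 * a 2 + u 5 * a 3 + u 2 * a 4 - u 3 * a 5 + u 0 * a 6 - u 1 * a 7,
  u 7 * a 0 - u 6 * a 1 + u 5 * a 2 + u 4 * a 3 - u 3 * a 4 - u 2 * a 5 + u 1 * a 6 + u 0 * a 7]

/-- Left multiplication by an octonion. -/
def octLeft (u : Euc 8) : Euc 8 →ₗ[ℝ] Euc 8 where
  toFun := octMul u
  map_add' a b := by
    ext i; fin_cases i <;> simp [octMul] <;> ring
  map_smul' c a := by
    ext i; fin_cases i <;> simp [octMul] <;> ring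

/-- The norm of the octonions is multiplicative. -/
theorem inner_octMul (u a b : Euc 8) :
    inner ℝ (octMul u a) (octMul u b) = inner ℝ u u * inner ℝ a b := by
  simp only [PiLp.inner_apply, Fin.sum_univ_eight, octMul, RCLike.inner_apply, conj_trivial]
  simp
  ring

/-! ### The stabilizer of the model four-form -/

/-- The bilinear pairing of two-vectors, given by their coordinates `p` and `q`, that `Omega0`
induces; see `Omega0_apply`. Only the entries of `p` and `q` above the diagonal enter. -/
def omegaPairing (p q : Fin 8 → Fin 8 → ℝ) : ℝ :=
    p 0 1 * (q 2 3 + q 4 5 + q 6 7) + p 0 2 * (-q 1 3 + q 4 6 - q 5 7) +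
    p 0 3 * (q 1 2 - q 4 7 - q 5 6) + p 0 4 * (-q 1 5 - q 2 6 + q 3 7) +
    p 0 5 * (q 1 4 + q 2 7 + q 3 6) + p 0 6 * (-q 1 7 + q 2 4 - q 3 5) +
    p 0 7 * (q 1 6 - q 2 5 - q 3 4) + p 1 2 * (q 0 3 - q 4 7 - q 5 6) +
    p 1 3 * (-q 0 2 - q 4 6 + q 5 7) + p 1 4 * (q 0 5 + q 2 7 + q 3 6) +
    p 1 5 * (-q 0 4 + q 2 6 - q 3 7) + p 1 6 * (q 0 7 - q 2 5 - q 3 4) +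
    p 1 7 * (-q 0 6 - q 2 4 + q 3 5) + p 2 3 * (q 0 1 + q 4 5 + q 6 7) +
    p 2 4 * (q 0 6 - q 1 7 - q 3 5) + p 2 5 * (-q 0 7 - q 1 6 + q 3 4) +
    p 2 6 * (-q 0 4 + q 1 5 - q 3 7) + p 2 7 * (q 0 5 + q 1 4 + q 3 6) +
    p 3 4 * (-q 0 7 - q 1 6 + q 2 5) + p 3 5 * (-q 0 6 + q 1 7 - q 2 4) +
    p 3 6 * (q 0 5 + q 1 4 + q 2 7) + p 3 7 * (q 0 4 - q 1 5 - q 2 6) +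
    p 4 5 * (q 0 1 + q 2 3 + q 6 7) + p 4 6 * (q 0 2 - q 1 3 - q 5 7) +
    p 4 7 * (-q 0 3 - q 1 2 + q 5 6) + p 5 6 * (-q 0 3 - q 1 2 + q 4 7) +
    p 5 7 * (-q 0 2 + q 1 3 - q 4 6) + p 6 7 * (q 0 1 + q 2 3 + q 4 5)

/-- The Plücker coordinates of a pair of vectors. -/
def pluecker (a b : Euc 8) (i j : Fin 8) : ℝ := a i * b j - a j * b i

theorem Omega0_apply (a b c d : Euc 8) :
    Omega0 ![a, b, c, d] = omegaPairing (pluecker a b) (pluecker c d) := by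
  simp only [Omega0, ContinuousAlternatingMap.add_apply, ContinuousAlternatingMap.sub_apply,
    dx_apply, det_fin_four, Matrix.of_apply, Matrix.cons_val, omegaPairing, pluecker]
  ring

theorem octMul_stdB (u : Euc 8) (j : Fin 8) : octMul u (stdB 8 j) = !₂[
    ![u 0, -u 1, -u 2, -u 3, -u 4, -u 5, -u 6, -u 7] j,
    ![u 1, u 0, -u 3, u 2, -u 5, u 4, -u 7, u 6] j,
    ![u 2, u 3, u 0, -u 1, -u 6, u 7, u 4, -u 5] j,
    ![u 3, -u 2, u 1, u 0, u 7, u 6, -u 5, -u 4] j,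
    ![u 4, u 5, u 6, -u 7, u 0, -u 1, -u 2, u 3] j,
    ![u 5, -u 4, -u 7, -u 6, u 1, u 0, u 3, u 2] j,
    ![u 6, u 7, -u 4, u 5, u 2, -u 3, u 0, -u 1] j,
    ![u 7, -u 6, u 5, u 4, -u 3, -u 2, u 1, u 0] j] := by
  fin_cases j <;> ext i <;> fin_cases i <;> simp [octMul, stdB]

theorem stdB_eq (j : Fin 8) : stdB 8 j = !₂[
    ![1, 0, 0, 0, 0, 0, 0, 0] j, ![0, 1, 0, 0, 0, 0, 0, 0] j, ![0, 0, 1, 0, 0, 0, 0, 0] j,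
    ![0, 0, 0, 1, 0, 0, 0, 0] j, ![0, 0, 0, 0, 1, 0, 0, 0] j, ![0, 0, 0, 0, 0, 1, 0, 0] j,
    ![0, 0, 0, 0, 0, 0, 1, 0] j, ![0, 0, 0, 0, 0, 0, 0, 1] j] := by
  fin_cases j <;> ext i <;> fin_cases i <;> simp [stdB]

set_option maxHeartbeats 4000000 in
/-- The seventy coefficients of the pullback of `Omega0` under an imaginary octonion. -/
theorem Omega0_octMul_stdB (u : Euc 8) (hu : u 0 = 0) (i j k l : Fin 8) (hij : i < j) (hjk : j < k)
    (hkl : k < l) :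
    Omega0 ![octMul u (stdB 8 i), octMul u (stdB 8 j), octMul u (stdB 8 k), octMul u (stdB 8 l)]
      = (inner ℝ u u) ^ 2 * Omega0 ![stdB 8 i, stdB 8 j, stdB 8 k, stdB 8 l] := by
  rw [octMul_stdB, octMul_stdB, octMul_stdB, octMul_stdB, stdB_eq, stdB_eq, stdB_eq, stdB_eq,
    Omega0_apply, Omega0_apply]
  simp only [PiLp.inner_apply, Fin.sum_univ_eight, RCLike.inner_apply, conj_trivial, hu]
  generalize u 1 = u1
  generalize u 2 = u2
  generalize u 3 = u3
  generalize u 4 = u4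
  generalize u 5 = u5
  generalize u 6 = u6
  generalize u 7 = u7
  fin_cases i <;> fin_cases j <;> first | (exfalso; revert hij; decide) | skip
  all_goals
    fin_cases k <;> first | (exfalso; revert hjk; decide) | skip
  all_goals
    fin_cases l <;> first | (exfalso; revert hkl; decide) | skip
  all_goals
    simp only [omegaPairing, pluecker, Fin.isValue, Fin.reduceFinMk, Fin.mk_one, Fin.zero_eta,
      Matrix.cons_val]
    ring

theorem eq_vec_four {α : Type*} (v : Fin 4 → α) : v = ![v 0, v 1, v 2, v 3] := by
  funext i; fin_cases i <;> rfl

theorem vec_four_map {α β : Type*} (g : α → β) (a b c d : α) :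
    (fun i => g (![a, b, c, d] i)) = ![g a, g b, g c, g d] :=
  eq_vec_four _

/-- Multiplication with an imaginary octonion `u` scales `Omega0` by `‖u‖⁴`. -/
theorem Omega0_octMul {u : Euc 8} (hu : u 0 = 0) (a b c d : Euc 8) :
    Omega0 ![octMul u a, octMul u b, octMul u c, octMul u d]
      = (inner ℝ u u) ^ 2 * Omega0 ![a, b, c, d] := by
  have key : Omega0.toAlternatingMap.compLinearMap (octLeft u)
      = (inner ℝ u u) ^ 2 • Omega0.toAlternatingMap := by
    refine alternatingMap_ext_strictMono (stdB 8) fun w hw => ?_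
    have h := Omega0_octMul_stdB u hu (w 0) (w 1) (w 2) (w 3) (hw (by decide)) (hw (by decide))
      (hw (by decide))
    simp only [AlternatingMap.compLinearMap_apply, AlternatingMap.smul_apply,
      ContinuousAlternatingMap.coe_toAlternatingMap, smul_eq_mul]
    generalize Omega0 = η at h ⊢
    rw [eq_vec_four (stdB 8 ∘ w), vec_four_map]
    exact h
  have h := DFunLike.congr_fun key ![a, b, c, d]
  simp only [AlternatingMap.compLinearMap_apply, AlternatingMap.smul_apply,
    ContinuousAlternatingMap.coe_toAlternatingMap, smul_eq_mul] at h
  generalize Omega0 = η at h ⊢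
  rw [vec_four_map] at h
  exact h

theorem octLeft_injective {u : Euc 8} (hu : u ≠ 0) : Function.Injective (octLeft u) := by
  rw [← LinearMap.ker_eq_bot, LinearMap.ker_eq_bot']
  intro a ha
  have h := inner_octMul u a a
  have ha' : octMul u a = 0 := ha
  rw [ha', inner_zero_left] at h
  simpa [hu] using h.symm

/-- The determinant of `octLeft u` is positive for `u ≠ 0`, since it vanishes nowhere on the connected
space `ℝ⁸ ∖ {0}` and is `1` at the unit octonion. -/
theorem det_octLeft_pos {u : Euc 8} (hu : u ≠ 0) : 0 < LinearMap.det (octLeft u) := by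
  have hcont : Continuous fun u : Euc 8 => LinearMap.det (octLeft u) := by
    have e : (fun u : Euc 8 => LinearMap.det (octLeft u)) =
        fun u => (LinearMap.toMatrix (stdB 8) (stdB 8) (octLeft u)).det := by
      funext u; rw [LinearMap.det_toMatrix]
    rw [e]
    refine Continuous.matrix_det (continuous_matrix fun i j => ?_)
    simp only [LinearMap.toMatrix_apply]
    change Continuous fun u => (octMul u (stdB 8 j)) i
    generalize stdB 8 j = a
    simp only [octMul]
    fin_cases i <;> · simp; fun_prop
  have hconn : IsPreconnected ({0}ᶜ : Set (Euc 8)) :=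
    (isConnected_compl_singleton_of_one_lt_rank (by simp [← Module.finrank_eq_rank]) 0).isPreconnected
  have hne : ∀ v : Euc 8, v ≠ 0 → LinearMap.det (octLeft v) ≠ 0 := fun v hv => by
    have := LinearMap.isUnit_det _ ((Module.End.isUnit_iff _).2
      ⟨octLeft_injective hv, LinearMap.injective_iff_surjective.1 (octLeft_injective hv)⟩)
    exact this.ne_zero
  have hone : LinearMap.det (octLeft (stdB 8 0)) = 1 := by
    have : octLeft (stdB 8 0) = LinearMap.id := by
      ext a i
      change octMul (stdB 8 0) a i = a i
      rw [stdB_eq]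
      fin_cases i <;> simp [octMul]
    rw [this, LinearMap.det_id]
  by_contra hneg
  have h0 := hconn.intermediate_value (a := u) (b := stdB 8 0) hu ((stdB 8).ne_zero 0)
    hcont.continuousOn
  obtain ⟨v, hv, hv0⟩ := h0 ⟨not_lt.1 hneg, by rw [hone]; exact zero_le_one⟩
  exact hne v hv hv0

/-- The subgroup of rotations fixing `Omega0` is transitive on directions: every `v ≠ 0` can be moved
to a positive multiple of the first basis vector. For an imaginary octonion `u` orthogonal to `v` the
product `w = u v` is again imaginary, and `a ↦ w (u a)` maps `v` to `w²`, a negative multiple of the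
unit. -/
theorem exists_rotation_fixing_Omega0 (v : Euc 8) (hv : v ≠ 0) :
    ∃ B : Euc 8 ≃ₗ[ℝ] Euc 8, (∀ a b, inner ℝ (B a) (B b) = inner ℝ a b) ∧
      (∀ a b c d, Omega0 ![B a, B b, B c, B d] = Omega0 ![a, b, c, d]) ∧
      0 < LinearMap.det (B : Euc 8 →ₗ[ℝ] Euc 8) ∧ B v = ‖v‖ • stdB 8 0 := by
  -- an imaginary octonion orthogonal to `v`
  obtain ⟨u, hu0, hu, huv⟩ : ∃ u : Euc 8, u 0 = 0 ∧ u ≠ 0 ∧ inner ℝ u v = 0 := by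
    by_cases h : v 1 = 0
    · refine ⟨!₂[0, 1, 0, 0, 0, 0, 0, 0], rfl, fun h => ?_, ?_⟩
      · simpa using congrArg (fun w : Euc 8 => w 1) h
      · simp [PiLp.inner_apply, Fin.sum_univ_eight, h]
    · refine ⟨!₂[0, -v 2, v 1, 0, 0, 0, 0, 0], rfl, fun h' => h ?_, ?_⟩
      · simpa using congrArg (fun w : Euc 8 => w 2) h'
      · simp [PiLp.inner_apply, Fin.sum_univ_eight]; ring
  obtain ⟨w, hwdef⟩ : ∃ w, w = octMul u v := ⟨_, rfl⟩
  have hw0 : w 0 = 0 := by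
    simp only [PiLp.inner_apply, Fin.sum_univ_eight, RCLike.inner_apply, conj_trivial, hu0] at huv
    rw [hwdef]
    simp only [octMul, hu0]
    simp
    linarith
  have hw : w ≠ 0 := fun h =>
    hv (octLeft_injective hu ((hwdef.symm.trans h).trans (map_zero (octLeft u)).symm))
  have hvn : ‖v‖ ≠ 0 := norm_ne_zero_iff.2 hv
  have hun : ‖u‖ ≠ 0 := norm_ne_zero_iff.2 hu
  -- the factor that makes `a ↦ w (u a)` an isometry, with the sign that corrects that of `w²`
  set r : ℝ := -(‖u‖ ^ 2 * ‖v‖)⁻¹ with hr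
  have hr0 : r ≠ 0 := neg_ne_zero.2 (inv_ne_zero (mul_ne_zero (pow_ne_zero 2 hun) hvn))
  have hwn : inner ℝ w w = ‖u‖ ^ 2 * ‖v‖ ^ 2 := by
    rw [hwdef, inner_octMul, real_inner_self_eq_norm_sq, real_inner_self_eq_norm_sq]
  have hinj : Function.Injective (r • (octLeft w ∘ₗ octLeft u)) := by
    intro a b hab
    exact octLeft_injective hu (octLeft_injective hw (smul_right_injective _ hr0 hab))
  let B := LinearEquiv.ofInjectiveEndo (r • (octLeft w ∘ₗ octLeft u)) hinj
  have hB : ∀ a, B a = r • octMul w (octMul u a) := fun a => rfl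
  refine ⟨B, fun a b => ?_, fun a b c d => ?_, ?_, ?_⟩
  · rw [hB, hB, inner_smul_left, inner_smul_right, inner_octMul, inner_octMul, hwn,
      real_inner_self_eq_norm_sq, hr]
    simp only [conj_trivial]
    field_simp
  · simp only [hB]
    have e : ∀ a b c d : Euc 8, Omega0 ![r • a, r • b, r • c, r • d]
        = r ^ 4 * Omega0 ![a, b, c, d] := fun a b c d => by
      simp only [Omega0_apply, omegaPairing, pluecker, PiLp.smul_apply, smul_eq_mul]
      ring
    rw [e, Omega0_octMul hw0, Omega0_octMul hu0, hwn, real_inner_self_eq_norm_sq, hr]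
    field_simp
  · have e : (B : Euc 8 →ₗ[ℝ] Euc 8) = r • (octLeft w ∘ₗ octLeft u) := rfl
    rw [e, LinearMap.det_smul, LinearMap.det_comp]
    have := det_octLeft_pos hu
    have := det_octLeft_pos hw
    have h8 : 0 < r ^ Module.finrank ℝ (Euc 8) := by
      rw [finrank_euclideanSpace_fin]
      exact Even.pow_pos (by decide) hr0
    positivity
  · rw [hB, ← hwdef]
    -- the square of an imaginary octonion is minus its norm squared
    have hsq : octMul w w = (-inner ℝ w w) • stdB 8 0 := by
      rw [stdB_eq]
      ext i
      simp only [PiLp.inner_apply, Fin.sum_univ_eight, RCLike.inner_apply, conj_trivial]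
      fin_cases i <;> simp [octMul, hw0] <;> ring
    rw [hsq, smul_smul, hwn, hr]
    congr 1
    field_simp

theorem sum_sq_orthonormalBasis (f : OrthonormalBasis (Fin 8) ℝ (Euc 8)) (η : Euc 8 →L[ℝ] ℝ) :
    ∑ l, η (f l) ^ 2 = ∑ l, η (stdB 8 l) ^ 2 := by
  obtain ⟨z, rfl⟩ := (InnerProductSpace.toDual ℝ (Euc 8)).surjective η
  simp only [InnerProductSpace.toDual_apply_apply]
  have h1 := f.sum_sq_norm_inner_left z
  have h2 := (EuclideanSpace.basisFun (Fin 8) ℝ).sum_sq_norm_inner_left z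
  simp only [Real.norm_eq_abs, sq_abs] at h1 h2
  rw [h1]
  simp only [OrthonormalBasis.coe_toBasis]
  rw [h2]

/-- The triple cross product with the first basis vector, up to sign, is the cross product on `ℝ⁷`. -/
theorem Omega0_sum_sq_first (b c : Euc 8) (hb : b 0 = 0) (hc : c 0 = 0) :
    ∑ l, Omega0 ![stdB 8 0, b, c, stdB 8 l] ^ 2
      = inner ℝ b b * inner ℝ c c - inner ℝ b c ^ 2 := by
  simp only [stdB_eq, Omega0_apply, PiLp.inner_apply, Fin.sum_univ_eight, RCLike.inner_apply,
    conj_trivial, omegaPairing, pluecker, Fin.isValue, Matrix.cons_val, hb, hc]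
  ring

/-- The triple cross product determined by `Omega0` of three orthonormal vectors is a unit vector: by
the transitivity of the stabilizer the first one may be taken to be the first basis vector. -/
theorem Omega0_sum_sq (f : OrthonormalBasis (Fin 8) ℝ (Euc 8)) (i j k : Fin 8) (hij : i ≠ j)
    (hik : i ≠ k) (hjk : j ≠ k) : ∑ l, Omega0 ![f i, f j, f k, f l] ^ 2 = 1 := by
  have hfi : ‖f i‖ = 1 := f.norm_eq_one i
  obtain ⟨B, hB, hBΩ, -, hBi⟩ := exists_rotation_fixing_Omega0 (f i)
    (norm_ne_zero_iff.1 (by rw [hfi]; exact one_ne_zero))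
  rw [hfi, one_smul] at hBi
  let f' := f.map (B.isometryOfInner hB)
  have hf' : ∀ l, f' l = B (f l) := fun l => by simp [f']
  have horth : ∀ a b : Fin 8, inner ℝ (f' a) (f' b) = if a = b then (1 : ℝ) else 0 :=
    fun a b => orthonormal_iff_ite.1 f'.orthonormal a b
  have hzero : ∀ a, i ≠ a → f' a 0 = 0 := fun a ha => by
    have h := horth i a
    rw [if_neg ha, hf' i, hBi] at h
    simpa [stdB, EuclideanSpace.inner_single_left] using h
  let η : Euc 8 →L[ℝ] ℝ := LinearMap.toContinuousLinearMap
    (Omega0.toMultilinearMap.toLinearMap ![stdB 8 0, f' j, f' k, 0] 3)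
  have hη : ∀ a, η a = Omega0 ![stdB 8 0, f' j, f' k, a] := fun a => by
    change Omega0 (Function.update ![stdB 8 0, f' j, f' k, 0] 3 a) = _
    congr 1
    funext x; fin_cases x <;> simp [Function.update]
  have h1 : ∀ l, Omega0 ![f i, f j, f k, f l] = η (f' l) := fun l => by
    rw [hη, ← hBΩ, hBi, hf', hf', hf']
  simp only [h1]
  rw [sum_sq_orthonormalBasis]
  simp only [hη]
  rw [Omega0_sum_sq_first _ _ (hzero j hij) (hzero k hik), horth, horth, horth]
  simp [hjk]

theorem Omega0_swap_last (a b c d : Euc 8) : Omega0 ![a, b, d, c] = -Omega0 ![a, b, c, d] := by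
  simp only [Omega0_apply, omegaPairing, pluecker]; ring

theorem Omega0_swap_outer (a b c d : Euc 8) : Omega0 ![d, b, c, a] = -Omega0 ![a, b, c, d] := by
  simp only [Omega0_apply, omegaPairing, pluecker]; ring

/-- `Omega0` vanishes on tuples with a repeated entry among the first three. -/
theorem Omega0_eq_zero_of_repeated (f : OrthonormalBasis (Fin 8) ℝ (Euc 8)) (i j k l : Fin 8)
    (h : i = j ∨ i = k ∨ j = k) : Omega0 ![f i, f j, f k, f l] = 0 := by
  rcases h with rfl | rfl | rfl <;> · simp only [Omega0_apply, omegaPairing, pluecker]; ring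

theorem Omega0_sum_sq_eq_ite (f : OrthonormalBasis (Fin 8) ℝ (Euc 8)) (i j k : Fin 8) :
    ∑ l, Omega0 ![f i, f j, f k, f l] ^ 2 = if i = j ∨ i = k ∨ j = k then 0 else 1 := by
  split_ifs with h
  · exact Finset.sum_eq_zero fun l _ => by rw [Omega0_eq_zero_of_repeated f i j k l h]; simp
  · push Not at h
    exact Omega0_sum_sq f i j k h.1 h.2.1 h.2.2

/-- The combinatorial heart of the fact that the stabilizer of `Omega0` is orthogonal. The squared
coefficients `x`, `y` of `Omega0` in two orthonormal bases, related by scaling the basis vectors with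
`exp (σ i / 2)`, have the same marginals; then
`∑ y (exp s - 1) s = ∑ (x - y) s = 0` for `s = σ i + σ j + σ k + σ l`, which forces `s = 0` wherever
`y ≠ 0`. Summing `y s = 0` over `k` and `l` then yields linear equations for the `σ i + σ j` whose only
solution is `0`. -/
theorem eq_zero_of_equal_marginals (x y : Fin 8 → Fin 8 → Fin 8 → Fin 8 → ℝ) (σ : Fin 8 → ℝ)
    (hy : ∀ i j k l, 0 ≤ y i j k l)
    (hxy : ∀ i j k l, x i j k l = Real.exp (σ i + σ j + σ k + σ l) * y i j k l)
    (hyl : ∀ i j k l, y i j l k = y i j k l)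
    (hxo : ∀ i j k l, x l j k i = x i j k l) (hyo : ∀ i j k l, y l j k i = y i j k l)
    (hxs : ∀ i j k, ∑ l, x i j k l = if i = j ∨ i = k ∨ j = k then 0 else 1)
    (hys : ∀ i j k, ∑ l, y i j k l = if i = j ∨ i = k ∨ j = k then 0 else 1) (i : Fin 8) :
    σ i = 0 := by
  have hds : ∀ i j k, ∑ l, (x i j k l - y i j k l) = 0 := fun i j k => by
    rw [Finset.sum_sub_distrib, hxs, hys, sub_self]
  have hds' : ∀ j k l, ∑ i, (x i j k l - y i j k l) = 0 := fun j k l => by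
    rw [← hds l j k]
    exact Finset.sum_congr rfl fun i _ => by rw [hxo, hyo]
  have h1 : ∑ i, ∑ j, ∑ k, ∑ l, (x i j k l - y i j k l) * (σ i + σ j + σ k) = 0 := by
    refine Finset.sum_eq_zero fun i _ => Finset.sum_eq_zero fun j _ => Finset.sum_eq_zero fun k _ => ?_
    rw [← Finset.sum_mul, hds, zero_mul]
  have h2 : ∑ i, ∑ j, ∑ k, ∑ l, (x i j k l - y i j k l) * σ l = 0 := by
    have : ∀ j k, ∑ i, ∑ l, (x i j k l - y i j k l) * σ l = 0 := fun j k => by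
      rw [Finset.sum_comm]
      refine Finset.sum_eq_zero fun l _ => ?_
      rw [← Finset.sum_mul, hds', zero_mul]
    rw [Finset.sum_comm]
    refine Finset.sum_eq_zero fun j _ => ?_
    rw [Finset.sum_comm]
    exact Finset.sum_eq_zero fun k _ => this j k
  have h3 : ∑ i, ∑ j, ∑ k, ∑ l,
      y i j k l * ((Real.exp (σ i + σ j + σ k + σ l) - 1) * (σ i + σ j + σ k + σ l)) = 0 := by
    refine Eq.trans ?_ ((congrArg₂ (· + ·) h1 h2).trans (add_zero 0))
    simp only [← Finset.sum_add_distrib]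
    refine Finset.sum_congr rfl fun i _ => Finset.sum_congr rfl fun j _ =>
      Finset.sum_congr rfl fun k _ => Finset.sum_congr rfl fun l _ => ?_
    rw [hxy]; ring
  have hpos : ∀ s : ℝ, 0 ≤ (Real.exp s - 1) * s := fun s => by
    rcases le_total 0 s with hs | hs
    · exact mul_nonneg (by linarith [Real.one_le_exp hs]) hs
    · exact mul_nonneg_of_nonpos_of_nonpos (by linarith [Real.exp_le_one_iff.2 hs]) hs
  have hterm : ∀ i j k l,
      0 ≤ y i j k l * ((Real.exp (σ i + σ j + σ k + σ l) - 1) * (σ i + σ j + σ k + σ l)) :=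
    fun i j k l => mul_nonneg (hy _ _ _ _) (hpos _)
  have h4 : ∀ i j k l, y i j k l * (σ i + σ j + σ k + σ l) = 0 := fun i j k l => by
    have e1 := (Finset.sum_eq_zero_iff_of_nonneg fun i _ => Finset.sum_nonneg fun j _ =>
      Finset.sum_nonneg fun k _ => Finset.sum_nonneg fun l _ => hterm i j k l).1 h3 i
      (Finset.mem_univ _)
    have e2 := (Finset.sum_eq_zero_iff_of_nonneg fun j _ =>
      Finset.sum_nonneg fun k _ => Finset.sum_nonneg fun l _ => hterm i j k l).1 e1 j
      (Finset.mem_univ _)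
    have e3 := (Finset.sum_eq_zero_iff_of_nonneg fun k _ => Finset.sum_nonneg fun l _ =>
      hterm i j k l).1 e2 k (Finset.mem_univ _)
    have e4 := (Finset.sum_eq_zero_iff_of_nonneg fun l _ => hterm i j k l).1 e3 l
      (Finset.mem_univ _)
    rcases mul_eq_zero.1 e4 with h | h
    · rw [h, zero_mul]
    · rcases mul_eq_zero.1 h with h | h
      · rw [Real.exp_eq_one_iff _ |>.1 (sub_eq_zero.1 h), mul_zero]
      · rw [h, mul_zero]
  have h5 : ∀ i j, i ≠ j → 4 * (σ i + σ j) + 2 * ∑ k, σ k = 0 := fun i j hij => by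
    have e : ∑ k, ∑ l, y i j k l * (σ i + σ j + σ k + σ l) = 0 :=
      Finset.sum_eq_zero fun k _ => Finset.sum_eq_zero fun l _ => h4 i j k l
    have e1 : ∑ k, ∑ l, y i j k l * (σ i + σ j + σ k + σ l)
        = ∑ k, ∑ l, y i j k l * (σ i + σ j) + ∑ k, ∑ l, y i j k l * σ k
          + ∑ k, ∑ l, y i j k l * σ l := by
      simp only [← Finset.sum_add_distrib]
      exact Finset.sum_congr rfl fun k _ => Finset.sum_congr rfl fun l _ => by ring
    have e2 : ∑ k, ∑ l, y i j k l * σ l = ∑ k, ∑ l, y i j k l * σ k := by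
      rw [Finset.sum_comm]
      exact Finset.sum_congr rfl fun k _ => Finset.sum_congr rfl fun l _ => by rw [hyl]
    rw [e1, e2] at e
    simp only [← Finset.sum_mul, hys] at e
    have e3 : ∀ τ : Fin 8 → ℝ, ∑ k, (if i = j ∨ i = k ∨ j = k then (0 : ℝ) else 1) * τ k
        = ∑ k, τ k - τ i - τ j := fun τ => by
      have : ∀ k, (if i = j ∨ i = k ∨ j = k then (0 : ℝ) else 1) * τ k
          = τ k - (if i = k then τ k else 0) - (if j = k then τ k else 0) := fun k => by
        by_cases h1 : i = k
        · have h2 : ¬ j = k := fun h => hij (h1.trans h.symm)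
          simp [h1, h2]
        · by_cases h2 : j = k <;> simp [h1, h2, hij]
      simp only [this, Finset.sum_sub_distrib]
      simp
    have e4 := e3 fun _ => 1
    simp only [mul_one] at e4
    rw [e3, e4] at e
    simp at e
    linarith
  have h6 : ∀ i, σ i = -(∑ k, σ k) / 4 := fun i => by
    obtain ⟨j, k, hij, hik, hjk⟩ : ∃ j k : Fin 8, i ≠ j ∧ i ≠ k ∧ j ≠ k := by
      revert i; decide
    linarith [h5 i j hij, h5 i k hik, h5 j k hjk]
  have h7 : ∑ k, σ k = 0 := by
    have : ∑ k, σ k = ∑ _k : Fin 8, (-(∑ k, σ k) / 4) := Finset.sum_congr rfl fun k _ => h6 k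
    rw [Finset.sum_const, Finset.card_univ, Fintype.card_fin, nsmul_eq_mul] at this
    push_cast at this
    linarith
  rw [h6, h7]; simp

/-- The linear automorphisms of `ℝ⁸` that fix `Omega0` are orthogonal: `Spin(7) ⊆ SO(8)`. The
singular values of `A` are all `1` by `eq_zero_of_equal_marginals`, applied to the coefficients of
`Omega0` in the bases of its singular vectors. -/
theorem inner_map_of_fixes_Omega0 (A : Euc 8 ≃ₗ[ℝ] Euc 8)
    (hA : ∀ a b c d, Omega0 ![A a, A b, A c, A d] = Omega0 ![a, b, c, d]) (a b : Euc 8) :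
    inner ℝ (A a) (A b) = inner ℝ a b := by
  let T : Euc 8 →ₗ[ℝ] Euc 8 := LinearMap.adjoint (A : Euc 8 →ₗ[ℝ] Euc 8) * (A : Euc 8 →ₗ[ℝ] Euc 8)
  have hT : T.IsSymmetric := LinearMap.isSymmetric_adjoint_mul_self _
  -- an orthonormal basis with orthogonal images
  let e : OrthonormalBasis (Fin 8) ℝ (Euc 8) := hT.eigenvectorBasis finrank_euclideanSpace_fin
  have horth : ∀ i j, i ≠ j → inner ℝ (A (e i)) (A (e j)) = 0 := fun i j hij => by
    have h1 : inner ℝ (A (e i)) (A (e j)) = inner ℝ (e i) (T (e j)) := by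
      change _ = inner ℝ (e i)
        (LinearMap.adjoint (A : Euc 8 →ₗ[ℝ] Euc 8) ((A : Euc 8 →ₗ[ℝ] Euc 8) (e j)))
      rw [LinearMap.adjoint_inner_right]; rfl
    rw [h1, hT.apply_eigenvectorBasis, inner_smul_right, e.orthonormal.2 hij, mul_zero]
  have hne : ∀ i, 0 < ‖A (e i)‖ := fun i =>
    norm_pos_iff.2 ((map_ne_zero_iff A A.injective).2 (e.orthonormal.ne_zero i))
  have hfo : Orthonormal ℝ fun i => (‖A (e i)‖⁻¹) • A (e i) := by
    refine ⟨fun i => ?_, fun i j hij => ?_⟩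
    · rw [norm_smul, norm_inv, norm_norm, inv_mul_cancel₀ (hne i).ne']
    · simp only
      rw [inner_smul_left, inner_smul_right, horth i j hij, mul_zero, mul_zero]
  obtain ⟨f, hf⟩ : ∃ f : OrthonormalBasis (Fin 8) ℝ (Euc 8),
      ∀ i, f i = (‖A (e i)‖⁻¹) • A (e i) := by
    let B := basisOfOrthonormalOfCardEqFinrank hfo (by simp)
    have hB : ∀ i, B i = (‖A (e i)‖⁻¹) • A (e i) := fun i => by
      simp [B]
    refine ⟨B.toOrthonormalBasis ?_, fun i => by rw [Module.Basis.coe_toOrthonormalBasis, hB]⟩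
    rw [coe_basisOfOrthonormalOfCardEqFinrank]; exact hfo
  have hAe : ∀ i, A (e i) = ‖A (e i)‖ • f i := fun i => by
    rw [hf, smul_smul, mul_inv_cancel₀ (hne i).ne', one_smul]
  have hlog : ∀ i, Real.log (‖A (e i)‖ ^ 2) = 0 := by
    refine eq_zero_of_equal_marginals (fun i j k l => Omega0 ![e i, e j, e k, e l] ^ 2)
      (fun i j k l => Omega0 ![f i, f j, f k, f l] ^ 2) (fun i => Real.log (‖A (e i)‖ ^ 2))
      (fun i j k l => sq_nonneg _) (fun i j k l => ?_)
      (fun i j k l => by rw [Omega0_swap_last, neg_sq])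
      (fun i j k l => by rw [Omega0_swap_outer, neg_sq])
      (fun i j k l => by rw [Omega0_swap_outer, neg_sq])
      (fun i j k => Omega0_sum_sq_eq_ite e i j k) (fun i j k => Omega0_sum_sq_eq_ite f i j k)
    have hs : ∀ (r s t u : ℝ) (a b c d : Euc 8), Omega0 ![r • a, s • b, t • c, u • d]
        = r * s * t * u * Omega0 ![a, b, c, d] := fun r s t u a b c d => by
      simp only [Omega0_apply, omegaPairing, pluecker, PiLp.smul_apply, smul_eq_mul]
      ring
    simp only [Real.exp_add, Real.exp_log (pow_pos (hne _) 2)]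
    rw [← hA, hAe i, hAe j, hAe k, hAe l, hs]
    simp only [norm_smul, norm_norm, f.norm_eq_one, mul_one]
    ring
  have hone : ∀ i, ‖A (e i)‖ = 1 := fun i => by
    have := Real.eq_one_of_pos_of_log_eq_zero (pow_pos (hne i) 2) (hlog i)
    exact (pow_eq_one_iff_of_nonneg (hne i).le two_ne_zero).1 this
  have hAe' : ∀ i, A (e i) = f i := fun i => by rw [hf, hone, inv_one, one_smul]
  have hAf : A = (e.equiv f (Equiv.refl _)).toLinearEquiv := by
    refine LinearEquiv.toLinearMap_injective (e.toBasis.ext fun i => ?_)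
    simp [hAe']
  rw [hAf]
  exact (e.equiv f (Equiv.refl _)).inner_map_map a b

/-! ### Restriction to the orthogonal complement of the first axis -/

/-- The last seven coordinates. -/
def tail : Euc 8 →L[ℝ] Euc 7 := LinearMap.toContinuousLinearMap
  { toFun := fun a => WithLp.toLp 2 fun i => a i.succ
    map_add' := fun _ _ => rfl
    map_smul' := fun _ _ => rfl }

theorem tail_apply (a : Euc 8) (i : Fin 7) : tail a i = a i.succ := rfl

/-- The contraction of `Omega0` with the first basis vector is `phi0` in the other coordinates. -/
theorem Omega0_first (a b c : Euc 8) :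
    Omega0 ![stdB 8 0, a, b, c] = phi0 ![tail a, tail b, tail c] := by
  simp only [stdB_eq, Omega0_apply, omegaPairing, pluecker, phi0, ContinuousAlternatingMap.add_apply,
    ContinuousAlternatingMap.sub_apply, dx_apply, Matrix.det_fin_three, Matrix.of_apply,
    Matrix.cons_val, tail_apply]
  simp
  ring

theorem inner_tail (a b : Euc 8) : inner ℝ (tail a) (tail b) = inner ℝ a b - a 0 * b 0 := by
  simp only [PiLp.inner_apply, Fin.sum_univ_succ (n := 7), tail_apply, RCLike.inner_apply,
    conj_trivial]
  ring

/-! ### Smoothness of forms and metrics tested on vector fields -/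

/-- The values of a form at equal points agree; the vectors are compared in the model space `ℝⁿ`, which
is every tangent space by definition. -/
theorem DForm.congr_point {n k : ℕ} {M : Type*} [TopologicalSpace M]
    [ChartedSpace (Euc n) M] (η : DForm n k M) {p q : M} (h : p = q) (v w : Fin k → Euc n)
    (hvw : v = w) : η p v = η q w := by
  subst h; rw [hvw]

section Smoothness

variable {n : ℕ} {M : Type*} [TopologicalSpace M] [ChartedSpace (Euc n) M] [IsManifold (𝓡 n) ∞ M]
  {E : Type*} [NormedAddCommGroup E] [NormedSpace ℝ E] {H : Type*} [TopologicalSpace H]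
  {I : ModelWithCorners ℝ E H} {N : Type*} [TopologicalSpace N] [ChartedSpace H N]

theorem mfderiv_extChartAt_symm_comp {x₀ x : M} (hx : x ∈ (chartAt (Euc n) x₀).source)
    (v : TangentSpace (𝓡 n) x) :
    mfderiv 𝓘(ℝ, Euc n) (𝓡 n) (extChartAt (𝓡 n) x₀).symm (extChartAt (𝓡 n) x₀ x)
      (mfderiv (𝓡 n) 𝓘(ℝ, Euc n) (extChartAt (𝓡 n) x₀) x v) = v := by
  have hx' : x ∈ (extChartAt (𝓡 n) x₀).source := by rwa [extChartAt_source]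
  have h := mfderivWithin_extChartAt_symm_comp_mfderiv_extChartAt' (I := 𝓡 n) hx'
  rw [ModelWithCorners.range_eq_univ, mfderivWithin_univ] at h
  exact DFunLike.congr_fun h v

theorem mfderiv_extChartAt_comp_symm {x₀ : M} {y : Euc n} (hy : y ∈ (extChartAt (𝓡 n) x₀).target)
    (v : Euc n) :
    mfderiv (𝓡 n) 𝓘(ℝ, Euc n) (extChartAt (𝓡 n) x₀) ((extChartAt (𝓡 n) x₀).symm y)
      (mfderiv 𝓘(ℝ, Euc n) (𝓡 n) (extChartAt (𝓡 n) x₀).symm y v) = v := by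
  have h := mfderiv_extChartAt_comp_mfderivWithin_extChartAt_symm (I := 𝓡 n) hy
  rw [ModelWithCorners.range_eq_univ, mfderivWithin_univ] at h
  exact DFunLike.congr_fun h v

theorem trivializationAt_snd {x₀ x : M} (hx : x ∈ (chartAt (Euc n) x₀).source)
    (v : TangentSpace (𝓡 n) x) :
    (trivializationAt (Euc n) (TangentSpace (𝓡 n) : M → Type _) x₀ ⟨x, v⟩).2 =
      mfderiv (𝓡 n) 𝓘(ℝ, Euc n) (extChartAt (𝓡 n) x₀) x v := by
  rw [← TangentBundle.continuousLinearMapAt_trivializationAt hx]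
  exact (Trivialization.continuousLinearMapAt_apply_of_mem (R := ℝ) _
    (by simpa [TangentBundle.trivializationAt_baseSet] using hx) v).symm

/-- A `k`-form on `ℝⁿ` in terms of its coefficients. -/
theorem continuousAlternatingMap_eq_sum {k : ℕ} (η : Euc n [⋀^Fin k]→L[ℝ] ℝ) (u : Fin k → Euc n) :
    η u = ∑ r : Fin k → Fin n, (∏ i, u i (r i)) * η fun i => stdB n (r i) := by
  have hu : u = fun i => ∑ j, u i j • stdB n j := by
    funext i
    have := (stdB n).sum_repr (u i)
    simpa using this.symm
  conv_lhs => rw [hu]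
  change η.toMultilinearMap _ = _
  rw [MultilinearMap.map_sum]
  refine Finset.sum_congr rfl fun r _ => ?_
  rw [MultilinearMap.map_smul_univ, smul_eq_mul]
  rfl

/-- The value of a smooth form on smooth vector fields along a smooth map is smooth. -/
theorem DForm.IsSmooth.contMDiffAt_apply {k : ℕ} {η : DForm n k M} (hη : η.IsSmooth) {c : N → M}
    {w : Fin k → ∀ y, TangentSpace (𝓡 n) (c y)} {y₀ : N} (hc : ContMDiffAt I (𝓡 n) ∞ c y₀)
    (hw : ∀ i, ContMDiffAt I (𝓡 n).tangent ∞
      (fun y => (⟨c y, w i y⟩ : TangentBundle (𝓡 n) M)) y₀) :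
    ContMDiffAt I 𝓘(ℝ, ℝ) ∞ (fun y => η (c y) fun i => w i y) y₀ := by
  have hsrc : ∀ᶠ y in 𝓝 y₀, c y ∈ (chartAt (Euc n) (c y₀)).source :=
    hc.continuousAt ((chartAt (Euc n) (c y₀)).open_source.mem_nhds (mem_chart_source _ _))
  have hu : ∀ i, ContMDiffAt I 𝓘(ℝ, Euc n) ∞ (fun y => (trivializationAt (Euc n)
      (TangentSpace (𝓡 n) : M → Type _) (c y₀) ⟨c y, w i y⟩).2) y₀ := fun i =>
    ((contMDiffAt_totalSpace).1 (hw i)).2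
  have hF : ContMDiffAt I 𝓘(ℝ, Euc n) ∞ (fun y => extChartAt (𝓡 n) (c y₀) (c y)) y₀ :=
    (contMDiffAt_extChartAt (x := c y₀)).comp y₀ hc
  have hηF : ContMDiffAt I 𝓘(ℝ, Euc n [⋀^Fin k]→L[ℝ] ℝ) ∞
      (fun y => η.inChart (c y₀) (extChartAt (𝓡 n) (c y₀) (c y))) y₀ := by
    have h := (hη (c y₀)).contDiffAt (extChartAt_target_mem_nhds (I := 𝓡 n) (c y₀))
    exact ContMDiffAt.comp (I' := 𝓘(ℝ, Euc n)) y₀ h.contMDiffAt hF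
  have hev : ∀ r : Fin k → Fin n, ContMDiffAt I 𝓘(ℝ, ℝ) ∞
      (fun y => η.inChart (c y₀) (extChartAt (𝓡 n) (c y₀) (c y)) fun i => stdB n (r i)) y₀ := by
    intro r
    have hL : ContDiff ℝ ∞ fun α : Euc n [⋀^Fin k]→L[ℝ] ℝ => α fun i => stdB n (r i) :=
      (ContinuousLinearMap.contDiff ((ContinuousMultilinearMap.apply ℝ (fun _ : Fin k => Euc n) ℝ
        fun i => stdB n (r i)).comp
          (ContinuousAlternatingMap.toContinuousMultilinearMapCLM ℝ)))
    exact ContMDiffAt.comp y₀ hL.contMDiff.contMDiffAt hηF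
  have hsum : ContMDiffAt I 𝓘(ℝ, ℝ) ∞ (fun y => ∑ r : Fin k → Fin n,
      (∏ i, (trivializationAt (Euc n) (TangentSpace (𝓡 n) : M → Type _) (c y₀) ⟨c y, w i y⟩).2
        (r i)) * η.inChart (c y₀) (extChartAt (𝓡 n) (c y₀) (c y)) fun i => stdB n (r i)) y₀ := by
    refine ContMDiffAt.sum fun r _ => ContMDiffAt.mul (ContMDiffAt.prod fun i _ => ?_) (hev r)
    exact ContMDiffAt.comp y₀ (g := fun z : Euc n => z (r i))
      (EuclideanSpace.proj (𝕜 := ℝ) (r i)).contDiff.contMDiff.contMDiffAt (hu i)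
  refine hsum.congr_of_eventuallyEq ?_
  filter_upwards [hsrc] with y hy
  rw [← continuousAlternatingMap_eq_sum]
  have hy' : c y ∈ (extChartAt (𝓡 n) (c y₀)).source := by rwa [extChartAt_source]
  have e : (extChartAt (𝓡 n) (c y₀)).symm (extChartAt (𝓡 n) (c y₀) (c y)) = c y :=
    (extChartAt (𝓡 n) (c y₀)).left_inv hy'
  refine η.congr_point e.symm _ _ (funext fun i => ?_)
  exact ((congrArg _ (trivializationAt_snd hy (w i y))).trans
    (mfderiv_extChartAt_symm_comp hy (w i y))).symm

/-- Smoothness of a map into the `k`-forms on `ℝⁿ` can be tested on constant vectors. -/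
theorem contDiffAt_of_apply {k : ℕ} {F : Type*} [NormedAddCommGroup F] [NormedSpace ℝ F]
    {α : F → Euc n [⋀^Fin k]→L[ℝ] ℝ} {y : F}
    (h : ∀ a : Fin k → Euc n, ContDiffAt ℝ ∞ (fun y => α y a) y) : ContDiffAt ℝ ∞ α y := by
  let ev : (Euc n [⋀^Fin k]→L[ℝ] ℝ) →ₗ[ℝ] ((Fin k → Fin n) → ℝ) :=
    { toFun := fun α r => α fun i => stdB n (r i)
      map_add' := fun _ _ => rfl
      map_smul' := fun _ _ => rfl }
  have hinj : LinearMap.ker ev = ⊥ := by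
    rw [LinearMap.ker_eq_bot']
    intro α hα
    ext u
    rw [continuousAlternatingMap_eq_sum]
    exact Finset.sum_eq_zero fun r _ => by
      rw [show (α fun i => stdB n (r i)) = 0 from congrFun hα r, mul_zero]
  obtain ⟨L, hL⟩ := LinearMap.exists_leftInverse_of_injective ev hinj
  have hα : α = fun y => LinearMap.toContinuousLinearMap L (ev (α y)) := by
    funext y
    exact (DFunLike.congr_fun hL (α y)).symm
  rw [hα]
  exact (LinearMap.toContinuousLinearMap L).contDiff.contDiffAt.comp y
    (contDiffAt_pi.2 fun r => h _)

/-- The inner product of smooth vector fields along a smooth map is smooth. -/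
theorem RMetric.contMDiffAt_inner (g : RMetric n M) {c : N → M}
    {v w : ∀ y, TangentSpace (𝓡 n) (c y)} {y₀ : N} (hc : ContMDiffAt I (𝓡 n) ∞ c y₀)
    (hv : ContMDiffAt I (𝓡 n).tangent ∞ (fun y => (⟨c y, v y⟩ : TangentBundle (𝓡 n) M)) y₀)
    (hw : ContMDiffAt I (𝓡 n).tangent ∞ (fun y => (⟨c y, w y⟩ : TangentBundle (𝓡 n) M)) y₀) :
    ContMDiffAt I 𝓘(ℝ, ℝ) ∞ (fun y => g.inner (c y) (v y) (w y)) y₀ := by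
  have : ContMDiffAt I ((𝓡 n).prod 𝓘(ℝ, ℝ)) ∞
      (fun y => TotalSpace.mk' ℝ (E := Bundle.Trivial M ℝ) (c y) (g.inner (c y) (v y) (w y))) y₀ := by
    apply ContMDiffAt.clm_bundle_apply₂ (F₁ := Euc n) (F₂ := Euc n)
    · exact ContMDiffAt.comp y₀ g.contMDiff.contMDiffAt hc
    · exact hv
    · exact hw
  exact ((contMDiffAt_totalSpace).1 this).2

/-- The image of a smooth vector field under the differential of a smooth map is smooth. -/
theorem contMDiffAt_mfderiv_apply [IsManifold I ∞ N] {U : Set N} (hU : IsOpen U) {c : N → M}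
    (hc : ContMDiffOn I (𝓡 n) ∞ c U) {y₀ : N} (hy₀ : y₀ ∈ U) {V : ∀ y, TangentSpace I y}
    (hV : ContMDiffAt I I.tangent ∞ (fun y => (⟨y, V y⟩ : TangentBundle I N)) y₀) :
    ContMDiffAt I (𝓡 n).tangent ∞
      (fun y => (⟨c y, mfderiv I (𝓡 n) c y (V y)⟩ : TangentBundle (𝓡 n) M)) y₀ := by
  have hI : IsManifold I 1 N := IsManifold.of_le (n := ∞) (by norm_num)
  have hJ : IsManifold (𝓡 n) 1 M := IsManifold.of_le (n := ∞) (by norm_num)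
  have h := hc.contMDiffOn_tangentMapWithin (m := ∞) le_rfl hU.uniqueMDiffOn
  have hopen : IsOpen (TotalSpace.proj ⁻¹' U : Set (TangentBundle I N)) :=
    hU.preimage (FiberBundle.continuous_proj E (TangentSpace I : N → Type _))
  have h' := ContMDiffAt.comp y₀ (h.contMDiffAt (x := ⟨y₀, V y₀⟩) (hopen.mem_nhds hy₀)) hV
  refine h'.congr_of_eventuallyEq ?_
  filter_upwards [hU.mem_nhds hy₀] with y hy
  simp only [Function.comp_apply, tangentMapWithin]
  rw [mfderivWithin_of_isOpen hU hy]

end Smoothness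

/-! ### Submersions: local sections and descent -/

/-- A family of bilinear forms on the tangent spaces is smooth if its coefficients in charts are. -/
theorem contMDiff_bilinear_of_chart {n : ℕ} {N : Type*} [TopologicalSpace N]
    [ChartedSpace (Euc n) N] [IsManifold (𝓡 n) ∞ N]
    (h : ∀ q : N, TangentSpace (𝓡 n) q →L[ℝ] TangentSpace (𝓡 n) q →L[ℝ] ℝ)
    (hh : ∀ (x₀ : N) (a b : Euc n), ∀ y ∈ (extChartAt (𝓡 n) x₀).target, ContDiffAt ℝ ∞
      (fun y => h ((extChartAt (𝓡 n) x₀).symm y)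
        (mfderiv 𝓘(ℝ, Euc n) (𝓡 n) (extChartAt (𝓡 n) x₀).symm y a)
        (mfderiv 𝓘(ℝ, Euc n) (𝓡 n) (extChartAt (𝓡 n) x₀).symm y b)) y) :
    ContMDiff (𝓡 n) ((𝓡 n).prod 𝓘(ℝ, Euc n →L[ℝ] Euc n →L[ℝ] ℝ)) ∞
      (fun q => TotalSpace.mk' (Euc n →L[ℝ] Euc n →L[ℝ] ℝ)
        (E := fun q : N => TangentSpace (𝓡 n) q →L[ℝ] TangentSpace (𝓡 n) q →L[ℝ] ℝ) q (h q)) := by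
  intro x₀
  rw [contMDiffAt_hom_bundle]
  refine ⟨contMDiffAt_id, ?_⟩
  set Φ : N → Euc n →L[ℝ] Euc n →L[ℝ] ℝ := fun q => ContinuousLinearMap.inCoordinates (Euc n)
    (TangentSpace (𝓡 n) : N → Type _) (Euc n →L[ℝ] ℝ)
    (fun q : N => TangentSpace (𝓡 n) q →L[ℝ] ℝ) x₀ q x₀ q (h q) with hΦ
  change ContMDiffAt (𝓡 n) 𝓘(ℝ, Euc n →L[ℝ] Euc n →L[ℝ] ℝ) ∞ Φ x₀
  set e := extChartAt (𝓡 n) x₀ with he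
  have hsymm : ∀ q ∈ (chartAt (Euc n) x₀).source, ∀ a : Euc n,
      (trivializationAt (Euc n) (TangentSpace (𝓡 n) : N → Type _) x₀).symm q a =
        mfderiv 𝓘(ℝ, Euc n) (𝓡 n) e.symm (e q) a := fun q hq a => by
    have h1 := TangentBundle.symmL_trivializationAt (I := 𝓡 n) hq
    rw [ModelWithCorners.range_eq_univ, mfderivWithin_univ] at h1
    rw [← Trivialization.symmL_apply (R := ℝ)]
    · exact DFunLike.congr_fun h1 a
    · simpa [TangentBundle.trivializationAt_baseSet] using hq
  have hG : ContDiffOn ℝ ∞ (fun y => Φ (e.symm y)) e.target := by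
    refine contDiffOn_clm_apply.2 fun a => contDiffOn_clm_apply.2 fun b => fun y hy => ?_
    refine ((hh x₀ a b y hy).congr_of_eventuallyEq ?_).contDiffWithinAt
    filter_upwards [extChartAt_target_mem_nhds' hy] with y' hy'
    have hs : e.symm y' ∈ (chartAt (Euc n) x₀).source := by
      rw [← extChartAt_source (𝓡 n)]; exact e.map_target hy'
    have hs' : e.symm y' ∈
        (trivializationAt (Euc n) (TangentSpace (𝓡 n) : N → Type _) x₀).baseSet := by
      simpa [TangentBundle.trivializationAt_baseSet] using hs
    simp only [hΦ]
    refine (inCoordinates_apply_eq₂ (E₃ := Bundle.Trivial N ℝ) hs' hs' (Set.mem_univ _)).trans ?_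
    rw [hsymm _ hs, hsymm _ hs, e.right_inv hy']
    simp only [Trivial.fiberBundle_trivializationAt', Trivial.linearMapAt_trivialization]
    rfl
  have h1 : ContMDiffAt (𝓡 n) 𝓘(ℝ, Euc n →L[ℝ] Euc n →L[ℝ] ℝ) ∞ ((fun y => Φ (e.symm y)) ∘ e) x₀ :=
    ContMDiffAt.comp (I' := 𝓘(ℝ, Euc n)) x₀
      (hG.contDiffAt (extChartAt_target_mem_nhds x₀)).contMDiffAt contMDiffAt_extChartAt
  refine h1.congr_of_eventuallyEq ?_
  filter_upwards [extChartAt_source_mem_nhds (I := 𝓡 n) x₀] with q hq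
  simp only [Function.comp_apply]
  rw [e.left_inv hq]

theorem mfderiv_congr_point {m n : ℕ} {M N : Type*} [TopologicalSpace M] [ChartedSpace (Euc m) M]
    [TopologicalSpace N] [ChartedSpace (Euc n) N] (f : M → N) {p q : M} (h : p = q) (v : Euc m) :
    (mfderiv (𝓡 m) (𝓡 n) f p v : Euc n) = mfderiv (𝓡 m) (𝓡 n) f q v := by
  subst h; rfl

/-- A submersion has smooth local sections through every point. -/
theorem exists_local_section {m n : ℕ} {M N : Type*} [TopologicalSpace M]
    [ChartedSpace (Euc m) M] [TopologicalSpace N] [ChartedSpace (Euc n) N] {f : M → N} {p : M}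
    (hf : Manifold.IsSubmersionAt (𝓡 m) (𝓡 n) ∞ f p) :
    ∃ (U : Set N) (s : N → M), IsOpen U ∧ f p ∈ U ∧ s (f p) = p ∧ ContMDiffOn (𝓡 n) (𝓡 m) ∞ s U ∧
      ∀ q ∈ U, f (s q) = q := by
  set φ := hf.domChart
  set χ := hf.codChart
  set A := hf.equiv
  have hφ : φ ∈ IsManifold.maximalAtlas (𝓡 m) ∞ M := hf.domChart_mem_maximalAtlas
  have hχ : χ ∈ IsManifold.maximalAtlas (𝓡 n) ∞ N := hf.codChart_mem_maximalAtlas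
  have hp : p ∈ φ.source := hf.mem_domChart_source
  have hfp : f p ∈ χ.source := hf.mem_codChart_source
  have hw : ∀ z ∈ φ.target, χ (f (φ.symm z)) = (A z).1 := fun z hz => by
    have := hf.writtenInCharts (by simpa using hz : z ∈ (φ.extend (𝓡 m)).target)
    simpa using this
  have hmaps : ∀ x ∈ φ.source, f x ∈ χ.source := fun x hx => hf.source_subset_preimage_source hx
  let j : Euc n → Euc m := fun y => A.symm (y, (A (φ p)).2)
  have hj : ContDiff ℝ ∞ j := A.symm.contDiff.comp (contDiff_id.prodMk contDiff_const)
  have hAp : (A (φ p)).1 = χ (f p) := by rw [← hw _ (φ.map_source hp), φ.left_inv hp]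
  have hjp : j (χ (f p)) = φ p := by
    change A.symm (χ (f p), (A (φ p)).2) = φ p
    rw [← hAp]; exact A.symm_apply_apply _
  refine ⟨χ.source ∩ χ ⁻¹' (j ⁻¹' φ.target), fun q => φ.symm (j (χ q)),
    χ.isOpen_inter_preimage (φ.open_target.preimage hj.continuous), ⟨hfp, ?_⟩, ?_, ?_, ?_⟩
  · change j (χ (f p)) ∈ φ.target
    rw [hjp]; exact φ.map_source hp
  · change φ.symm (j (χ (f p))) = p
    rw [hjp, φ.left_inv hp]
  · have h1 : ContMDiffOn (𝓡 n) (𝓡 n) ∞ χ χ.source := contMDiffOn_of_mem_maximalAtlas hχ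
    have h2 : ContMDiffOn (𝓡 m) (𝓡 m) ∞ φ.symm φ.target := contMDiffOn_symm_of_mem_maximalAtlas hφ
    exact h2.comp (hj.contMDiff.comp_contMDiffOn (h1.mono Set.inter_subset_left))
      fun q hq => hq.2
  · rintro q ⟨hq, hq'⟩
    refine χ.injOn (hmaps _ (φ.map_target hq')) hq ?_
    rw [hw _ hq']
    change (A (A.symm (χ q, (A (φ p)).2))).1 = χ q
    rw [A.apply_symm_apply]

section Submersion

variable {m n : ℕ} {M N : Type*} [TopologicalSpace M] [ChartedSpace (Euc m) M]
  [TopologicalSpace N] [ChartedSpace (Euc n) N] [IsManifold (𝓡 n) ∞ N]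
  {f : M → N}

/-- Local sections of a submersion in terms of charts of the base: a smooth map `c` from the chart
domain that lifts the inverse of the chart. -/
theorem exists_chart_section (hf : Manifold.IsSubmersion (𝓡 m) (𝓡 n) ∞ f) {x₀ : N} {y₀ : Euc n}
    (hy₀ : y₀ ∈ (extChartAt (𝓡 n) x₀).target) {p : M} (hp : f p = (extChartAt (𝓡 n) x₀).symm y₀) :
    ∃ (U : Set (Euc n)) (c : Euc n → M), IsOpen U ∧ y₀ ∈ U ∧ U ⊆ (extChartAt (𝓡 n) x₀).target ∧
      c y₀ = p ∧ ContMDiffOn 𝓘(ℝ, Euc n) (𝓡 m) ∞ c U ∧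
      (∀ y ∈ U, f (c y) = (extChartAt (𝓡 n) x₀).symm y) ∧
      ∀ y ∈ U, ∀ v : Euc n, (mfderiv (𝓡 m) (𝓡 n) f (c y) (mfderiv 𝓘(ℝ, Euc n) (𝓡 m) c y v) : Euc n) =
        mfderiv 𝓘(ℝ, Euc n) (𝓡 n) (extChartAt (𝓡 n) x₀).symm y v := by
  obtain ⟨V, s, hV, hpV, hsp, hs, hfs⟩ := exists_local_section (hf.isSubmersionAt p)
  set e := extChartAt (𝓡 n) x₀
  have hesm : ContMDiffOn 𝓘(ℝ, Euc n) (𝓡 n) ∞ e.symm e.target := contMDiffOn_extChartAt_symm x₀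
  have hU : IsOpen (e.target ∩ e.symm ⁻¹' V) :=
    hesm.continuousOn.isOpen_inter_preimage (isOpen_extChartAt_target x₀) hV
  have hc : ContMDiffOn 𝓘(ℝ, Euc n) (𝓡 m) ∞ (s ∘ e.symm) (e.target ∩ e.symm ⁻¹' V) :=
    hs.comp (hesm.mono Set.inter_subset_left) fun y hy => hy.2
  refine ⟨e.target ∩ e.symm ⁻¹' V, s ∘ e.symm, hU, ⟨hy₀, ?_⟩, Set.inter_subset_left, ?_, hc,
    fun y hy => hfs _ hy.2, fun y hy v => ?_⟩
  · change e.symm y₀ ∈ V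
    rwa [← hp]
  · rw [Function.comp_apply, ← hp, hsp]
  · have h1 : f ∘ (s ∘ e.symm) =ᶠ[𝓝 y] e.symm := by
      filter_upwards [hU.mem_nhds hy] with y' hy'
      exact hfs _ hy'.2
    have h2 := mfderiv_comp (I := 𝓘(ℝ, Euc n)) (I' := 𝓡 m) (I'' := 𝓡 n) y
      ((hf.contMDiff (s (e.symm y))).mdifferentiableAt (by simp))
      ((hc.contMDiffAt (hU.mem_nhds hy)).mdifferentiableAt (by simp))
    rw [← h1.mfderiv_eq, h2]
    rfl

theorem mfderiv_surjective_of_isSubmersion (hf : Manifold.IsSubmersion (𝓡 m) (𝓡 n) ∞ f) (p : M) :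
    Function.Surjective (mfderiv (𝓡 m) (𝓡 n) f p) := by
  intro w
  have hy₀ := mem_extChartAt_target (I := 𝓡 n) (f p)
  obtain ⟨U, c, -, hyU, -, hcp, -, -, hd⟩ := exists_chart_section hf hy₀ (p := p)
    (extChartAt_to_inv (I := 𝓡 n) (f p)).symm
  have h := hd _ hyU (mfderiv (𝓡 n) 𝓘(ℝ, Euc n) (extChartAt (𝓡 n) (f p)) (f p) w)
  rw [mfderiv_extChartAt_symm_comp (mem_chart_source _ _)] at h
  exact ⟨_, (mfderiv_congr_point f hcp _).symm.trans h⟩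

/-- The pullback of forms along a surjective submersion is injective. -/
theorem DForm.pullback_injective {k : ℕ} (hf : Manifold.IsSubmersion (𝓡 m) (𝓡 n) ∞ f)
    (hs : Function.Surjective f) {α β : DForm n k N}
    (h : DForm.pullback (m := m) f α = DForm.pullback f β) : α = β := by
  funext q
  obtain ⟨p, rfl⟩ := hs q
  ext v
  choose w hw using fun i => mfderiv_surjective_of_isSubmersion hf p (v i)
  have := DFunLike.congr_fun (congrFun h p) w
  have e : v = fun i => mfderiv (𝓡 m) (𝓡 n) f p (w i) := funext fun i => (hw i).symm
  rw [e]
  exact this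

/-- A form on the total space of a surjective submersion whose values depend only on the images of
the vectors in the base is a pullback. -/
theorem DForm.exists_pullback_eq {k : ℕ} (hf : Manifold.IsSubmersion (𝓡 m) (𝓡 n) ∞ f)
    (hs : Function.Surjective f) (η : DForm m k M)
    (hη : ∀ p p' : M, f p = f p' → ∀ v v' : Fin k → Euc m,
      (∀ i, (mfderiv (𝓡 m) (𝓡 n) f p (v i) : Euc n) = mfderiv (𝓡 m) (𝓡 n) f p' (v' i)) →
      η p v = η p' v') :
    ∃ α : DForm n k N, DForm.pullback (m := m) f α = η := by
  choose σ hσ using hs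
  have hinv : ∀ p : M, ∃ L : Euc n →ₗ[ℝ] Euc m, ∀ w, mfderiv (𝓡 m) (𝓡 n) f p (L w) = w := fun p => by
    obtain ⟨L, hL⟩ := LinearMap.exists_rightInverse_of_surjective
      (mfderiv (𝓡 m) (𝓡 n) f p).toLinearMap
      (LinearMap.range_eq_top.2 (mfderiv_surjective_of_isSubmersion hf p))
    exact ⟨L, fun w => DFunLike.congr_fun hL w⟩
  choose L hL using hinv
  refine ⟨fun q => (η (σ q)).compContinuousLinearMap (show TangentSpace (𝓡 n) q →L[ℝ]
    TangentSpace (𝓡 m) (σ q) from (LinearMap.toContinuousLinearMap (L (σ q)) : Euc n →L[ℝ] Euc m)), ?_⟩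
  funext p
  ext v
  exact hη _ _ (hσ (f p)) _ _ fun i => hL _ _

end Submersion

/-! ### The circle action and its generator -/

section Action

variable {M : Type*} [TopologicalSpace M] [ChartedSpace (Euc 8) M] [MulAction Circle M]

omit [TopologicalSpace M] [ChartedSpace (Euc 8) M] in
theorem proj_surjective : Function.Surjective (proj M) := Quotient.mk_surjective

omit [TopologicalSpace M] [ChartedSpace (Euc 8) M] in
theorem proj_smul (z : Circle) (p : M) : proj M (z • p) = proj M p :=
  Quotient.sound ⟨z, rfl⟩

omit [TopologicalSpace M] [ChartedSpace (Euc 8) M] in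
theorem exists_smul_eq_of_proj_eq {p q : M} (h : proj M p = proj M q) : ∃ z : Circle, z • p = q := by
  obtain ⟨z, hz⟩ := Quotient.exact h.symm
  exact ⟨z, hz⟩

variable [ContMDiffSMul (𝓡 1) (𝓡 8) ∞ Circle M]

theorem contMDiff_action :
    ContMDiff (𝓘(ℝ, ℝ).prod (𝓡 8)) (𝓡 8) ∞ fun x : ℝ × M => Circle.exp x.1 • x.2 :=
  (contMDiff_smul (I := 𝓡 1) (I' := 𝓡 8) (G := Circle) (M := M) (n := ∞)).comp
    ((contMDiff_circleExp.comp contMDiff_fst).prodMk contMDiff_snd)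

theorem contMDiff_smul_left (z : Circle) : ContMDiff (𝓡 8) (𝓡 8) ∞ fun p : M => z • p :=
  (contMDiff_smul (I := 𝓡 1) (I' := 𝓡 8) (G := Circle) (M := M) (n := ∞)).comp
    (contMDiff_const.prodMk contMDiff_id)

theorem contMDiff_orbit (p : M) : ContMDiff 𝓘(ℝ, ℝ) (𝓡 8) ∞ fun t : ℝ => Circle.exp t • p :=
  contMDiff_action.comp (contMDiff_id.prodMk contMDiff_const)

theorem mdifferentiableAt_smul (z : Circle) (p : M) :
    MDifferentiableAt (𝓡 8) (𝓡 8) (fun p : M => z • p) p :=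
  (contMDiff_smul_left z p).mdifferentiableAt (by simp)

theorem mdifferentiableAt_orbit (p : M) (t : ℝ) :
    MDifferentiableAt 𝓘(ℝ, ℝ) (𝓡 8) (fun t : ℝ => Circle.exp t • p) t :=
  (contMDiff_orbit p t).mdifferentiableAt (by simp)

/-- The generator is invariant under the action. -/
theorem mfderiv_smul_generator (z : Circle) (p : M) :
    (mfderiv (𝓡 8) (𝓡 8) (fun p : M => z • p) p (generator p) : Euc 8) = generator (z • p) := by
  have h1 : (fun t : ℝ => Circle.exp t • z • p) = (fun p : M => z • p) ∘
      fun t : ℝ => Circle.exp t • p := funext fun t => smul_comm _ _ _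
  have h2 := mfderiv_comp (I := 𝓘(ℝ, ℝ)) (I' := 𝓡 8) (I'' := 𝓡 8) (0 : ℝ)
    (mdifferentiableAt_smul z _) (mdifferentiableAt_orbit p 0)
  rw [← h1] at h2
  have h0 : Circle.exp 0 • p = p := by rw [Circle.exp_zero, one_smul]
  exact ((DFunLike.congr_fun h2 (1 : ℝ)).trans (mfderiv_congr_point (fun p : M => z • p) h0 _)).symm

/-- The velocity of an orbit is the generator at every time. -/
theorem mfderiv_orbit (p : M) (t : ℝ) :
    (mfderiv 𝓘(ℝ, ℝ) (𝓡 8) (fun t : ℝ => Circle.exp t • p) t (1 : ℝ) : Euc 8) =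
      generator (Circle.exp t • p) := by
  have h1 : (fun s : ℝ => Circle.exp s • p) = (fun s : ℝ => Circle.exp s • Circle.exp t • p) ∘
      fun s : ℝ => s - t := by
    funext s
    simp only [Function.comp_apply, smul_smul, ← Circle.exp_add, sub_add_cancel]
  have hsub : HasMFDerivAt 𝓘(ℝ, ℝ) 𝓘(ℝ, ℝ) (fun s : ℝ => s - t) t (ContinuousLinearMap.id ℝ ℝ) :=
    ((hasFDerivAt_id t).sub_const t).hasMFDerivAt
  have h2 := mfderiv_comp (I := 𝓘(ℝ, ℝ)) (I' := 𝓘(ℝ, ℝ)) (I'' := 𝓡 8) t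
    (f := fun s : ℝ => s - t) (g := fun s : ℝ => Circle.exp s • Circle.exp t • p)
    (mdifferentiableAt_orbit (Circle.exp t • p) (t - t)) hsub.mdifferentiableAt
  rw [← h1, hsub.mfderiv] at h2
  refine (DFunLike.congr_fun h2 (1 : ℝ)).trans ?_
  change (mfderiv 𝓘(ℝ, ℝ) (𝓡 8) (fun s : ℝ => Circle.exp s • Circle.exp t • p) (t - t) (1 : ℝ) : Euc 8)
    = mfderiv 𝓘(ℝ, ℝ) (𝓡 8) (fun s : ℝ => Circle.exp s • Circle.exp t • p) 0 (1 : ℝ)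
  rw [sub_self]

/-- The generator of a free action vanishes nowhere: if `X_p = 0` then the orbit of `p` has zero
velocity everywhere, hence is constant near `t = 0`. -/
theorem generator_ne_zero [IsManifold (𝓡 8) ∞ M]
    (hfree : ∀ (z : Circle) (p : M), z • p = p → z = 1) (p : M) :
    generator p ≠ 0 := by
  intro hX
  have hvel : ∀ t : ℝ, mfderiv 𝓘(ℝ, ℝ) (𝓡 8) (fun t : ℝ => Circle.exp t • p) t = 0 := fun t => by
    have h1 : (mfderiv 𝓘(ℝ, ℝ) (𝓡 8) (fun t : ℝ => Circle.exp t • p) t (1 : ℝ) : Euc 8) = 0 := by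
      rw [mfderiv_orbit, ← mfderiv_smul_generator, hX]
      exact map_zero _
    exact ContinuousLinearMap.ext_ring h1
  set e := extChartAt (𝓡 8) p
  have h0 : Circle.exp 0 • p = p := by rw [Circle.exp_zero, one_smul]
  have hcont : Continuous fun t : ℝ => Circle.exp t • p := (contMDiff_orbit p).continuous
  have hopen : IsOpen ((fun t : ℝ => Circle.exp t • p) ⁻¹' (chartAt (Euc 8) p).source) :=
    (chartAt (Euc 8) p).open_source.preimage hcont
  have hmem : (0 : ℝ) ∈ (fun t : ℝ => Circle.exp t • p) ⁻¹' (chartAt (Euc 8) p).source := by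
    change Circle.exp 0 • p ∈ (chartAt (Euc 8) p).source
    rw [h0]; exact mem_chart_source _ _
  obtain ⟨ε, hε, hball⟩ := Metric.isOpen_iff.1 hopen 0 hmem
  have hd : ∀ t ∈ Metric.ball (0 : ℝ) ε,
      HasFDerivAt (fun t : ℝ => e (Circle.exp t • p)) (0 : ℝ →L[ℝ] Euc 8) t := fun t ht => by
    have h1 : MDifferentiableAt (𝓡 8) 𝓘(ℝ, Euc 8) e (Circle.exp t • p) :=
      mdifferentiableAt_extChartAt (hball ht)
    have h2 := h1.hasMFDerivAt.comp t (mdifferentiableAt_orbit p t).hasMFDerivAt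
    rw [hvel] at h2
    have h3 : (mfderiv (𝓡 8) 𝓘(ℝ, Euc 8) e (Circle.exp t • p)).comp
        (0 : TangentSpace 𝓘(ℝ, ℝ) t →L[ℝ] TangentSpace (𝓡 8) (Circle.exp t • p)) = 0 :=
      ContinuousLinearMap.comp_zero _
    rw [h3] at h2
    exact h2.hasFDerivAt
  have hconst : ∀ t ∈ Metric.ball (0 : ℝ) ε, e (Circle.exp t • p) = e p := fun t ht => by
    have := Metric.isOpen_ball.is_const_of_fderiv_eq_zero (𝕜 := ℝ)
      (convex_ball (0 : ℝ) ε).isPreconnected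
      (fun t ht => (hd t ht).differentiableAt.differentiableWithinAt)
      (fun t ht => (hd t ht).fderiv) ht (Metric.mem_ball_self hε)
    simpa only [h0] using this
  have hfix : ∀ t ∈ Metric.ball (0 : ℝ) ε, Circle.exp t = 1 := fun t ht => by
    refine hfree _ p (e.injOn ?_ ?_ (hconst t ht))
    · rw [extChartAt_source]; exact hball ht
    · exact mem_extChartAt_source p
  have hε2 : 0 < min (ε / 2) 1 := lt_min (by linarith) one_pos
  have h1 := hfix (min (ε / 2) 1) (by
    rw [Metric.mem_ball, dist_zero_right, Real.norm_eq_abs, abs_of_pos hε2]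
    exact (min_le_left _ _).trans_lt (by linarith))
  have h2 := Circle.arg_exp (x := min (ε / 2) 1) (by linarith [Real.pi_pos])
    ((min_le_right _ _).trans (by linarith [Real.pi_gt_three]))
  rw [h1] at h2
  simp only [Circle.coe_one, Complex.arg_one] at h2
  exact hε2.ne h2

/-- The generator is a smooth vector field: it is the differential of the action `ℝ × M → M` applied to
the vector field `(∂_t, 0)` along `{0} × M`. -/
theorem contMDiff_generator [IsManifold (𝓡 8) ∞ M] :
    ContMDiff (𝓡 8) (𝓡 8).tangent ∞
      (fun p : M => (⟨p, generator p⟩ : TangentBundle (𝓡 8) M)) := by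
  have hI : IsManifold (𝓡 8) 1 M := IsManifold.of_le (n := ∞) (by norm_num)
  have h1 : ContMDiff (𝓡 8) (𝓘(ℝ, ℝ).tangent.prod (𝓡 8).tangent) ∞ fun p : M =>
      ((⟨0, (1 : ℝ)⟩ : TangentBundle 𝓘(ℝ, ℝ) ℝ), (⟨p, 0⟩ : TangentBundle (𝓡 8) M)) :=
    contMDiff_const.prodMk (Bundle.contMDiff_zeroSection ℝ (TangentSpace (𝓡 8) : M → Type _))
  have h2 : ContMDiff (𝓘(ℝ, ℝ).prod (𝓡 8)).tangent (𝓡 8).tangent ∞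
      (tangentMap (𝓘(ℝ, ℝ).prod (𝓡 8)) (𝓡 8) fun x : ℝ × M => Circle.exp x.1 • x.2) :=
    contMDiff_action.contMDiff_tangentMap le_rfl
  have h3 := h2.comp ((contMDiff_equivTangentBundleProd_symm (n := ∞) (I := 𝓘(ℝ, ℝ)) (M := ℝ)
    (I' := 𝓡 8) (M' := M)).comp h1)
  have e : ∀ (p q : M) (h : p = q) (v w : Euc 8) (hvw : v = w),
      (⟨p, v⟩ : TangentBundle (𝓡 8) M) = ⟨q, w⟩ := by rintro p _ rfl v _ rfl; rfl
  convert h3 using 1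
  funext p
  refine e _ _ (by simp) _ _ ?_
  have h4 := mfderiv_comp (I := 𝓘(ℝ, ℝ)) (I' := 𝓘(ℝ, ℝ).prod (𝓡 8)) (I'' := 𝓡 8) (0 : ℝ)
    (f := fun t : ℝ => (t, p)) (g := fun x : ℝ × M => Circle.exp x.1 • x.2)
    ((contMDiff_action (0, p)).mdifferentiableAt (by simp))
    (mdifferentiableAt_id.prodMk mdifferentiableAt_const)
  rw [mfderiv_prod_left] at h4
  exact DFunLike.congr_fun h4 (1 : ℝ)

end Action

/-! ### Orientations of quotients of vector spaces -/

section LinearOrientation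

variable {V W : Type*} [AddCommGroup V] [Module ℝ V] [AddCommGroup W] [Module ℝ W] {n : ℕ}

/-- Two bases of `V` starting with the same vector `X` and inducing bases of the quotient `W` of `V`
by the line of `X` are related by a matrix with the same determinant as the induced bases. -/
theorem det_eq_det_quotient (L : V →ₗ[ℝ] W) (b b' : Module.Basis (Fin (n + 1)) ℝ V)
    (c c' : Module.Basis (Fin n) ℝ W) (h0 : b' 0 = b 0) (hb : L (b 0) = 0)
    (hc : ∀ i, c i = L (b i.succ)) (hc' : ∀ i, c' i = L (b' i.succ)) :
    b.det b' = c.det c' := by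
  rw [Module.Basis.det_apply, Module.Basis.det_apply, Matrix.det_succ_column_zero,
    Fin.sum_univ_succ]
  have h1 : ∀ i : Fin n, b.toMatrix b' i.succ 0 = 0 := fun i => by
    rw [Module.Basis.toMatrix_apply, h0, Module.Basis.repr_self, Finsupp.single_eq_of_ne]
    exact Fin.succ_ne_zero i
  have h2 : b.toMatrix b' 0 0 = 1 := by
    rw [Module.Basis.toMatrix_apply, h0, Module.Basis.repr_self, Finsupp.single_eq_same]
  have h3 : (b.toMatrix b').submatrix Fin.succ Fin.succ = c.toMatrix c' := by
    ext i j
    rw [Matrix.submatrix_apply, Module.Basis.toMatrix_apply, Module.Basis.toMatrix_apply, hc' j]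
    conv_rhs => rw [← b.sum_repr (b' j.succ), map_sum, Fin.sum_univ_succ]
    simp only [map_smul, hb, smul_zero, zero_add, ← hc]
    simp [Finsupp.single_apply]
  rw [← h3]
  simp [h1, h2]

theorem orientation_quotient_eq (L : V →ₗ[ℝ] W) (b b' : Module.Basis (Fin (n + 1)) ℝ V)
    (c c' : Module.Basis (Fin n) ℝ W) (h0 : b' 0 = b 0) (hb : L (b 0) = 0)
    (hc : ∀ i, c i = L (b i.succ)) (hc' : ∀ i, c' i = L (b' i.succ))
    (ho : b.orientation = b'.orientation) : c.orientation = c'.orientation := by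
  rw [Module.Basis.orientation_eq_iff_det_pos] at ho ⊢
  rwa [← det_eq_det_quotient L b b' c c' h0 hb hc hc']

/-- A basis of the quotient by a line lifts to a basis, starting with a given vector of the line. -/
theorem exists_basis_cons (hV : Module.finrank ℝ V = n + 1) (L : V →ₗ[ℝ] W) {X : V} (hX : X ≠ 0)
    (hLX : L X = 0) (c : Module.Basis (Fin n) ℝ W) (w : Fin n → V) (hw : ∀ i, L (w i) = c i) :
    ∃ b : Module.Basis (Fin (n + 1)) ℝ V, b 0 = X ∧ ∀ i : Fin n, b i.succ = w i := by
  have hLw : L ∘ w = c := funext hw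
  have hwi : LinearIndependent ℝ w := by
    refine LinearIndependent.of_comp L ?_
    rw [hLw]; exact c.linearIndependent
  have hXs : X ∉ Submodule.span ℝ (Set.range w) := fun h => by
    obtain ⟨a, ha⟩ := (Submodule.mem_span_range_iff_exists_fun ℝ).1 h
    have h1 : ∑ i, a i • c i = 0 := by
      rw [← hLX, ← ha, map_sum]
      exact Finset.sum_congr rfl fun i _ => by rw [map_smul, hw]
    have h2 := Fintype.linearIndependent_iff.1 c.linearIndependent a h1
    exact hX (by rw [← ha]; exact Finset.sum_eq_zero fun i _ => by rw [h2 i, zero_smul])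
  have hli : LinearIndependent ℝ (Fin.cons X w : Fin (n + 1) → V) :=
    linearIndependent_finCons.2 ⟨hwi, hXs⟩
  refine ⟨basisOfLinearIndependentOfCardEqFinrank hli (by simp [hV]), ?_, fun i => ?_⟩
  · simp
  · simp

/-- There is a positive basis of `V` that starts with `X` and induces a basis of the quotient. -/
theorem exists_oriented_basis_cons {n : ℕ} (hV : Module.finrank ℝ V = n + 2)
    (hW : Module.finrank ℝ W = n + 1) (L : V →ₗ[ℝ] W) (hL : Function.Surjective L) {X : V}
    (hX : X ≠ 0) (hLX : L X = 0) (o : Orientation ℝ V (Fin (n + 2))) :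
    ∃ (b : Module.Basis (Fin (n + 2)) ℝ V) (c : Module.Basis (Fin (n + 1)) ℝ W),
      b 0 = X ∧ b.orientation = o ∧ ∀ i, c i = L (b i.succ) := by
  have hWf : Module.Finite ℝ W := Module.finite_of_finrank_pos (by omega)
  let c : Module.Basis (Fin (n + 1)) ℝ W := Module.finBasisOfFinrankEq ℝ W hW
  let c' := c.adjustToOrientation (-c.orientation)
  have hc' : c'.orientation = -c.orientation := c.orientation_adjustToOrientation _
  choose w hw using fun i => hL (c i)
  choose w' hw' using fun i => hL (c' i)
  obtain ⟨b, hb0, hb⟩ := exists_basis_cons hV L hX hLX c w hw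
  obtain ⟨b', hb0', hb'⟩ := exists_basis_cons hV L hX hLX c' w' hw'
  have hcb : ∀ i, c i = L (b i.succ) := fun i => by rw [hb, hw]
  have hcb' : ∀ i, c' i = L (b' i.succ) := fun i => by rw [hb', hw']
  by_cases h : b.orientation = o
  · exact ⟨b, c, hb0, h, hcb⟩
  · refine ⟨b', c', hb0', ?_, hcb'⟩
    -- the lifts of two bases of opposite orientations have opposite orientations
    have h1 : b.orientation ≠ b'.orientation := fun h1 => by
      have h2 := orientation_quotient_eq L b b' c c' (by rw [hb0, hb0']) (by rw [hb0, hLX]) hcb hcb' h1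
      rw [hc'] at h2
      exact (Module.Ray.ne_neg_self _) h2
    have h2 := (b.orientation_ne_iff_eq_neg o).1 (Ne.symm h)
    have h3 := (b.orientation_ne_iff_eq_neg b'.orientation).1 (Ne.symm h1)
    rw [h2, h3]

end LinearOrientation

/-! ### Orientations of manifolds -/

section ManifoldOrientation

variable {n : ℕ} {M : Type*} [TopologicalSpace M] [ChartedSpace (Euc n) M]
  [IsManifold (𝓡 n) ∞ M]

omit [IsManifold (𝓡 n) ∞ M] in
instance finiteDimensional_tangentSpace (p : M) : FiniteDimensional ℝ (TangentSpace (𝓡 n) p) :=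
  inferInstanceAs (FiniteDimensional ℝ (Euc n))

omit [IsManifold (𝓡 n) ∞ M] in
instance t2Space_tangentSpace (p : M) : T2Space (TangentSpace (𝓡 n) p) :=
  inferInstanceAs (T2Space (Euc n))

omit [IsManifold (𝓡 n) ∞ M] in
theorem finrank_tangentSpace (p : M) : Module.finrank ℝ (TangentSpace (𝓡 n) p) = n :=
  finrank_euclideanSpace_fin (𝕜 := ℝ)

/-- A continuous family of bases of the tangent spaces which is positive at a point is positive
nearby. The family is given by its vectors `v`, which may fail to be a basis away from `y₀`. -/
theorem MOrientation.eventually_orientation_eq (o : MOrientation n M) {Y : Type*}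
    [TopologicalSpace Y] {c : Y → M} {y₀ : Y} (hc : ContinuousAt c y₀)
    (v : ∀ y, Fin n → TangentSpace (𝓡 n) (c y))
    (hv : ∀ i, ContinuousAt (fun y => (⟨c y, v y i⟩ : TangentBundle (𝓡 n) M)) y₀)
    (B₀ : Module.Basis (Fin n) ℝ (TangentSpace (𝓡 n) (c y₀))) (hB₀ : ∀ i, B₀ i = v y₀ i)
    (ho : B₀.orientation = o.at_ (c y₀)) :
    ∀ᶠ y in 𝓝 y₀, ∀ B : Module.Basis (Fin n) ℝ (TangentSpace (𝓡 n) (c y)),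
      (∀ i, B i = v y i) → B.orientation = o.at_ (c y) := by
  obtain ⟨o₀, h₀⟩ := o.locallyConstant (c y₀)
  set T := trivializationAt (Euc n) (TangentSpace (𝓡 n) : M → Type _) (c y₀) with hT
  have hmem : c y₀ ∈ T.baseSet := mem_baseSet_trivializationAt _ _ _
  let A := T.continuousLinearEquivAt ℝ (c y₀) hmem
  have hu : ∀ i, ContinuousAt (fun y => (T ⟨c y, v y i⟩).2) y₀ := fun i => by
    have h1 : ContinuousAt T (⟨c y₀, v y₀ i⟩ : TangentBundle (𝓡 n) M) :=
      T.continuousAt (T.mem_source.2 hmem)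
    exact continuous_snd.continuousAt.comp
      (ContinuousAt.comp (f := fun y => (⟨c y, v y i⟩ : TangentBundle (𝓡 n) M)) h1 (hv i))
  let D : Module.Basis (Fin n) ℝ (Euc n) := B₀.map A.toLinearEquiv
  have hD : ∀ i, D i = (T ⟨c y₀, v y₀ i⟩).2 := fun i => by
    rw [← hB₀]; rfl
  have hdet : ContinuousAt (fun y => D.det fun i => (T ⟨c y, v y i⟩).2) y₀ := by
    have h1 : Continuous fun u : Fin n → Euc n => D.det u := by
      simp only [Module.Basis.det_apply]
      refine Continuous.matrix_det (continuous_matrix fun i j => ?_)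
      exact (D.coord i).continuous_of_finiteDimensional.comp (continuous_apply j)
    exact h1.continuousAt.comp (continuousAt_pi.2 hu)
  have hpos : ∀ᶠ y in 𝓝 y₀, 0 < D.det fun i => (T ⟨c y, v y i⟩).2 := by
    refine hdet.eventually (lt_mem_nhds ?_)
    have : (fun i => (T ⟨c y₀, v y₀ i⟩).2) = D := funext fun i => (hD i).symm
    change 0 < D.det fun i => (T ⟨c y₀, v y₀ i⟩).2
    rw [this, D.det_self]; exact one_pos
  have hD0 : D.orientation = o₀ := by
    rw [Module.Basis.orientation_map, ho]
    exact h₀.self_of_nhds hmem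
  filter_upwards [hpos, hc.eventually h₀, hc.eventually (T.open_baseSet.mem_nhds hmem)]
    with y h1 h2 h3 B hB
  let A' := T.continuousLinearEquivAt ℝ (c y) h3
  have h4 : (B.map A'.toLinearEquiv).orientation = D.orientation := by
    symm
    rw [Module.Basis.orientation_eq_iff_det_pos]
    have : ⇑(B.map A'.toLinearEquiv) = fun i => (T ⟨c y, v y i⟩).2 := funext fun i => by
      rw [← hB]; rfl
    rw [this]; exact h1
  rw [hD0, ← h2 h3, Module.Basis.orientation_map] at h4
  exact (Orientation.map (Fin n) A'.toLinearEquiv).injective h4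

end ManifoldOrientation

/-! ### Invariance of the orientation and of the metric -/

section Invariance

variable {M : Type*} [TopologicalSpace M] [ChartedSpace (Euc 8) M] [IsManifold (𝓡 8) ∞ M]
  [MulAction Circle M] [ContMDiffSMul (𝓡 1) (𝓡 8) ∞ Circle M]

omit [IsManifold (𝓡 8) ∞ M] in
theorem mfderiv_smul_mul (z z' : Circle) (p : M) (v : TangentSpace (𝓡 8) p) :
    (mfderiv (𝓡 8) (𝓡 8) (fun p : M => (z' * z) • p) p v : Euc 8) =
      mfderiv (𝓡 8) (𝓡 8) (fun p : M => z' • p) (z • p)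
        (mfderiv (𝓡 8) (𝓡 8) (fun p : M => z • p) p v) := by
  have h1 : (fun p : M => (z' * z) • p) = (fun p : M => z' • p) ∘ fun p : M => z • p :=
    funext fun p => mul_smul _ _ _
  rw [h1, mfderiv_comp (I' := 𝓡 8) p (mdifferentiableAt_smul z' _) (mdifferentiableAt_smul z p)]
  rfl

omit [IsManifold (𝓡 8) ∞ M] [ContMDiffSMul (𝓡 1) (𝓡 8) ∞ Circle M] in
theorem mfderiv_one_smul {z : Circle} (hz : z = 1) (p : M) (v : TangentSpace (𝓡 8) p) :
    (mfderiv (𝓡 8) (𝓡 8) (fun p : M => z • p) p v : Euc 8) = v := by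
  have h1 : (fun p : M => z • p) = id := funext fun p => by rw [hz, one_smul, id]
  rw [h1, mfderiv_id]
  rfl

/-- The differential of the action of `z` as a linear equivalence. -/
def smulEquiv (z : Circle) (p : M) : TangentSpace (𝓡 8) p ≃L[ℝ] TangentSpace (𝓡 8) (z • p) :=
  ContinuousLinearEquiv.equivOfInverse (mfderiv (𝓡 8) (𝓡 8) (fun p : M => z • p) p)
    (mfderiv (𝓡 8) (𝓡 8) (fun p : M => z⁻¹ • p) (z • p) :)
    (fun v => (mfderiv_smul_mul z z⁻¹ p v).symm.trans (mfderiv_one_smul (inv_mul_cancel z) p v))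
    (fun v => by
      have h := (mfderiv_smul_mul z⁻¹ z (z • p) v).symm.trans
        (mfderiv_one_smul (mul_inv_cancel z) (z • p) v)
      exact (mfderiv_congr_point (fun p : M => z • p) (inv_smul_smul z p).symm _).trans h)

theorem continuous_mfderiv_smul (p : M) (v : TangentSpace (𝓡 8) p) :
    Continuous fun t : ℝ => (⟨Circle.exp t • p,
      mfderiv (𝓡 8) (𝓡 8) (fun p : M => Circle.exp t • p) p v⟩ : TangentBundle (𝓡 8) M) := by
  have hI : IsManifold (𝓡 8) 1 M := IsManifold.of_le (n := ∞) (by norm_num)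
  have h1 : ContMDiff 𝓘(ℝ, ℝ) (𝓘(ℝ, ℝ).tangent.prod (𝓡 8).tangent) ∞ fun t : ℝ =>
      ((⟨t, (0 : ℝ)⟩ : TangentBundle 𝓘(ℝ, ℝ) ℝ), (⟨p, v⟩ : TangentBundle (𝓡 8) M)) :=
    ContMDiff.prodMk (Bundle.contMDiff_zeroSection ℝ (TangentSpace 𝓘(ℝ, ℝ) : ℝ → Type _))
      contMDiff_const
  have h2 : ContMDiff (𝓘(ℝ, ℝ).prod (𝓡 8)).tangent (𝓡 8).tangent ∞
      (tangentMap (𝓘(ℝ, ℝ).prod (𝓡 8)) (𝓡 8) fun x : ℝ × M => Circle.exp x.1 • x.2) :=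
    contMDiff_action.contMDiff_tangentMap le_rfl
  have h3 := h2.comp ((contMDiff_equivTangentBundleProd_symm (n := ∞) (I := 𝓘(ℝ, ℝ)) (M := ℝ)
    (I' := 𝓡 8) (M' := M)).comp h1)
  convert h3.continuous using 1
  funext t
  have h4 := mfderiv_comp (I := 𝓡 8) (I' := 𝓘(ℝ, ℝ).prod (𝓡 8)) (I'' := 𝓡 8) p
    (f := fun q : M => (t, q)) (g := fun x : ℝ × M => Circle.exp x.1 • x.2)
    ((contMDiff_action (t, p)).mdifferentiableAt (by simp))
    (mdifferentiableAt_const.prodMk mdifferentiableAt_id)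
  rw [mfderiv_prod_right] at h4
  exact congrArg (TotalSpace.mk (Circle.exp t • p)) (DFunLike.congr_fun h4 v)

theorem orientation_eq_neg_comm {V ι : Type*} [AddCommGroup V] [Module ℝ V]
    (x y : Orientation ℝ V ι) : x = -y ↔ -x = y :=
  ⟨fun h => h ▸ @neg_neg (Module.Ray ℝ (V [⋀^ι]→ₗ[ℝ] ℝ)) _ y,
    fun h => h ▸ (@neg_neg (Module.Ray ℝ (V [⋀^ι]→ₗ[ℝ] ℝ)) _ x).symm⟩

omit [MulAction Circle M] [ContMDiffSMul (𝓡 1) (𝓡 8) ∞ Circle M] in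
theorem map_orientation_of_eq (o : MOrientation 8 M) {p q : M} (h : p = q)
    (e : TangentSpace (𝓡 8) p ≃L[ℝ] TangentSpace (𝓡 8) q) (he : ∀ v, (e v : Euc 8) = v) :
    Orientation.map (Fin 8) e.toLinearEquiv (o.at_ p) = o.at_ q := by
  subst h
  have : e.toLinearEquiv = LinearEquiv.refl ℝ _ := LinearEquiv.ext he
  rw [this, Orientation.map_refl]
  rfl

/-- The action preserves the orientation, since the times at which a given basis is moved to a positive
one form an open and closed set. -/
theorem map_smulEquiv_orientation (o : MOrientation 8 M) (z : Circle) (p : M) :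
    Orientation.map (Fin 8) (smulEquiv z p).toLinearEquiv (o.at_ p) = o.at_ (z • p) := by
  -- the set of times at which the moved basis `B` is positive
  let S : Module.Basis (Fin 8) ℝ (TangentSpace (𝓡 8) p) → Set ℝ := fun B =>
    {t | (B.map (smulEquiv (Circle.exp t) p).toLinearEquiv).orientation = o.at_ (Circle.exp t • p)}
  have hopen : ∀ B, IsOpen (S B) := fun B => isOpen_iff_mem_nhds.2 fun t ht => by
    filter_upwards [o.eventually_orientation_eq (contMDiff_orbit p).continuous.continuousAt
      (fun t i => mfderiv (𝓡 8) (𝓡 8) (fun p : M => Circle.exp t • p) p (B i))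
      (fun i => (continuous_mfderiv_smul p (B i)).continuousAt) _ (fun i => rfl) ht] with s hs
    exact hs _ fun i => rfl
  let B₁ : Module.Basis (Fin 8) ℝ (TangentSpace (𝓡 8) p) :=
    (EuclideanSpace.basisFun (Fin 8) ℝ).toBasis
  let B := B₁.adjustToOrientation (o.at_ p)
  let B' := B₁.adjustToOrientation (-o.at_ p)
  have hB : B.orientation = o.at_ p := B₁.orientation_adjustToOrientation _
  have hB' : B'.orientation = -o.at_ p := B₁.orientation_adjustToOrientation _
  have hcompl : (S B)ᶜ = S B' := by
    ext t
    simp only [S, Set.mem_compl_iff, Set.mem_ofPred_eq, Module.Basis.orientation_map, hB', hB,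
      Orientation.map_neg]
    rw [← ne_eq, Orientation.ne_iff_eq_neg _ _ (by rw [Fintype.card_fin, finrank_tangentSpace])]
    exact orientation_eq_neg_comm _ _
  have huniv : S B = Set.univ := by
    refine IsClopen.eq_univ ⟨⟨hcompl ▸ hopen B'⟩, hopen B⟩ ⟨0, ?_⟩
    have h0 : Circle.exp 0 = 1 := Circle.exp_zero
    rw [Set.mem_ofPred_eq, Module.Basis.orientation_map, hB]
    exact map_orientation_of_eq o (by rw [h0, one_smul]) _ fun v => mfderiv_one_smul h0 p v
  obtain ⟨t, rfl⟩ := Circle.exp_surjective z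
  have h : t ∈ S B := huniv ▸ Set.mem_univ t
  rw [← h, Module.Basis.orientation_map, hB]

/-- The action preserves the metric, because it preserves `Ω` and the stabilizer of `Omega0` consists of
orthogonal maps. -/
theorem metric_smul {o : MOrientation 8 M} {g : RMetric 8 M} {Ω : DForm 8 4 M}
    (hadm : ∀ p : M, IsAdmissibleWithMetric (o.at_ p) (Ω p) (g.inner p))
    (hinv : ∀ z : Circle, DForm.pullback (fun p : M => z • p) Ω = Ω) (z : Circle) (p : M)
    (a b : TangentSpace (𝓡 8) p) :
    g.inner (z • p) (smulEquiv z p a) (smulEquiv z p b) = g.inner p a b := by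
  obtain ⟨f, -, hf, hfg⟩ := hadm p
  obtain ⟨f', -, hf', hfg'⟩ := hadm (z • p)
  let A : Euc 8 ≃ₗ[ℝ] Euc 8 :=
    f.toLinearEquiv.symm.trans ((smulEquiv z p).toLinearEquiv.trans f'.toLinearEquiv)
  have hA : ∀ v, A (f v) = f' (smulEquiv z p v) := fun v => by
    change f' (smulEquiv z p (f.symm (f v))) = _
    rw [f.symm_apply_apply]
  have hinv' : ∀ w : Fin 4 → TangentSpace (𝓡 8) p,
      Ω (z • p) (fun i => smulEquiv z p (w i)) = Ω p w := fun w =>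
    DFunLike.congr_fun (congrFun (hinv z) p) w
  have hAO : ∀ a b c d, Omega0 ![A a, A b, A c, A d] = Omega0 ![a, b, c, d] := fun a b c d => by
    have h := hinv' ![f.symm a, f.symm b, f.symm c, f.symm d]
    rw [hf, hf'] at h
    generalize Omega0 = η at h ⊢
    rw [← f.apply_symm_apply a, ← f.apply_symm_apply b, ← f.apply_symm_apply c,
      ← f.apply_symm_apply d, hA, hA, hA, hA]
    refine Eq.trans (congrArg η ?_) (h.trans (congrArg η ?_))
    · exact (vec_four_map (fun v => f' (smulEquiv z p v)) _ _ _ _).symm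
    · exact vec_four_map f _ _ _ _
  have h := inner_map_of_fixes_Omega0 A hAO (f a) (f b)
  rw [hfg, hfg', ← hA, ← hA, h]

end Invariance

section Projection

variable {M : Type*} [TopologicalSpace M] [ChartedSpace (Euc 8) M]
  [MulAction Circle M] [ContMDiffSMul (𝓡 1) (𝓡 8) ∞ Circle M]
  [ChartedSpace (Euc 7) (OrbitSpace M)] [IsManifold (𝓡 7) ∞ (OrbitSpace M)]

/-! ### The differential of the projection -/

omit [IsManifold (𝓡 7) ∞ (OrbitSpace M)] in
theorem mfderiv_proj_smulEquiv (hsub : Manifold.IsSubmersion (𝓡 8) (𝓡 7) ∞ (proj M))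
    (z : Circle) (p : M) (v : TangentSpace (𝓡 8) p) :
    (mfderiv (𝓡 8) (𝓡 7) (proj M) (z • p) (smulEquiv z p v) : Euc 7) =
      mfderiv (𝓡 8) (𝓡 7) (proj M) p v := by
  have h1 : proj M ∘ (fun p : M => z • p) = proj M := funext fun p => proj_smul z p
  have h2 := mfderiv_comp (I' := 𝓡 8) (I'' := 𝓡 7) p
    ((hsub.contMDiff (z • p)).mdifferentiableAt (by simp)) (mdifferentiableAt_smul z p)
  rw [h1] at h2
  exact (DFunLike.congr_fun h2 v).symm

omit [IsManifold (𝓡 7) ∞ (OrbitSpace M)] in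
theorem mfderiv_proj_generator (hsub : Manifold.IsSubmersion (𝓡 8) (𝓡 7) ∞ (proj M)) (p : M) :
    mfderiv (𝓡 8) (𝓡 7) (proj M) p (generator p) = 0 := by
  have h1 : proj M ∘ (fun t : ℝ => Circle.exp t • p) = fun _ => proj M p :=
    funext fun t => proj_smul _ p
  have h2 := mfderiv_comp (I := 𝓘(ℝ, ℝ)) (I' := 𝓡 8) (I'' := 𝓡 7) (0 : ℝ)
    ((hsub.contMDiff (Circle.exp 0 • p)).mdifferentiableAt (by simp)) (mdifferentiableAt_orbit p 0)
  rw [h1, mfderiv_const] at h2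
  have h0 : Circle.exp 0 • p = p := by rw [Circle.exp_zero, one_smul]
  exact (mfderiv_congr_point (proj M) h0 _).symm.trans (DFunLike.congr_fun h2 (1 : ℝ)).symm

/-- The kernel of the differential of the projection is the line of the generator: it contains the
generator and has dimension `8 - 7`. -/
theorem eq_smul_generator_of_mfderiv_proj [IsManifold (𝓡 8) ∞ M]
    (hfree : ∀ (z : Circle) (p : M), z • p = p → z = 1)
    (hsub : Manifold.IsSubmersion (𝓡 8) (𝓡 7) ∞ (proj M)) {p : M} {v : TangentSpace (𝓡 8) p}
    (hv : mfderiv (𝓡 8) (𝓡 7) (proj M) p v = 0) : ∃ a : ℝ, v = a • generator p := by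
  let L : TangentSpace (𝓡 8) p →ₗ[ℝ] TangentSpace (𝓡 7) (proj M p) :=
    (mfderiv (𝓡 8) (𝓡 7) (proj M) p).toLinearMap
  have h1 := LinearMap.finrank_range_add_finrank_ker L
  rw [LinearMap.range_eq_top.2 (mfderiv_surjective_of_isSubmersion hsub p), finrank_top,
    finrank_tangentSpace, finrank_tangentSpace] at h1
  have h2 : Module.finrank ℝ (LinearMap.ker L) = 1 := by omega
  have hX : generator p ∈ LinearMap.ker L := mfderiv_proj_generator hsub p
  obtain ⟨a, ha⟩ := (finrank_eq_one_iff_of_nonzero' (⟨generator p, hX⟩ : LinearMap.ker L)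
    (fun h => generator_ne_zero hfree p (congrArg Subtype.val h))).1 h2 ⟨v, hv⟩
  exact ⟨a, (congrArg Subtype.val ha).symm⟩

/-- Vectors with the same image in the orbit space differ by the action and a multiple of the
generator. -/
theorem exists_smulEquiv_add_smul [IsManifold (𝓡 8) ∞ M]
    (hfree : ∀ (z : Circle) (p : M), z • p = p → z = 1)
    (hsub : Manifold.IsSubmersion (𝓡 8) (𝓡 7) ∞ (proj M)) (z : Circle) (p : M)
    (v : TangentSpace (𝓡 8) p) (v' : TangentSpace (𝓡 8) (z • p))
    (h : (mfderiv (𝓡 8) (𝓡 7) (proj M) p v : Euc 7) =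
      mfderiv (𝓡 8) (𝓡 7) (proj M) (z • p) v') :
    ∃ a : ℝ, v' = smulEquiv z p v + a • generator (z • p) := by
  obtain ⟨a, ha⟩ := eq_smul_generator_of_mfderiv_proj hfree hsub
    (p := z • p) (v := v' - smulEquiv z p v) (by
      rw [map_sub, sub_eq_zero]
      exact (h.symm.trans (mfderiv_proj_smulEquiv hsub z p v).symm))
  exact ⟨a, by rw [← ha]; abel⟩

omit [ChartedSpace (Euc 7) (OrbitSpace M)] [IsManifold (𝓡 7) ∞ (OrbitSpace M)] in
theorem smulEquiv_generator (z : Circle) (p : M) :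
    smulEquiv z p (generator p) = generator (z • p) := mfderiv_smul_generator z p

theorem contMDiff_const_vectorField {n : ℕ} (a : Euc n) :
    ContMDiff 𝓘(ℝ, Euc n) 𝓘(ℝ, Euc n).tangent ∞
      (fun y : Euc n => (⟨y, a⟩ : TangentBundle 𝓘(ℝ, Euc n) (Euc n))) :=
  contMDiff_vectorSpace_iff_contDiff.2 contDiff_const

theorem trivializationAt_symm_apply {n : ℕ} {N : Type*} [TopologicalSpace N]
    [ChartedSpace (Euc n) N] [IsManifold (𝓡 n) ∞ N] {x₀ x : N}
    (hx : x ∈ (trivializationAt (Euc n) (TangentSpace (𝓡 n) : N → Type _) x₀).baseSet) {y : Euc n}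
    (hy : extChartAt (𝓡 n) x₀ x = y) (w : Euc n) :
    (((trivializationAt (Euc n) (TangentSpace (𝓡 n) : N → Type _) x₀).continuousLinearEquivAt
      ℝ x hx).symm w : Euc n) = mfderiv 𝓘(ℝ, Euc n) (𝓡 n) (extChartAt (𝓡 n) x₀).symm y w := by
  have hx' : x ∈ (chartAt (Euc n) x₀).source := by
    rwa [TangentBundle.trivializationAt_baseSet] at hx
  have hx'' : x ∈ (extChartAt (𝓡 n) x₀).source := by rwa [extChartAt_source]
  subst hy
  refine (ContinuousLinearEquiv.symm_apply_eq _).2 ?_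
  refine Eq.trans ?_ (trivializationAt_snd hx' _).symm
  refine (mfderiv_extChartAt_comp_symm ((extChartAt (𝓡 n) x₀).map_source hx'') w).symm.trans ?_
  exact mfderiv_congr_point (extChartAt (𝓡 n) x₀) ((extChartAt (𝓡 n) x₀).left_inv hx'') _

/-! ### The orientation of the orbit space -/

variable [IsManifold (𝓡 8) ∞ M]

/-- The orientation that the positive bases of `T_p M` starting with the generator induce on the tangent
space at a point `q` of the orbit space depends neither on the basis nor on the point `p` over `q`. -/
theorem exists_pointwise_orientation (hfree : ∀ (z : Circle) (p : M), z • p = p → z = 1)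
    (hsub : Manifold.IsSubmersion (𝓡 8) (𝓡 7) ∞ (proj M)) (o : MOrientation 8 M)
    (q : OrbitSpace M) : ∃ x : Orientation ℝ (TangentSpace (𝓡 7) q) (Fin 7),
      ∀ p : M, proj M p = q → ∀ (b : Module.Basis (Fin 8) ℝ (TangentSpace (𝓡 8) p))
        (c : Module.Basis (Fin 7) ℝ (TangentSpace (𝓡 7) q)),
        b 0 = generator p → b.orientation = o.at_ p →
        (∀ i : Fin 7, (c i : Euc 7) = mfderiv (𝓡 8) (𝓡 7) (proj M) p (b i.succ)) →
        c.orientation = x := by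
  obtain ⟨p₀, rfl⟩ := proj_surjective q
  obtain ⟨b₀, c₀, hb₀, hbo, hbc⟩ := exists_oriented_basis_cons (n := 6)
    (finrank_tangentSpace p₀) (finrank_tangentSpace (proj M p₀))
    (mfderiv (𝓡 8) (𝓡 7) (proj M) p₀).toLinearMap (mfderiv_surjective_of_isSubmersion hsub p₀)
    (generator_ne_zero hfree p₀) (mfderiv_proj_generator hsub p₀) (o.at_ p₀)
  refine ⟨c₀.orientation, fun p hp b c hb ho hbc' => ?_⟩
  obtain ⟨z, rfl⟩ := exists_smul_eq_of_proj_eq hp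
  let b' := b.map (smulEquiv z p).toLinearEquiv
  have hb' : ∀ i, b' i = smulEquiv z p (b i) := fun i => rfl
  refine orientation_quotient_eq (mfderiv (𝓡 8) (𝓡 7) (proj M) (z • p)).toLinearMap b' b₀ c c₀
    ?_ ?_ (fun i => (hbc' i).trans (mfderiv_proj_smulEquiv hsub z p (b i.succ)).symm) hbc ?_
  · rw [hb₀, hb', hb, smulEquiv_generator]
  · rw [hb', hb, smulEquiv_generator]
    exact mfderiv_proj_generator hsub _
  · rw [hbo, Module.Basis.orientation_map, ho, map_smulEquiv_orientation]

/-- The pointwise orientations of the orbit space are locally constant: near a point, a section of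
the projection together with the generator gives a continuous family of positive bases. -/
theorem exists_isInducedOrientation (hfree : ∀ (z : Circle) (p : M), z • p = p → z = 1)
    (hsub : Manifold.IsSubmersion (𝓡 8) (𝓡 7) ∞ (proj M)) (o : MOrientation 8 M) :
    ∃ o' : MOrientation 7 (OrbitSpace M), IsInducedOrientation o o' := by
  choose x hx using exists_pointwise_orientation hfree hsub o
  refine ⟨⟨x, fun q₀ => ?_⟩, fun p b c hb ho hc => hx _ p rfl b c hb ho hc⟩
  obtain ⟨p₀, hp₀⟩ := proj_surjective q₀
  have hq₀ : q₀ ∈ (chartAt (Euc 7) q₀).source := mem_chart_source _ _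
  obtain ⟨U, s, hU, hyU, hUt, hsp, hs, hps, hds⟩ := exists_chart_section hsub
    (mem_extChartAt_target (I := 𝓡 7) q₀) (p := p₀)
    (hp₀.trans (extChartAt_to_inv (I := 𝓡 7) q₀).symm)
  set y₀ := extChartAt (𝓡 7) q₀ q₀ with hy₀
  have hpq : proj M (s y₀) = q₀ := by rw [hsp, hp₀]
  set T := trivializationAt (Euc 7) (TangentSpace (𝓡 7) : OrbitSpace M → Type _) q₀ with hT
  have hbase : ∀ q, q ∈ T.baseSet ↔ q ∈ (chartAt (Euc 7) q₀).source := fun q => by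
    rw [hT, TangentBundle.trivializationAt_baseSet]
  have hbase₀ : proj M (s y₀) ∈ T.baseSet := (hbase _).2 (by rw [hpq]; exact hq₀)
  obtain ⟨b₀, c₀, hb₀, hbo, hbc⟩ := exists_oriented_basis_cons (n := 6)
    (finrank_tangentSpace (s y₀)) (finrank_tangentSpace (proj M (s y₀)))
    (mfderiv (𝓡 8) (𝓡 7) (proj M) (s y₀)).toLinearMap (mfderiv_surjective_of_isSubmersion hsub _)
    (generator_ne_zero hfree _) (mfderiv_proj_generator hsub _) (o.at_ (s y₀))
  -- the basis of coordinate vectors that corresponds to `c₀`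
  let D : Module.Basis (Fin 7) ℝ (Euc 7) :=
    c₀.map (T.continuousLinearEquivAt ℝ (proj M (s y₀)) hbase₀).toLinearEquiv
  let v : ∀ y, Fin 8 → TangentSpace (𝓡 8) (s y) := fun y =>
    Fin.cons (generator (s y)) fun i => mfderiv 𝓘(ℝ, Euc 7) (𝓡 8) s y (D i)
  have hB : ∀ (y : Euc 7) (q : OrbitSpace M), proj M (s y) = q →
      ∀ c : Module.Basis (Fin 7) ℝ (TangentSpace (𝓡 7) q),
      (∀ i, (c i : Euc 7) = mfderiv (𝓡 8) (𝓡 7) (proj M) (s y)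
        (mfderiv 𝓘(ℝ, Euc 7) (𝓡 8) s y (D i))) →
      ∃ B : Module.Basis (Fin 8) ℝ (TangentSpace (𝓡 8) (s y)), ∀ i, B i = v y i := by
    rintro y _ rfl c hc
    obtain ⟨B, h0, h1⟩ := exists_basis_cons (finrank_tangentSpace (s y))
      (mfderiv (𝓡 8) (𝓡 7) (proj M) (s y)).toLinearMap (generator_ne_zero hfree (s y))
      (mfderiv_proj_generator hsub (s y)) c _ fun i => (hc i).symm
    exact ⟨B, Fin.cases h0 h1⟩
  have hc₀ : ∀ i, (c₀ i : Euc 7) = mfderiv (𝓡 8) (𝓡 7) (proj M) (s y₀)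
      (mfderiv 𝓘(ℝ, Euc 7) (𝓡 8) s y₀ (D i)) := fun i => by
    refine Eq.trans ?_ (hds y₀ hyU (D i)).symm
    rw [← trivializationAt_symm_apply (x := proj M (s y₀)) hbase₀ (by rw [hpq])]
    exact ((T.continuousLinearEquivAt ℝ (proj M (s y₀)) hbase₀).symm_apply_apply (c₀ i)).symm
  obtain ⟨B₀, hB₀⟩ := hB y₀ _ rfl c₀ hc₀
  have hB₀o : B₀.orientation = o.at_ (s y₀) := by
    have hB00 : B₀ 0 = generator (s y₀) := hB₀ 0
    rw [← hbo, eq_comm, Module.Basis.orientation_eq_iff_det_pos,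
      det_eq_det_quotient (mfderiv (𝓡 8) (𝓡 7) (proj M) (s y₀)).toLinearMap b₀ B₀ c₀ c₀
      (hB00.trans hb₀.symm) (by rw [hb₀]; exact mfderiv_proj_generator hsub _) hbc
      (fun i => (hc₀ i).trans (by rw [hB₀]; rfl)), Module.Basis.det_self]
    exact one_pos
  have hsm : ContinuousAt s y₀ := (hs.continuousOn.continuousAt (hU.mem_nhds hyU))
  have hev := o.eventually_orientation_eq hsm v (fun i => by
    refine Fin.cases ?_ (fun j => ?_) i
    · exact ContinuousAt.comp (g := fun p : M => (⟨p, generator p⟩ : TangentBundle (𝓡 8) M))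
        contMDiff_generator.continuous.continuousAt hsm
    · exact (contMDiffAt_mfderiv_apply hU hs hyU (V := fun _ => D j)
        (contMDiff_const_vectorField (D j) y₀)).continuousAt) B₀ hB₀ hB₀o
  refine ⟨D.orientation, ?_⟩
  have hcont : ContinuousAt (extChartAt (𝓡 7) q₀) q₀ := continuousAt_extChartAt q₀
  filter_upwards [hcont.eventually hev, hcont.eventually (hU.mem_nhds hyU),
    (chartAt (Euc 7) q₀).open_source.mem_nhds hq₀] with q h1 h2 h3 hq
  set y := extChartAt (𝓡 7) q₀ q
  have hqy : proj M (s y) = q := by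
    rw [hps y h2]; exact (extChartAt (𝓡 7) q₀).left_inv (by rwa [extChartAt_source])
  let c : Module.Basis (Fin 7) ℝ (TangentSpace (𝓡 7) q) :=
    D.map (T.continuousLinearEquivAt ℝ q hq).symm.toLinearEquiv
  have hc : ∀ i, (c i : Euc 7) = mfderiv (𝓡 8) (𝓡 7) (proj M) (s y)
      (mfderiv 𝓘(ℝ, Euc 7) (𝓡 8) s y (D i)) := fun i =>
    (trivializationAt_symm_apply hq rfl (D i)).trans (hds y h2 (D i)).symm
  obtain ⟨B, hBv⟩ := hB y q hqy c hc
  have hco := hx q (s y) hqy B c (hBv 0) (h1 B hBv) fun i => (hc i).trans (by rw [hBv]; rfl)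
  rw [← hco, ← Module.Basis.orientation_map]
  congr 1
  ext i : 1
  exact (T.continuousLinearEquivAt ℝ q hq).apply_symm_apply (D i)

theorem isInducedOrientation_unique (hfree : ∀ (z : Circle) (p : M), z • p = p → z = 1)
    (hsub : Manifold.IsSubmersion (𝓡 8) (𝓡 7) ∞ (proj M)) {o : MOrientation 8 M}
    {o₁ o₂ : MOrientation 7 (OrbitSpace M)} (h₁ : IsInducedOrientation o o₁)
    (h₂ : IsInducedOrientation o o₂) : o₁ = o₂ := by
  refine MOrientation.ext (funext fun q => ?_)
  obtain ⟨p, rfl⟩ := proj_surjective q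
  obtain ⟨b, c, hb, hbo, hbc⟩ := exists_oriented_basis_cons (n := 6)
    (finrank_tangentSpace p) (finrank_tangentSpace (proj M p))
    (mfderiv (𝓡 8) (𝓡 7) (proj M) p).toLinearMap (mfderiv_surjective_of_isSubmersion hsub p)
    (generator_ne_zero hfree p) (mfderiv_proj_generator hsub p) (o.at_ p)
  rw [← h₁ p b c hb hbo hbc, ← h₂ p b c hb hbo hbc]

end Projection

/-! ### The linear model of the quotient -/

section LinearQuotient

/-- An alternating map that vanishes as soon as one argument is `v` is invariant under adding multiples
of `v` to its arguments. -/
theorem alternatingMap_add_smul {V : Type*} [AddCommGroup V] [Module ℝ V] {k : ℕ}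
    (α : V [⋀^Fin k]→ₗ[ℝ] ℝ) {v : V} (hα : ∀ w i, α (Function.update w i v) = 0) (w : Fin k → V)
    (a : Fin k → ℝ) : α (fun i => w i + a i • v) = α w := by
  suffices h : ∀ s : Finset (Fin k), α (s.piecewise (fun i => w i + a i • v) w) = α w by
    simpa using h Finset.univ
  intro s
  induction s using Finset.induction with
  | empty => simp
  | insert i s hi ih =>
    have h1 : Function.update (s.piecewise (fun i => w i + a i • v) w) i (w i) =
        s.piecewise (fun i => w i + a i • v) w := by
      rw [Function.update_eq_self_iff, Finset.piecewise_eq_of_notMem _ _ _ hi]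
    rw [Finset.piecewise_insert, α.map_update_add, α.map_update_smul, hα, h1, ih, smul_zero,
      add_zero]

variable {V : Type*} [AddCommGroup V] [Module ℝ V] [TopologicalSpace V]

theorem contract_add_smul {k : ℕ} (v : V) (η : V [⋀^Fin (k + 1)]→L[ℝ] ℝ) (w : Fin k → V)
    (a : Fin k → ℝ) : contract v η (fun i => w i + a i • v) = contract v η w := by
  refine alternatingMap_add_smul (contract v η).toAlternatingMap (fun w i => ?_) w a
  change contract v η _ = 0
  rw [contract_apply]
  refine η.map_eq_zero_of_eq _ (i := 0) (j := i.succ) ?_ (Fin.succ_ne_zero i).symm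
  simp

theorem contract_smul_apply {k : ℕ} (r : ℝ) (v : V) (η : V [⋀^Fin (k + 1)]→L[ℝ] ℝ)
    (w : Fin k → V) : contract (r • v) η w = r * η (Matrix.vecCons v w) := by
  rw [contract_apply]
  have h := η.toAlternatingMap.map_update_smul (Matrix.vecCons v w) 0 r v
  rw [Matrix.vecCons, Fin.update_cons_zero, Fin.update_cons_zero] at h
  exact h

/-- `ι_v Ω` already annihilates `v`, so it is its own extension from `v^⊥`. -/
theorem contractExtended_eq_contract [IsTopologicalAddGroup V] [ContinuousSMul ℝ V]
    (B : V →L[ℝ] V →L[ℝ] ℝ) (v : V) (Ω : V [⋀^Fin 4]→L[ℝ] ℝ) :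
    contractExtended B v Ω = contract v Ω := by
  ext w
  refine Eq.trans (congrArg (contract v Ω) ?_)
    (contract_add_smul v Ω w fun i => -((B v v)⁻¹ * B v (w i)))
  funext i
  change orthProj B v (w i) = _
  simp [orthProj, sub_eq_add_neg]

theorem orientation_map_trans {V₁ V₂ V₃ ι : Type*} [AddCommGroup V₁] [Module ℝ V₁]
    [AddCommGroup V₂] [Module ℝ V₂] [AddCommGroup V₃] [Module ℝ V₃] (e : V₁ ≃ₗ[ℝ] V₂)
    (e' : V₂ ≃ₗ[ℝ] V₃) (o : Orientation ℝ V₁ ι) :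
    Orientation.map ι (e.trans e') o = Orientation.map ι e' (Orientation.map ι e o) := by
  induction o using Module.Ray.ind with
  | h v hv => rfl

/-- The isomorphism with `ℝ⁸` that exhibits an admissible form can be chosen to send a given vector
to a positive multiple of the first basis vector. -/
theorem IsAdmissibleWithMetric.exists_adapted {o : Orientation ℝ V (Fin 8)}
    {Ω : V [⋀^Fin 4]→L[ℝ] ℝ} {B : V →L[ℝ] V →L[ℝ] ℝ} (h : IsAdmissibleWithMetric o Ω B) {v : V}
    (hv : v ≠ 0) :
    ∃ f : V ≃L[ℝ] Euc 8, IsOriented o f ∧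
      Ω = Omega0.compContinuousLinearMap (f : V →L[ℝ] Euc 8) ∧
      (∀ a b, B a b = inner ℝ (f a) (f b)) ∧ f v = Real.sqrt (B v v) • stdB 8 0 := by
  obtain ⟨f, hfo, hfΩ, hfB⟩ := h
  have hfv : f v ≠ 0 := fun h => hv (f.map_eq_zero_iff.1 h)
  obtain ⟨R, hR, hRΩ, hRdet, hRv⟩ := exists_rotation_fixing_Omega0 (f v) hfv
  refine ⟨f.trans R.toContinuousLinearEquiv, ?_, ?_, fun a b => ?_, ?_⟩
  · unfold IsOriented at hfo ⊢
    change Orientation.map (Fin 8) (f.toLinearEquiv.trans R) o = _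
    rw [orientation_map_trans, hfo, Orientation.map_eq_iff_det_pos _ _ (by simp)]
    exact hRdet
  · rw [hfΩ]
    ext w
    generalize Omega0 = η at hRΩ ⊢
    change η (fun i => f (w i)) = η (fun i => R (f (w i)))
    rw [eq_vec_four w, vec_four_map f, vec_four_map fun x => R (f x), hRΩ]
  · rw [hfB, ← hR]; rfl
  · rw [hfB, real_inner_self_eq_norm_sq, Real.sqrt_sq (norm_nonneg _)]
    exact hRv

theorem tail_stdB_zero : tail (stdB 8 0) = 0 := by
  ext i; rw [tail_apply]; simp

theorem tail_stdB_succ (i : Fin 7) : tail (stdB 8 i.succ) = stdB 7 i := by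
  ext j; rw [tail_apply]; simp

theorem tail_surjective : Function.Surjective tail := fun u =>
  ⟨WithLp.toLp 2 (Fin.cons 0 u), by ext i; rw [tail_apply]; simp⟩

theorem eq_smul_of_tail_eq_zero {a : Euc 8} (h : tail a = 0) : a = a 0 • stdB 8 0 := by
  ext i
  refine Fin.cases (by simp) (fun j => ?_) i
  rw [← tail_apply, h]; simp

variable {W : Type*} [AddCommGroup W] [Module ℝ W] [TopologicalSpace W] [IsTopologicalAddGroup W]
  [ContinuousSMul ℝ W] [T2Space W] [FiniteDimensional ℝ W]

/-- An isomorphism `V ≃ ℝ⁸` that sends a generator of the kernel of `L : V → W` to the first axis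
descends to an isomorphism `W ≃ ℝ⁷`. -/
theorem exists_quotient_equiv (L : V →L[ℝ] W) (hL : Function.Surjective L) {X : V}
    (hker : ∀ v, L v = 0 → ∃ a : ℝ, v = a • X) (hLX : L X = 0) (f : V ≃L[ℝ] Euc 8) {r : ℝ}
    (hr : r ≠ 0) (hfX : f X = r • stdB 8 0) :
    ∃ F : W ≃L[ℝ] Euc 7, ∀ v, F (L v) = tail (f v) := by
  obtain ⟨R, hR⟩ := LinearMap.exists_rightInverse_of_surjective L.toLinearMap
    (LinearMap.range_eq_top.2 hL)
  have hR' : ∀ w, L (R w) = w := fun w => DFunLike.congr_fun hR w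
  let F₀ : W →ₗ[ℝ] Euc 7 := tail.toLinearMap ∘ₗ f.toLinearEquiv.toLinearMap ∘ₗ R
  have hF₀ : ∀ v, F₀ (L v) = tail (f v) := fun v => by
    obtain ⟨a, ha⟩ := hker (R (L v) - v) (by rw [map_sub, hR', sub_self])
    change tail (f (R (L v))) = tail (f v)
    rw [← sub_eq_zero, ← map_sub, ← map_sub, ha, map_smul, hfX, map_smul, map_smul,
      tail_stdB_zero, smul_zero, smul_zero]
  have hbij : Function.Bijective F₀ := by
    refine ⟨(injective_iff_map_eq_zero F₀).2 fun w hw => ?_, fun u => ?_⟩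
    · obtain ⟨v, rfl⟩ := hL w
      rw [hF₀] at hw
      have h1 := eq_smul_of_tail_eq_zero hw
      have h2 : v = (f v 0 * r⁻¹) • X := f.injective (by
        rw [map_smul, hfX, smul_smul, mul_assoc, inv_mul_cancel₀ hr, mul_one]; exact h1)
      rw [h2, map_smul, hLX, smul_zero]
    · obtain ⟨a, rfl⟩ := tail_surjective u
      exact ⟨L (f.symm a), by rw [hF₀, f.apply_symm_apply]⟩
  exact ⟨(LinearEquiv.ofBijective F₀ hbij).toContinuousLinearEquiv, hF₀⟩

omit [T2Space W] [FiniteDimensional ℝ W] [IsTopologicalAddGroup W] [ContinuousSMul ℝ W] in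
/-- The descended isomorphism is oriented if `W` carries the orientation induced from `V`. -/
theorem isOriented_quotient (L : V →L[ℝ] W) {X : V} (hLX : L X = 0) (f : V ≃L[ℝ] Euc 8) {r : ℝ}
    (hr : 0 < r) (hfX : f X = r • stdB 8 0) (F : W ≃L[ℝ] Euc 7) (hF : ∀ v, F (L v) = tail (f v))
    {o : Orientation ℝ V (Fin 8)} {o' : Orientation ℝ W (Fin 7)}
    (ho : ∀ (b : Module.Basis (Fin 8) ℝ V) (c : Module.Basis (Fin 7) ℝ W), b 0 = X →
      b.orientation = o → (∀ i : Fin 7, c i = L (b i.succ)) → c.orientation = o')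
    (hf : IsOriented o f) : IsOriented o' F := by
  let c : Module.Basis (Fin 7) ℝ W := (stdB 7).map F.symm.toLinearEquiv
  have hX : X ≠ 0 := fun h => by
    rw [h, map_zero] at hfX
    exact smul_ne_zero hr.ne' ((stdB 8).ne_zero 0) hfX.symm
  have hLc : ∀ i : Fin 7, L (f.symm (stdB 8 i.succ)) = c i := fun i => F.injective (by
    rw [hF, f.apply_symm_apply, tail_stdB_succ]; exact (F.apply_symm_apply _).symm)
  obtain ⟨b, hb0, hb⟩ := exists_basis_cons (n := 7)
    (by rw [f.toLinearEquiv.finrank_eq, finrank_euclideanSpace_fin]) L.toLinearMap hX hLX c _ hLc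
  have hbf : (b.map f.toLinearEquiv).orientation = (stdB 8).orientation := by
    rw [eq_comm, Module.Basis.orientation_eq_iff_det_pos]
    have : ⇑(b.map f.toLinearEquiv) = Function.update (stdB 8) 0 (r • stdB 8 0) := by
      funext i
      refine Fin.cases ?_ (fun j => ?_) i
      · rw [Function.update_self, Module.Basis.map_apply, hb0]; exact hfX
      · rw [Function.update_of_ne (Fin.succ_ne_zero j), Module.Basis.map_apply, hb]
        exact f.apply_symm_apply _
    rw [this, AlternatingMap.map_update_smul, Function.update_eq_self, Module.Basis.det_self,
      smul_eq_mul, mul_one]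
    exact hr
  have hbo : b.orientation = o := by
    rw [Module.Basis.orientation_map, ← hf] at hbf
    exact (Orientation.map (Fin 8) f.toLinearEquiv).injective hbf
  have hco := ho b c hb0 hbo fun i => by rw [hb, hLc]
  unfold IsOriented
  rw [← hco, ← Module.Basis.orientation_map]
  congr 1
  ext i : 1
  exact F.apply_symm_apply _

omit [T2Space W] [IsTopologicalAddGroup W] [ContinuousSMul ℝ W] [FiniteDimensional ℝ W] in
/-- Positive multiples of positive forms are positive: rescale the isomorphism with `ℝ⁷`. -/
theorem IsPositive.smul {o : Orientation ℝ W (Fin 7)} {φ : W [⋀^Fin 3]→L[ℝ] ℝ}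
    (h : IsPositive o φ) {r : ℝ} (hr : 0 < r) : IsPositive o (r • φ) := by
  obtain ⟨F, hFo, rfl⟩ := h
  set s : ℝ := r ^ (1 / 3 : ℝ)
  have hs : 0 < s := Real.rpow_pos_of_pos hr _
  have hs3 : s ^ 3 = r := by
    rw [← Real.rpow_natCast, ← Real.rpow_mul hr.le]; norm_num
  let S : Euc 7 ≃ₗ[ℝ] Euc 7 := LinearEquiv.smulOfNeZero ℝ (Euc 7) s hs.ne'
  refine ⟨F.trans S.toContinuousLinearEquiv, ?_, ?_⟩
  · unfold IsOriented at hFo ⊢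
    change Orientation.map (Fin 7) (F.toLinearEquiv.trans S) o = _
    rw [orientation_map_trans, hFo, Orientation.map_eq_iff_det_pos _ _ (by simp)]
    have : (S : Euc 7 →ₗ[ℝ] Euc 7) = s • LinearMap.id := rfl
    rw [this, LinearMap.det_smul, LinearMap.det_id, mul_one]
    exact pow_pos hs _
  · ext w
    generalize phi0 = φ
    have h := φ.toAlternatingMap.map_smul_univ (fun _ => s) (fun i => F (w i))
    simp only [Finset.prod_const, Finset.card_univ, Fintype.card_fin, hs3] at h
    exact h.symm

end LinearQuotient

section Descent

variable {M : Type*} [TopologicalSpace M] [ChartedSpace (Euc 8) M] [IsManifold (𝓡 8) ∞ M]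
  [MulAction Circle M] [ContMDiffSMul (𝓡 1) (𝓡 8) ∞ Circle M]

/-! ### Descent of invariant forms -/

omit [ContMDiffSMul (𝓡 1) (𝓡 8) ∞ Circle M] in
theorem contractField_apply (g : RMetric 8 M) (lam : M → ℝ) (Ω : DForm 8 4 M) (p : M)
    (w : Fin 3 → TangentSpace (𝓡 8) p) :
    contractField g (fun p => lam p • generator p) Ω p w =
      lam p * Ω p (Matrix.vecCons (generator p) w) := by
  unfold contractField
  rw [contractExtended_eq_contract, contract_smul_apply]

variable [ChartedSpace (Euc 7) (OrbitSpace M)] [IsManifold (𝓡 7) ∞ (OrbitSpace M)]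

/-- For an invariant function `lam` the form `lam ι_X Ω` is invariant and annihilates `X`, so it descends;
the descended form is smooth because its coefficients can be computed along a section. -/
theorem exists_descended_form (hfree : ∀ (z : Circle) (p : M), z • p = p → z = 1)
    (hsub : Manifold.IsSubmersion (𝓡 8) (𝓡 7) ∞ (proj M)) (g : RMetric 8 M) {Ω : DForm 8 4 M}
    (hΩ : Ω.IsSmooth) (hinv : ∀ z : Circle, DForm.pullback (fun p : M => z • p) Ω = Ω)
    {lam : M → ℝ} (hlam : ContMDiff (𝓡 8) 𝓘(ℝ, ℝ) ∞ lam)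
    (hlam' : ∀ (z : Circle) (p : M), lam (z • p) = lam p) :
    ∃ ψ : DForm 7 3 (OrbitSpace M), ψ.IsSmooth ∧
      DForm.pullback (proj M) ψ = contractField g (fun p => lam p • generator p) Ω := by
  obtain ⟨ψ, hψ⟩ := DForm.exists_pullback_eq hsub proj_surjective
    (contractField g (fun p => lam p • generator p) Ω) fun p p' hp v v' hv => by
      obtain ⟨z, rfl⟩ := exists_smul_eq_of_proj_eq hp
      choose a ha using fun i => exists_smulEquiv_add_smul hfree hsub z p (v i) (v' i) (hv i)
      have h1 : contract (generator (z • p)) (Ω (z • p)) v' =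
          contract (generator (z • p)) (Ω (z • p)) fun i => smulEquiv z p (v i) := by
        rw [← contract_add_smul _ _ _ a]
        exact congrArg _ (funext ha)
      refine (contractField_apply g lam Ω p v).trans
        (Eq.trans ?_ (contractField_apply g lam Ω (z • p) v').symm)
      rw [hlam']
      congr 1
      refine Eq.trans ?_ h1.symm
      rw [contract_apply]
      refine (DFunLike.congr_fun (congrFun (hinv z) p) _).symm.trans (congrArg (Ω (z • p)) ?_)
      funext i
      exact Fin.cases (smulEquiv_generator z p) (fun j => rfl) i
  refine ⟨ψ, fun x₀ y₀ hy₀ => ContDiffAt.contDiffWithinAt (contDiffAt_of_apply fun a => ?_), hψ⟩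
  obtain ⟨p, hp⟩ := proj_surjective ((extChartAt (𝓡 7) x₀).symm y₀)
  obtain ⟨U, s, hU, hyU, -, -, hs, hps, hds⟩ := exists_chart_section hsub hy₀ hp
  have hsm : ContMDiffAt 𝓘(ℝ, Euc 7) (𝓡 8) ∞ s y₀ := hs.contMDiffAt (hU.mem_nhds hyU)
  have hval : (fun y => ψ.inChart x₀ y a) =ᶠ[𝓝 y₀] fun y => lam (s y) * Ω (s y)
      (Matrix.vecCons (generator (s y)) fun i => mfderiv 𝓘(ℝ, Euc 7) (𝓡 8) s y (a i)) := by
    filter_upwards [hU.mem_nhds hyU] with y hy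
    rw [← contractField_apply g, ← hψ]
    exact ψ.congr_point (hps y hy).symm _ _ (funext fun i => (hds y hy (a i)).symm)
  refine ContDiffAt.congr_of_eventuallyEq ?_ hval
  rw [← contMDiffAt_iff_contDiffAt]
  refine ContMDiffAt.mul ((hlam _).comp y₀ hsm)
    (hΩ.contMDiffAt_apply (w := fun i y => (Matrix.vecCons (generator (s y))
      fun i => mfderiv 𝓘(ℝ, Euc 7) (𝓡 8) s y (a i) : Fin 4 → TangentSpace (𝓡 8) (s y)) i) hsm
      fun i => ?_)
  refine Fin.cases ?_ (fun j => ?_) i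
  · exact (contMDiff_generator _).comp y₀ hsm
  · exact contMDiffAt_mfderiv_apply hU hs hyU (contMDiff_const_vectorField (a j) y₀)

/-! ### Positivity and the metric -/

/-- An isomorphism `T_p M ≃ ℝ⁸` adapted to the generator `X` descends to an oriented isomorphism `F` of
the tangent space of the orbit space with `ℝ⁷`. It carries `phi0` to `ι_X Ω / ‖X‖` and the Euclidean
inner product to the restriction of the metric to the complement of `X`. -/
theorem exists_quotient_frame (hfree : ∀ (z : Circle) (p : M), z • p = p → z = 1)
    (hsub : Manifold.IsSubmersion (𝓡 8) (𝓡 7) ∞ (proj M)) {o : MOrientation 8 M}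
    {g : RMetric 8 M} {Ω : DForm 8 4 M}
    (hadm : ∀ p : M, IsAdmissibleWithMetric (o.at_ p) (Ω p) (g.inner p))
    {o' : MOrientation 7 (OrbitSpace M)} (ho' : IsInducedOrientation o o') (p : M) :
    ∃ F : TangentSpace (𝓡 7) (proj M p) ≃L[ℝ] Euc 7, IsOriented (o'.at_ (proj M p)) F ∧
      (∀ w : Fin 3 → TangentSpace (𝓡 8) p, Ω p (Matrix.vecCons (generator p) w) =
        Real.sqrt (g.inner p (generator p) (generator p)) *
          phi0 fun i => F (mfderiv (𝓡 8) (𝓡 7) (proj M) p (w i))) ∧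
      ∀ a b : TangentSpace (𝓡 8) p, inner ℝ (F (mfderiv (𝓡 8) (𝓡 7) (proj M) p a))
        (F (mfderiv (𝓡 8) (𝓡 7) (proj M) p b)) = g.inner p a b - g.inner p (generator p) a *
          g.inner p (generator p) b / g.inner p (generator p) (generator p) := by
  have hX := generator_ne_zero hfree p
  have hpos := g.pos p _ hX
  obtain ⟨f, hfo, hfΩ, hfg, hfX⟩ := (hadm p).exists_adapted hX
  set r := Real.sqrt (g.inner p (generator p) (generator p)) with hr
  have hr0 : 0 < r := Real.sqrt_pos.2 hpos
  obtain ⟨F, hF⟩ := exists_quotient_equiv (mfderiv (𝓡 8) (𝓡 7) (proj M) p)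
    (mfderiv_surjective_of_isSubmersion hsub p)
    (fun v hv => eq_smul_generator_of_mfderiv_proj hfree hsub hv)
    (mfderiv_proj_generator hsub p) f hr0.ne' hfX
  refine ⟨F, isOriented_quotient _ (mfderiv_proj_generator hsub p) f hr0 hfX F hF
    (fun b c => ho' p b c) hfo, fun w => ?_, fun a b => ?_⟩
  · rw [hfΩ]
    have h1 : (fun i => F (mfderiv (𝓡 8) (𝓡 7) (proj M) p (w i))) =
        ![tail (f (w 0)), tail (f (w 1)), tail (f (w 2))] := by
      funext i; fin_cases i <;> exact hF _
    have h2 : (fun i => f (Matrix.vecCons (generator p) w i)) =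
        Matrix.vecCons (r • stdB 8 0) ![f (w 0), f (w 1), f (w 2)] := by
      funext i; fin_cases i
      · exact hfX
      all_goals rfl
    rw [h1, ← Omega0_first]
    generalize Omega0 = η
    change η (fun i => f (Matrix.vecCons (generator p) w i)) = _
    rw [h2, ← contract_apply, contract_smul_apply]
  · have hcoord : ∀ a, f a 0 = r⁻¹ * g.inner p (generator p) a := fun a => by
      rw [hfg, hfX, real_inner_smul_left, ← mul_assoc, inv_mul_cancel₀ hr0.ne', one_mul]
      simp [EuclideanSpace.inner_single_left]
    have hrr : r * r = g.inner p (generator p) (generator p) := Real.mul_self_sqrt hpos.le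
    rw [hF, hF, inner_tail, ← hfg, hcoord, hcoord, ← hrr]
    field_simp

/-- The metric on the orbit space whose value on the images of `a` and `b` is
`g(a, b) - g(X, a) g(X, b) / g(X, X)`, the inner product of the horizontal parts. -/
theorem exists_quotient_metric (hfree : ∀ (z : Circle) (p : M), z • p = p → z = 1)
    (hsub : Manifold.IsSubmersion (𝓡 8) (𝓡 7) ∞ (proj M)) {o : MOrientation 8 M}
    {g : RMetric 8 M} {Ω : DForm 8 4 M}
    (hadm : ∀ p : M, IsAdmissibleWithMetric (o.at_ p) (Ω p) (g.inner p))
    (hinv : ∀ z : Circle, DForm.pullback (fun p : M => z • p) Ω = Ω)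
    {o' : MOrientation 7 (OrbitSpace M)} (ho' : IsInducedOrientation o o')
    {ψ : DForm 7 3 (OrbitSpace M)}
    (hψ : DForm.pullback (proj M) ψ = contractField g (normalizeField g generator) Ω) :
    ∃ h : RMetric 7 (OrbitSpace M),
      (∀ q, IsPositiveWithMetric (o'.at_ q) (ψ q) (h.inner q)) ∧
      IsRiemannianSubmersion g h (proj M) := by
  have hpt : ∀ q : OrbitSpace M, ∃ B : TangentSpace (𝓡 7) q →L[ℝ] TangentSpace (𝓡 7) q →L[ℝ] ℝ,
      IsPositiveWithMetric (o'.at_ q) (ψ q) B ∧ ∀ p : M, proj M p = q →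
        ∀ (a b : TangentSpace (𝓡 8) p) (a' b' : TangentSpace (𝓡 7) q),
        (a' : Euc 7) = mfderiv (𝓡 8) (𝓡 7) (proj M) p a →
        (b' : Euc 7) = mfderiv (𝓡 8) (𝓡 7) (proj M) p b →
        B a' b' = g.inner p a b - g.inner p (generator p) a *
          g.inner p (generator p) b / g.inner p (generator p) (generator p) := by
    intro q
    obtain ⟨p, rfl⟩ := proj_surjective q
    obtain ⟨F, hFo, hFΩ, hFg⟩ := exists_quotient_frame hfree hsub hadm ho' p
    let B : TangentSpace (𝓡 7) (proj M p) →L[ℝ] TangentSpace (𝓡 7) (proj M p) →L[ℝ] ℝ :=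
      (show Euc 7 →L[ℝ] Euc 7 →L[ℝ] ℝ from
        ((isBoundedBilinearMap_inner (𝕜 := ℝ) (E := Euc 7)).toContinuousLinearMap).bilinearComp
          (show Euc 7 →L[ℝ] Euc 7 from F.toContinuousLinearMap)
          (show Euc 7 →L[ℝ] Euc 7 from F.toContinuousLinearMap))
    have hB : ∀ a b, B a b = inner ℝ (F a) (F b) := fun a b => rfl
    refine ⟨B, ⟨F, hFo, ?_, hB⟩, ?_⟩
    · ext w
      choose v hv using fun i => mfderiv_surjective_of_isSubmersion hsub p (w i)
      obtain rfl : (fun i => mfderiv (𝓡 8) (𝓡 7) (proj M) p (v i)) = w := funext hv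
      refine (DFunLike.congr_fun (congrFun hψ p) v).trans ?_
      refine (contractField_apply g _ Ω p v).trans ?_
      rw [hFΩ, ← mul_assoc, inv_mul_cancel₀ (Real.sqrt_pos.2
        (g.pos p _ (generator_ne_zero hfree p))).ne', one_mul]
      rfl
    · intro p' hp' a b a' b' ha hb
      obtain ⟨z, rfl⟩ := exists_smul_eq_of_proj_eq hp'
      obtain rfl : a' = mfderiv (𝓡 8) (𝓡 7) (proj M) (z • p') (smulEquiv z p' a) :=
        ha.trans (mfderiv_proj_smulEquiv hsub z p' a).symm
      obtain rfl : b' = mfderiv (𝓡 8) (𝓡 7) (proj M) (z • p') (smulEquiv z p' b) :=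
        hb.trans (mfderiv_proj_smulEquiv hsub z p' b).symm
      rw [hB, hFg, ← smulEquiv_generator, metric_smul hadm hinv, metric_smul hadm hinv,
        metric_smul hadm hinv, metric_smul hadm hinv]
  choose B hBψ hB using hpt
  -- positivity is inherited from the isomorphisms with `ℝ⁷`, smoothness follows along sections
  let h : RMetric 7 (OrbitSpace M) :=
    { inner := B
      symm := fun q a b => by
        obtain ⟨f, -, -, hf⟩ := hBψ q
        rw [hf, hf, real_inner_comm]
      pos := fun q v hv => by
        obtain ⟨f, -, -, hf⟩ := hBψ q
        rw [hf]
        exact real_inner_self_pos.2 fun h => hv (f.map_eq_zero_iff.1 h)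
      isVonNBounded := fun q => by
        obtain ⟨f, -, -, hf⟩ := hBψ q
        have h1 : {v : TangentSpace (𝓡 7) q | B q v v < 1} =
            (f.symm : Euc 7 →L[ℝ] TangentSpace (𝓡 7) q) '' Metric.ball 0 1 := by
          ext v
          rw [Set.mem_ofPred_eq, hf, real_inner_self_eq_norm_sq, sq_lt_one_iff₀ (norm_nonneg _)]
          refine ⟨fun hv => ⟨f v, by simpa using hv, f.symm_apply_apply v⟩, ?_⟩
          rintro ⟨u, hu, rfl⟩
          simpa using hu
        rw [h1]
        exact (NormedSpace.isVonNBounded_ball ℝ (Euc 7) 1).image _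
      contMDiff := contMDiff_bilinear_of_chart B fun x₀ a b y₀ hy₀ => by
        obtain ⟨p, hp⟩ := proj_surjective ((extChartAt (𝓡 7) x₀).symm y₀)
        obtain ⟨U, s, hU, hyU, -, -, hs, hps, hds⟩ := exists_chart_section hsub hy₀ hp
        have hsm : ContMDiffAt 𝓘(ℝ, Euc 7) (𝓡 8) ∞ s y₀ := hs.contMDiffAt (hU.mem_nhds hyU)
        have hX : ContMDiffAt 𝓘(ℝ, Euc 7) (𝓡 8).tangent ∞
            (fun y => (⟨s y, generator (s y)⟩ : TangentBundle (𝓡 8) M)) y₀ :=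
          (contMDiff_generator _).comp y₀ hsm
        have hd : ∀ a : Euc 7, ContMDiffAt 𝓘(ℝ, Euc 7) (𝓡 8).tangent ∞ (fun y => (⟨s y,
            mfderiv 𝓘(ℝ, Euc 7) (𝓡 8) s y a⟩ : TangentBundle (𝓡 8) M)) y₀ := fun a =>
          contMDiffAt_mfderiv_apply hU hs hyU (contMDiff_const_vectorField a y₀)
        have hval := Filter.eventuallyEq_of_mem (hU.mem_nhds hyU) fun y hy =>
          hB ((extChartAt (𝓡 7) x₀).symm y) (s y) (hps y hy) _ _ _ _ (hds y hy a).symm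
            (hds y hy b).symm
        refine ContDiffAt.congr_of_eventuallyEq ?_ hval
        refine ContDiffAt.sub (g.contMDiffAt_inner hsm (hd a) (hd b)).contDiffAt
          (ContDiffAt.div (ContDiffAt.mul (g.contMDiffAt_inner hsm hX (hd a)).contDiffAt
            (g.contMDiffAt_inner hsm hX (hd b)).contDiffAt)
            (g.contMDiffAt_inner hsm hX hX).contDiffAt
            (g.pos _ _ (generator_ne_zero hfree _)).ne') }
  refine ⟨h, hBψ, hsub.contMDiff, mfderiv_surjective_of_isSubmersion hsub, fun p a b ha hb => ?_⟩
  have hXa : g.inner p (generator p) a = 0 := by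
    rw [g.symm]; exact ha _ (mfderiv_proj_generator hsub p)
  refine (hB _ p rfl a b _ _ rfl rfl).trans ?_
  rw [hXa, zero_mul, zero_div, sub_zero]

/-- A form on the orbit space that pulls back to a positive multiple of `ι_X Ω` is positive. -/
theorem isPositive_of_pullback_eq (hfree : ∀ (z : Circle) (p : M), z • p = p → z = 1)
    (hsub : Manifold.IsSubmersion (𝓡 8) (𝓡 7) ∞ (proj M)) {o : MOrientation 8 M}
    {g : RMetric 8 M} {Ω : DForm 8 4 M}
    (hadm : ∀ p : M, IsAdmissibleWithMetric (o.at_ p) (Ω p) (g.inner p))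
    {o' : MOrientation 7 (OrbitSpace M)} (ho' : IsInducedOrientation o o')
    {ψ : DForm 7 3 (OrbitSpace M)} {lam : M → ℝ} (hlam : ∀ p, 0 < lam p)
    (hψ : DForm.pullback (proj M) ψ = contractField g (fun p => lam p • generator p) Ω)
    (q : OrbitSpace M) : IsPositive (o'.at_ q) (ψ q) := by
  obtain ⟨p, rfl⟩ := proj_surjective q
  obtain ⟨F, hFo, hFΩ, -⟩ := exists_quotient_frame hfree hsub hadm ho' p
  have hr : 0 < lam p * Real.sqrt (g.inner p (generator p) (generator p)) :=
    mul_pos (hlam p) (Real.sqrt_pos.2 (g.pos p _ (generator_ne_zero hfree p)))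
  convert IsPositive.smul ⟨F, hFo, rfl⟩ hr using 1
  ext w
  choose v hv using fun i => mfderiv_surjective_of_isSubmersion hsub p (w i)
  obtain rfl : (fun i => mfderiv (𝓡 8) (𝓡 7) (proj M) p (v i)) = w := funext hv
  refine (DFunLike.congr_fun (congrFun hψ p) v).trans ?_
  refine (contractField_apply g _ Ω p v).trans ?_
  rw [hFΩ, ← mul_assoc]
  rfl

/-- The induced orientation, the descended forms and the quotient metric, for a given manifold structure
on the orbit space. -/
theorem quotient_structure (o : MOrientation 8 M) (g : RMetric 8 M)
    (Ω : DForm 8 4 M) (hΩ : Ω.IsSmooth)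
    (hadm : ∀ p : M, IsAdmissibleWithMetric (o.at_ p) (Ω p) (g.inner p))
    (hfree : ∀ (z : Circle) (p : M), z • p = p → z = 1)
    (hinv : ∀ z : Circle, DForm.pullback (fun p : M => z • p) Ω = Ω)
    (hsub : Manifold.IsSubmersion (𝓡 8) (𝓡 7) ∞ (proj M)) :
      (∃! o' : MOrientation 7 (OrbitSpace M), IsInducedOrientation o o') ∧
      ∀ o' : MOrientation 7 (OrbitSpace M), IsInducedOrientation o o' →
        (∃ ψ : DForm 7 3 (OrbitSpace M), ψ.IsSmooth ∧
          DForm.pullback (proj M) ψ = contractField g generator Ω ∧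
          (∀ ψ' : DForm 7 3 (OrbitSpace M),
            DForm.pullback (proj M) ψ' = contractField g generator Ω → ψ' = ψ) ∧
          ∀ q, IsPositive (o'.at_ q) (ψ q)) ∧
        (∃ ψ : DForm 7 3 (OrbitSpace M), ψ.IsSmooth ∧
          DForm.pullback (proj M) ψ = contractField g (normalizeField g generator) Ω ∧
          (∀ ψ' : DForm 7 3 (OrbitSpace M),
            DForm.pullback (proj M) ψ' = contractField g (normalizeField g generator) Ω → ψ' = ψ) ∧
          (∀ q, IsPositive (o'.at_ q) (ψ q)) ∧
          ∃ h : RMetric 7 (OrbitSpace M),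
            (∀ q, IsPositiveWithMetric (o'.at_ q) (ψ q) (h.inner q)) ∧
            IsRiemannianSubmersion g h (proj M)) := by
  obtain ⟨o₁, ho₁⟩ := exists_isInducedOrientation hfree hsub o
  refine ⟨⟨o₁, ho₁, fun o₂ ho₂ => isInducedOrientation_unique hfree hsub ho₂ ho₁⟩,
    fun o' ho' => ⟨?_, ?_⟩⟩
  · have hone : contractField g (fun p => (1 : ℝ) • generator p) Ω = contractField g generator Ω := by
      simp only [one_smul]
    obtain ⟨ψ, hψs, hψ⟩ := exists_descended_form hfree hsub g hΩ hinv (lam := fun _ => 1)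
      contMDiff_const fun _ _ => rfl
    refine ⟨ψ, hψs, hψ.trans hone, fun ψ' hψ' => ?_,
      isPositive_of_pullback_eq hfree hsub hadm ho' (fun _ => one_pos) hψ⟩
    exact DForm.pullback_injective hsub proj_surjective (hψ'.trans (hψ.trans hone).symm)
  · have hpos : ∀ p : M, 0 < g.inner p (generator p) (generator p) := fun p =>
      g.pos p _ (generator_ne_zero hfree p)
    have hsmooth : ContMDiff (𝓡 8) 𝓘(ℝ, ℝ) ∞
        fun p : M => (Real.sqrt (g.inner p (generator p) (generator p)))⁻¹ := fun p => by
      have h1 := g.contMDiffAt_inner (c := id) (y₀ := p) contMDiffAt_id (contMDiff_generator p)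
        (contMDiff_generator p)
      have h2 : ContDiffAt ℝ ∞ (fun x : ℝ => (Real.sqrt x)⁻¹)
          (g.inner p (generator p) (generator p)) :=
        (Real.contDiffAt_sqrt (hpos p).ne').inv (Real.sqrt_pos.2 (hpos p)).ne'
      exact ContMDiffAt.comp (I' := 𝓘(ℝ, ℝ))
        (f := fun p : M => g.inner p (generator p) (generator p)) p h2.contMDiffAt h1
    obtain ⟨ψ, hψs, hψ⟩ := exists_descended_form hfree hsub g hΩ hinv hsmooth fun z p => by
      rw [← smulEquiv_generator, metric_smul hadm hinv]
    refine ⟨ψ, hψs, hψ, fun ψ' hψ' => ?_, isPositive_of_pullback_eq hfree hsub hadm ho'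
      (fun p => inv_pos.2 (Real.sqrt_pos.2 (hpos p))) hψ,
      exists_quotient_metric hfree hsub hadm hinv ho' hψ⟩
    exact DForm.pullback_injective hsub proj_surjective (hψ'.trans hψ.symm)

end Descent

section Quotient

variable {M : Type*} [TopologicalSpace M] [ChartedSpace (Euc 8) M]
  [MulAction Circle M] [ContMDiffSMul (𝓡 1) (𝓡 8) ∞ Circle M]

/-! ### Topology of the orbit space -/

variable (M) in
theorem continuousSMul_circle : ContinuousSMul Circle M :=
  ContMDiffSMul.continuousSMul (I := 𝓡 1) (I' := 𝓡 8) ∞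

variable (M) in
omit [ChartedSpace (Euc 8) M] [ContMDiffSMul (𝓡 1) (𝓡 8) ∞ Circle M] in
theorem continuous_proj : Continuous (proj M) := continuous_quot_mk

variable (M) in
theorem isOpenMap_proj : IsOpenMap (proj M) :=
  have := continuousSMul_circle M
  MulAction.isOpenQuotientMap_quotientMk.isOpenMap

/-- The orbit space is Hausdorff, because the action of a compact group is proper. -/
theorem t2Space_orbitSpace [T2Space M] : T2Space (OrbitSpace M) := by
  have := continuousSMul_circle M
  have : ProperSMul Circle M := properSMul_iff_continuousSMul_ultrafilter_tendsto_t2.2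
    ⟨inferInstance, fun 𝒰 _ _ _ => by
      obtain ⟨g, -, hg⟩ := isCompact_univ.ultrafilter_le_nhds (𝒰.map Prod.fst) (by simp)
      exact ⟨g, hg⟩⟩
  infer_instance

theorem secondCountableTopology_orbitSpace [SecondCountableTopology M] :
    SecondCountableTopology (OrbitSpace M) :=
  have := continuousSMul_circle M
  ContinuousConstSMul.secondCountableTopology

/-! ### Slices -/

/-- A chart of `M` adapted to the action: in the coordinates `(y, t) ∈ ℝ⁷ × ℝ` the action of
`exp (it)` is the translation by `t`, and points of the chart in the same orbit have the same
coordinate `y`. The coordinates range over a ball of the product. -/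
structure SliceChart (p : M) where
  /-- The underlying chart of `M`. -/
  chart : OpenPartialHomeomorph M (Euc 8)
  /-- The splitting of the coordinates into those of the slice and that of the orbits. -/
  split : Euc 8 ≃L[ℝ] Euc 7 × ℝ
  /-- The radius of the ball of coordinates. -/
  radius : ℝ
  /-- The chart is defined at the base point. -/
  mem_source : p ∈ chart.source
  contMDiffOn : ContMDiffOn (𝓡 8) (𝓡 8) ∞ chart chart.source
  contMDiffOn_symm : ContMDiffOn (𝓡 8) (𝓡 8) ∞ chart.symm chart.target
  target_eq : chart.target = split ⁻¹' Metric.ball 0 radius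
  symm_apply : ∀ u ∈ chart.target,
    chart.symm u = Circle.exp (split u).2 • chart.symm (split.symm ((split u).1, 0))
  fst_eq : ∀ m ∈ chart.source, ∀ m' ∈ chart.source, proj M m = proj M m' →
    (split (chart m)).1 = (split (chart m')).1

/-- If `s` is a continuous slice through `p` on which the flow box map `(y, t) ↦ exp (it) • s y` is
injective near `0`, then points of `s` near `p` lie on different orbits: group elements near `1` are
covered by the flow box, and the others, forming a compact set, move `p` away from itself. -/
theorem eventually_eq_of_smul_eq [T2Space M] (hfree : ∀ (z : Circle) (p : M), z • p = p → z = 1)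
    {E : Type*} [NormedAddCommGroup E] {s : E → M} (hs : ContinuousAt s 0) {ε : ℝ} (hε : 0 < ε)
    (hinj : ∀ (y y' : E) (t : ℝ), ‖y‖ < ε → ‖y'‖ < ε → |t| < ε → Circle.exp t • s y = s y' → y = y') :
    ∀ᶠ w : E × E in 𝓝 (0, 0), ∀ z : Circle, z • s w.1 = s w.2 → w.1 = w.2 := by
  have := continuousSMul_circle M
  have h : ∀ᶠ w : E × E in 𝓝 (0, 0), ∀ z ∈ (Set.univ : Set Circle), z • s w.1 = s w.2 →
      w.1 = w.2 := by
    refine isCompact_univ.eventually_forall_of_forall_eventually fun z _ => ?_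
    have hs1 : ContinuousAt (fun x : (E × E) × Circle => s x.1.1) ((0, 0), z) :=
      ContinuousAt.comp (g := s) hs (by fun_prop)
    have hs2 : ContinuousAt (fun x : (E × E) × Circle => s x.1.2) ((0, 0), z) :=
      ContinuousAt.comp (g := s) hs (by fun_prop)
    by_cases hz : z = 1
    · subst hz
      have harg : ContinuousAt (fun x : (E × E) × Circle => Complex.arg x.2) ((0, 0), 1) := by
        refine ContinuousAt.comp (g := Complex.arg) (Complex.continuousAt_arg ?_) (by fun_prop)
        simp
      have h1 : ∀ᶠ x : (E × E) × Circle in 𝓝 ((0, 0), 1), |Complex.arg x.2| < ε :=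
        harg.abs.eventually (gt_mem_nhds (by simpa using hε))
      have hn1 : ContinuousAt (fun x : (E × E) × Circle => ‖x.1.1‖) ((0, 0), 1) := by fun_prop
      have hn2 : ContinuousAt (fun x : (E × E) × Circle => ‖x.1.2‖) ((0, 0), 1) := by fun_prop
      filter_upwards [h1, hn1.eventually (gt_mem_nhds (by simpa using hε)),
        hn2.eventually (gt_mem_nhds (by simpa using hε))] with x h1 h2 h3 h4
      refine hinj _ _ _ h2 h3 h1 ?_
      rwa [Circle.exp_arg]
    · have h1 : ContinuousAt (fun x : (E × E) × Circle => x.2 • s x.1.1) ((0, 0), z) :=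
        continuousAt_snd.smul hs1
      have h2 : z • s 0 ≠ s 0 := fun h => hz (hfree z _ h)
      filter_upwards [(h1.prodMk hs2).eventually (isClosed_diagonal.isOpen_compl.mem_nhds h2)]
        with x hx hx'
      exact absurd hx' hx
  filter_upwards [h] with w hw z
  exact hw z trivial

end Quotient

section SliceExistence

variable {M : Type*} [TopologicalSpace M] [ChartedSpace (Euc 8) M] [IsManifold (𝓡 8) ∞ M]
  [MulAction Circle M] [ContMDiffSMul (𝓡 1) (𝓡 8) ∞ Circle M]

/-- A splitting `ℝ⁸ ≃ ℝ⁷ × ℝ` whose second axis is a given nonzero vector. -/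
theorem exists_split {ξ : Euc 8} (hξ : ξ ≠ 0) :
    ∃ A : Euc 8 ≃L[ℝ] Euc 7 × ℝ, A.symm (0, 1) = ξ := by
  have hfr : Module.finrank ℝ (Euc 7 × ℝ) = Module.finrank ℝ (Euc 8) := by simp
  let A₀ : (Euc 7 × ℝ) ≃L[ℝ] Euc 8 := ContinuousLinearEquiv.ofFinrankEq hfr
  have h0 : A₀ (0, 1) ≠ 0 := fun h => by
    simpa using A₀.map_eq_zero_iff.1 h
  obtain ⟨R, hR⟩ := SeparatingDual.exists_continuousLinearEquiv_apply_eq (R := ℝ) h0 hξ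
  exact ⟨(A₀.trans R).symm, hR⟩

/-- The flow box: for the slice `s y = φ⁻¹(φ p + y)` in the chart `φ` at `p`, the map
`(y, t) ↦ exp (it) • s y` is smooth near `0` with derivative the identity. Here `ℝ⁸` is split by `A` such
that the second axis is the generator at `p`. -/
theorem exists_flowBox (hfree : ∀ (z : Circle) (p : M), z • p = p → z = 1) (p : M) :
    ∃ (A : Euc 8 ≃L[ℝ] Euc 7 × ℝ) (s : Euc 7 → M) (O : Set (Euc 8)), IsOpen O ∧ (0 : Euc 8) ∈ O ∧
      s 0 = p ∧ ContinuousAt s 0 ∧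
      ContMDiffOn (𝓡 8) (𝓡 8) ∞ (fun u => Circle.exp (A u).2 • s (A u).1) O ∧
      (∀ u ∈ O, Circle.exp (A u).2 • s (A u).1 ∈ (chartAt (Euc 8) p).source) ∧
      HasFDerivAt (fun u => chartAt (Euc 8) p (Circle.exp (A u).2 • s (A u).1))
        (ContinuousLinearMap.id ℝ (Euc 8)) 0 := by
  set φ := chartAt (Euc 8) p with hφ
  have hφs : ContMDiffOn (𝓡 8) (𝓡 8) ∞ φ.symm φ.target := contMDiffOn_chart_symm
  have hpt : φ p ∈ φ.target := mem_chart_target _ _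
  set ξ : Euc 8 := mfderiv (𝓡 8) (𝓡 8) φ p (generator p) with hξ
  have hξ0 : ξ ≠ 0 := fun h => by
    have h1 := mfderiv_extChartAt_symm_comp (mem_chart_source (Euc 8) p) (generator p)
    have h2 : mfderiv (𝓡 8) 𝓘(ℝ, Euc 8) (extChartAt (𝓡 8) p) p (generator p) = 0 := h
    rw [h2] at h1
    exact generator_ne_zero hfree p (h1.symm.trans (map_zero _))
  obtain ⟨A, hA⟩ := exists_split hξ0
  let s : Euc 7 → M := fun y => φ.symm (φ p + A.symm (y, 0))
  let G : Euc 8 → M := fun u => Circle.exp (A u).2 • s (A u).1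
  let a : Euc 8 → Euc 8 := fun u => φ p + A.symm ((A u).1, 0)
  have ha : ContDiff ℝ ∞ a := contDiff_const.add (A.symm.contDiff.comp
    ((contDiff_fst.comp A.contDiff).prodMk contDiff_const))
  have ha0 : a 0 = φ p := by simp [a]
  let D : Set (Euc 8) := a ⁻¹' φ.target
  have hD : IsOpen D := φ.open_target.preimage ha.continuous
  have hD0 : (0 : Euc 8) ∈ D := by change a 0 ∈ φ.target; rw [ha0]; exact hpt
  have hG : ContMDiffOn (𝓡 8) (𝓡 8) ∞ G D :=
    contMDiff_action.comp_contMDiffOn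
      (((contDiff_snd.comp A.contDiff).contMDiff.contMDiffOn).prodMk
        (hφs.comp ha.contMDiff.contMDiffOn fun u hu => hu))
  have hs0 : s 0 = p := by
    have : φ p + A.symm ((0 : Euc 7), (0 : ℝ)) = φ p := by
      rw [← Prod.zero_eq_mk, map_zero, add_zero]
    change φ.symm _ = p
    rw [this]; exact φ.left_inv (mem_chart_source _ _)
  have hG0 : G 0 = p := by simp [G, hs0]
  let O : Set (Euc 8) := D ∩ G ⁻¹' φ.source
  have hO : IsOpen O := hG.continuousOn.isOpen_inter_preimage hD φ.open_source
  have hO0 : (0 : Euc 8) ∈ O := ⟨hD0, by change G 0 ∈ φ.source; rw [hG0]; exact mem_chart_source _ _⟩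
  have hsc : ContinuousAt s 0 := by
    have h1 : ContinuousAt φ.symm (φ p + A.symm ((0 : Euc 7), (0 : ℝ))) := by
      rw [← Prod.zero_eq_mk, map_zero, add_zero]
      exact φ.continuousAt_symm hpt
    exact ContinuousAt.comp (f := fun y : Euc 7 => φ p + A.symm (y, 0)) h1 (by fun_prop)
  refine ⟨A, s, O, hO, hO0, hs0, hsc, hG.mono Set.inter_subset_left, fun u hu => hu.2, ?_⟩
  have hφc : ContMDiffOn (𝓡 8) (𝓡 8) ∞ φ φ.source := contMDiffOn_chart
  have hΘ : ContDiffOn ℝ ∞ (fun u => φ (G u)) O :=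
    (hφc.comp (hG.mono Set.inter_subset_left) fun u hu => hu.2).contDiffOn
  have hd : HasFDerivAt (fun u => φ (G u)) (fderiv ℝ (fun u => φ (G u)) 0) 0 :=
    ((hΘ.contDiffAt (hO.mem_nhds hO0)).differentiableAt (by simp)).hasFDerivAt
  convert hd using 1
  -- the derivative along the slice
  have hy : ∀ y : Euc 7, fderiv ℝ (fun u => φ (G u)) 0 (A.symm (y, 0)) = A.symm (y, 0) := fun y => by
    let c : ℝ → Euc 8 := fun r => r • A.symm (y, 0)
    have hc : HasDerivAt c (A.symm (y, 0)) 0 := by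
      simpa using (hasDerivAt_id (0 : ℝ)).smul_const (A.symm (y, 0))
    have hc0 : c 0 = 0 := zero_smul _ _
    have h1 : HasDerivAt (fun r => φ (G (c r))) (fderiv ℝ (fun u => φ (G u)) 0 (A.symm (y, 0))) 0 :=
      HasFDerivAt.comp_hasDerivAt (l := fun u => φ (G u)) (0 : ℝ) (by rw [hc0]; exact hd) hc
    have h2 : (fun r => φ (G (c r))) =ᶠ[𝓝 0] fun r => φ p + c r := by
      have hcc : ContinuousAt c 0 := hc.continuousAt
      filter_upwards [hcc.eventually (hO.mem_nhds (by rw [hc0]; exact hO0))] with r hr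
      have h3 : A (c r) = (r • y, 0) := by simp [c]
      have h4 : G (c r) = φ.symm (φ p + c r) := by
        simp only [G, s, h3, Circle.exp_zero, one_smul]
        simp [← h3]
      rw [h4]
      refine φ.right_inv ?_
      have := hr.1
      change φ p + A.symm ((A (c r)).1, 0) ∈ φ.target at this
      rw [h3] at this
      simpa [← h3] using this
    exact h1.unique ((hc.const_add (φ p)).congr_of_eventuallyEq h2)
  -- the derivative along the orbit
  have ht : fderiv ℝ (fun u => φ (G u)) 0 (A.symm (0, 1)) = A.symm (0, 1) := by
    let c : ℝ → Euc 8 := fun r => r • A.symm (0, 1)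
    have hc : HasDerivAt c (A.symm (0, 1)) 0 := by
      simpa using (hasDerivAt_id (0 : ℝ)).smul_const (A.symm ((0 : Euc 7), (1 : ℝ)))
    have hc0 : c 0 = 0 := zero_smul _ _
    have h1 : HasDerivAt (fun r => φ (G (c r))) (fderiv ℝ (fun u => φ (G u)) 0 (A.symm (0, 1))) 0 :=
      HasFDerivAt.comp_hasDerivAt (l := fun u => φ (G u)) (0 : ℝ) (by rw [hc0]; exact hd) hc
    have h2 : (fun r => φ (G (c r))) = fun r => φ (Circle.exp r • p) := by
      funext r
      have h3 : A (c r) = (0, r) := by simp [c]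
      simp only [G, h3, hs0]
    have h0 : Circle.exp 0 • p = p := by rw [Circle.exp_zero, one_smul]
    have h3 : MDifferentiableAt (𝓡 8) (𝓡 8) φ (Circle.exp 0 • p) := by
      rw [h0]
      exact (hφc.contMDiffAt (φ.open_source.mem_nhds (mem_chart_source _ _))).mdifferentiableAt
        (by simp)
    let L : ℝ →L[ℝ] Euc 8 := (mfderiv (𝓡 8) (𝓡 8) φ (Circle.exp 0 • p)).comp
      (mfderiv 𝓘(ℝ, ℝ) (𝓡 8) (fun t : ℝ => Circle.exp t • p) 0)
    have h4 : HasFDerivAt (fun r : ℝ => φ (Circle.exp r • p)) L 0 :=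
      (h3.hasMFDerivAt.comp (0 : ℝ) (mdifferentiableAt_orbit p 0).hasMFDerivAt).hasFDerivAt
    rw [h2] at h1
    refine h1.unique (h4.hasDerivAt.congr_deriv ?_)
    rw [hA, hξ]
    exact mfderiv_congr_point φ h0 _
  symm
  ext1 u
  have hu : u = A.symm ((A u).1, 0) + (A u).2 • A.symm (0, 1) := by
    rw [← map_smul, ← map_add]
    simp
  rw [hu, map_add, map_smul, hy, ht]
  rfl

/-- Slice charts exist at every point: invert the flow box map and shrink it. -/
theorem exists_sliceChart [T2Space M] (hfree : ∀ (z : Circle) (p : M), z • p = p → z = 1) (p : M) :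
    Nonempty (SliceChart p) := by
  obtain ⟨A, s, O, hO, hO0, hs0, hsc, hG, hGφ, hd⟩ := exists_flowBox hfree p
  set φ := chartAt (Euc 8) p with hφ
  set G : Euc 8 → M := fun u => Circle.exp (A u).2 • s (A u).1 with hGdef
  let Θ : Euc 8 → Euc 8 := fun u => φ (G u)
  have hφc : ContMDiffOn (𝓡 8) (𝓡 8) ∞ φ φ.source := contMDiffOn_chart
  have hΘ : ContDiffOn ℝ ∞ Θ O := (hφc.comp hG hGφ).contDiffOn
  have hΘ0 : ContDiffAt ℝ ∞ Θ 0 := hΘ.contDiffAt (hO.mem_nhds hO0)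
  have hd' : HasFDerivAt Θ ((ContinuousLinearEquiv.refl ℝ (Euc 8) : Euc 8 ≃L[ℝ] Euc 8) :
      Euc 8 →L[ℝ] Euc 8) 0 := hd
  let Θ' := hΘ0.toOpenPartialHomeomorph Θ hd' (by simp)
  have hinv : ∀ᶠ u in 𝓝 (0 : Euc 8), fderiv ℝ Θ u ∈
      Set.range ((↑) : (Euc 8 ≃L[ℝ] Euc 8) → Euc 8 →L[ℝ] Euc 8) := by
    have h1 : ContinuousAt (fderiv ℝ Θ) 0 :=
      (hΘ0.fderiv_right (m := 0) (by simp)).continuousAt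
    refine h1.eventually ?_
    rw [hd'.fderiv]
    exact ContinuousLinearEquiv.nhds _
  obtain ⟨ε₀, hε₀, hbox⟩ : ∃ ε₀ > 0, ∀ x : Euc 7 × ℝ, ‖x‖ < ε₀ → A.symm x ∈ Θ'.source ∧
      A.symm x ∈ O ∧ fderiv ℝ Θ (A.symm x) ∈
        Set.range ((↑) : (Euc 8 ≃L[ℝ] Euc 8) → Euc 8 →L[ℝ] Euc 8) := by
    have h1 : ∀ᶠ u in 𝓝 (0 : Euc 8), u ∈ Θ'.source ∧ u ∈ O ∧ fderiv ℝ Θ u ∈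
        Set.range ((↑) : (Euc 8 ≃L[ℝ] Euc 8) → Euc 8 →L[ℝ] Euc 8) :=
      Filter.Eventually.and
        (Θ'.open_source.mem_nhds (hΘ0.mem_toOpenPartialHomeomorph_source hd' (by simp)))
        (Filter.Eventually.and (hO.mem_nhds hO0) hinv)
    have h2 : Filter.Tendsto A.symm (𝓝 0) (𝓝 0) := by
      simpa using A.symm.continuous.tendsto 0
    obtain ⟨ε, hε, h⟩ := Metric.eventually_nhds_iff_ball.1 (h2.eventually h1)
    exact ⟨ε, hε, fun x hx => h x (by simpa using hx)⟩
  have hGA : ∀ (y : Euc 7) (t : ℝ), G (A.symm (y, t)) = Circle.exp t • s y := fun y t => by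
    simp [hGdef]
  have hinj : ∀ (y y' : Euc 7) (t : ℝ), ‖y‖ < ε₀ → ‖y'‖ < ε₀ → |t| < ε₀ →
      Circle.exp t • s y = s y' → y = y' := fun y y' t hy hy' ht h => by
    have h1 : Θ' (A.symm (y, t)) = Θ' (A.symm (y', 0)) := by
      change φ (G _) = φ (G _)
      rw [hGA, hGA, h, Circle.exp_zero, one_smul]
    have h2 := Θ'.injOn (hbox (y, t) (max_lt hy ht)).1
      (hbox (y', 0) (max_lt hy' (by simpa using hε₀))).1 h1
    exact congrArg Prod.fst (A.symm.injective h2)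
  obtain ⟨ε₁, hε₁, horb⟩ := Metric.eventually_nhds_iff_ball.1
    (eventually_eq_of_smul_eq hfree hsc hε₀ hinj)
  let ε := min ε₀ ε₁
  have hε : 0 < ε := lt_min hε₀ hε₁
  let B : Set (Euc 8) := A ⁻¹' Metric.ball 0 ε
  have hB : IsOpen B := Metric.isOpen_ball.preimage A.continuous
  have hmemB : ∀ u, u ∈ B ↔ ‖A u‖ < ε := fun u => by simp [B]
  have hboxB : ∀ u ∈ B, u ∈ Θ'.source ∧ u ∈ O ∧ fderiv ℝ Θ u ∈
        Set.range ((↑) : (Euc 8 ≃L[ℝ] Euc 8) → Euc 8 →L[ℝ] Euc 8) := fun u hu => by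
    have := hbox (A u) (((hmemB u).1 hu).trans_le (min_le_left _ _))
    rwa [A.symm_apply_apply] at this
  let pre := (Θ'.restrOpen B hB).trans φ.symm
  have hsource : pre.source = B := by
    ext u
    simp only [pre, OpenPartialHomeomorph.trans_source, OpenPartialHomeomorph.restrOpen_source,
      Set.mem_inter_iff, Set.mem_preimage, OpenPartialHomeomorph.symm_source]
    refine ⟨fun h => h.1.2, fun h => ⟨⟨(hboxB u h).1, h⟩, ?_⟩⟩
    exact φ.map_source (hGφ u (hboxB u h).2.1)
  have hpre : ∀ u ∈ B, pre u = G u := fun u hu => φ.left_inv (hGφ u (hboxB u hu).2.1)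
  have hpoint : ∀ m ∈ pre.target, ∃ u ∈ B, pre.symm m = u ∧ m = G u := fun m hm => by
    have h1 : pre.symm m ∈ B := hsource ▸ pre.map_target hm
    exact ⟨pre.symm m, h1, rfl, by rw [← hpre _ h1, pre.right_inv hm]⟩
  have h0B : (0 : Euc 8) ∈ B := by rw [hmemB, map_zero, norm_zero]; exact hε
  have hG0 : G 0 = p := by simp [hGdef, hs0]
  refine ⟨⟨pre.symm, A, ε, ?_, ?_, ?_, hsource, fun u hu => ?_, fun m hm m' hm' h => ?_⟩⟩
  · have := pre.map_source (hsource.symm ▸ h0B)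
    rwa [hpre 0 h0B, hG0] at this
  · intro m hm
    obtain ⟨u, hu, -, rfl⟩ := hpoint m hm
    obtain ⟨h1, h2, e, he⟩ := hboxB u hu
    have h3 : ContDiffAt ℝ ∞ Θ u := hΘ.contDiffAt (hO.mem_nhds h2)
    have h4 : Θ'.symm (φ (G u)) = u := Θ'.left_inv h1
    have h5 : ContDiffAt ℝ ∞ Θ'.symm (φ (G u)) :=
      Θ'.contDiffAt_symm (f₀' := e) (Θ'.map_source h1)
        (by rw [h4, he]; exact (h3.differentiableAt (by simp)).hasFDerivAt) (by rw [h4]; exact h3)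
    exact (h5.contMDiffAt.comp (G u) (hφc.contMDiffAt (φ.open_source.mem_nhds
      (hGφ u h2)))).contMDiffWithinAt
  · refine (hG.mono fun u hu => (hboxB u ?_).2.1).congr fun u hu => hpre u ?_
    · exact hsource ▸ hu
    · exact hsource ▸ hu
  · have huB : u ∈ B := hsource ▸ hu
    have hvB : A.symm ((A u).1, 0) ∈ B := by
      rw [hmemB, A.apply_symm_apply]
      refine lt_of_le_of_lt ?_ ((hmemB u).1 huB)
      simp [Prod.norm_def]
    change pre u = Circle.exp (A u).2 • pre _
    rw [hpre u huB, hpre _ hvB, hGA, Circle.exp_zero, one_smul]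
  · obtain ⟨u, hu, hmu, rfl⟩ := hpoint m hm
    obtain ⟨u', hu', hmu', rfl⟩ := hpoint m' hm'
    rw [hmu, hmu']
    have h1 : proj M (s (A u).1) = proj M (s (A u').1) := by
      rwa [proj_smul, proj_smul] at h
    obtain ⟨z, hz⟩ := exists_smul_eq_of_proj_eq h1
    refine horb ((A u).1, (A u').1) ?_ z hz
    have h2 := ((hmemB u).1 hu).trans_le (min_le_right _ _)
    have h3 := ((hmemB u').1 hu').trans_le (min_le_right _ _)
    have h4 : ‖(A u).1‖ < ε₁ := (norm_fst_le _).trans_lt h2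
    have h5 : ‖(A u').1‖ < ε₁ := (norm_fst_le _).trans_lt h3
    rw [← Prod.zero_eq_mk, mem_ball_zero_iff, Prod.norm_def]
    exact max_lt h4 h5

end SliceExistence

/-! ### The smooth structure of the orbit space -/

namespace SliceChart

variable {M : Type*} [TopologicalSpace M] [ChartedSpace (Euc 8) M] [MulAction Circle M] {p : M}

theorem mem_target (S : SliceChart p) {u : Euc 8} : u ∈ S.chart.target ↔ ‖S.split u‖ < S.radius := by
  rw [S.target_eq, Set.mem_preimage, mem_ball_zero_iff]

theorem radius_pos (S : SliceChart p) : 0 < S.radius :=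
  (norm_nonneg _).trans_lt (S.mem_target.1 (S.chart.map_source S.mem_source))

/-- The slice `{t = 0}`, as a map from its coordinates to `M`. -/
def slice (S : SliceChart p) (y : Euc 7) : M := S.chart.symm (S.split.symm (y, 0))

theorem mem_target_slice (S : SliceChart p) {y : Euc 7} (hy : y ∈ Metric.ball 0 S.radius) :
    S.split.symm (y, 0) ∈ S.chart.target := by
  rw [S.mem_target, S.split.apply_symm_apply]
  exact max_lt (mem_ball_zero_iff.1 hy) (by simpa using S.radius_pos)

theorem slice_mem_source (S : SliceChart p) {y : Euc 7} (hy : y ∈ Metric.ball 0 S.radius) :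
    S.slice y ∈ S.chart.source := S.chart.map_target (S.mem_target_slice hy)

theorem fst_mem_ball (S : SliceChart p) {u : Euc 8} (hu : u ∈ S.chart.target) :
    (S.split u).1 ∈ Metric.ball 0 S.radius :=
  mem_ball_zero_iff.2 ((norm_fst_le _).trans_lt (S.mem_target.1 hu))

theorem proj_symm (S : SliceChart p) {u : Euc 8} (hu : u ∈ S.chart.target) :
    proj M (S.chart.symm u) = proj M (S.slice (S.split u).1) := by
  rw [S.symm_apply u hu, proj_smul]; rfl

theorem injOn_proj_slice (S : SliceChart p) :
    Set.InjOn (fun y => proj M (S.slice y)) (Metric.ball 0 S.radius) := fun y hy y' hy' h => by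
  have h1 := S.fst_eq _ (S.slice_mem_source hy) _ (S.slice_mem_source hy') h
  rw [slice, slice, S.chart.right_inv (S.mem_target_slice hy),
    S.chart.right_inv (S.mem_target_slice hy')] at h1
  simpa using h1

theorem contMDiffOn_slice (S : SliceChart p) :
    ContMDiffOn (𝓡 7) (𝓡 8) ∞ S.slice (Metric.ball 0 S.radius) :=
  S.contMDiffOn_symm.comp (S.split.symm.contDiff.comp
    (contDiff_id.prodMk contDiff_const)).contMDiff.contMDiffOn fun _ hy => S.mem_target_slice hy

variable [ContMDiffSMul (𝓡 1) (𝓡 8) ∞ Circle M]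

/-- The projection of a slice is open, as the slice and its translates fill an open subset of `M`. -/
theorem isOpenMap_proj_slice (S : SliceChart p) :
    IsOpenMap ((Metric.ball (0 : Euc 7) S.radius).domRestrict fun y => proj M (S.slice y)) := by
  intro W hW
  obtain ⟨W', hW', rfl⟩ := isOpen_induced_iff.1 hW
  have h1 : IsOpen (S.chart.target ∩ (fun u => (S.split u).1) ⁻¹' W') :=
    S.chart.open_target.inter (hW'.preimage (continuous_fst.comp S.split.continuous))
  have h2 := isOpenMap_proj M _ (S.chart.symm.isOpen_image_of_subset_source h1
    Set.inter_subset_left)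
  convert h2 using 1
  ext q
  constructor
  · rintro ⟨⟨y, hy⟩, hyW, rfl⟩
    exact ⟨S.slice y, ⟨_, ⟨S.mem_target_slice hy, by simpa using hyW⟩, rfl⟩, rfl⟩
  · rintro ⟨_, ⟨u, ⟨hu, huW⟩, rfl⟩, rfl⟩
    exact ⟨⟨_, S.fst_mem_ball hu⟩, huW, (S.proj_symm hu).symm⟩

/-- The chart of the orbit space whose inverse is the projection of the slice. -/
def quotientChart (S : SliceChart p) : OpenPartialHomeomorph (OrbitSpace M) (Euc 7) :=
  (OpenPartialHomeomorph.ofContinuousOpenRestrict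
    (S.injOn_proj_slice.toPartialEquiv (fun y => proj M (S.slice y)) (Metric.ball 0 S.radius))
    ((continuous_proj M).comp_continuousOn S.contMDiffOn_slice.continuousOn)
    S.isOpenMap_proj_slice Metric.isOpen_ball).symm

theorem quotientChart_symm (S : SliceChart p) (y : Euc 7) :
    S.quotientChart.symm y = proj M (S.slice y) := rfl

theorem proj_mem_source (S : SliceChart p) {m : M} (hm : m ∈ S.chart.source) :
    proj M m ∈ S.quotientChart.source := by
  have h1 := S.chart.map_source hm
  have h2 := S.quotientChart.map_target (S.fst_mem_ball h1)
  rwa [quotientChart_symm, ← S.proj_symm h1, S.chart.left_inv hm] at h2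

theorem quotientChart_proj (S : SliceChart p) {m : M} (hm : m ∈ S.chart.source) :
    S.quotientChart (proj M m) = (S.split (S.chart m)).1 := by
  have h1 := S.chart.map_source hm
  have h2 := S.quotientChart.right_inv (S.fst_mem_ball h1)
  rwa [quotientChart_symm, ← S.proj_symm h1, S.chart.left_inv hm] at h2

theorem exists_mem_source (S : SliceChart p) {q : OrbitSpace M} (hq : q ∈ S.quotientChart.source) :
    ∃ m ∈ S.chart.source, proj M m = q :=
  ⟨S.slice (S.quotientChart q), S.slice_mem_source (S.quotientChart.map_source hq),
    S.quotientChart.left_inv hq⟩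

/-- The transition maps are smooth: after moving the first slice by the action into the second slice
chart they are given by the coordinates of that chart. -/
theorem contDiffOn_transition (S : SliceChart p) {p' : M} (S' : SliceChart p') :
    ContDiffOn ℝ ∞ (S'.quotientChart ∘ S.quotientChart.symm)
      (S.quotientChart.symm.trans S'.quotientChart).source := by
  intro y₀ hy₀
  rw [OpenPartialHomeomorph.trans_source, OpenPartialHomeomorph.symm_source] at hy₀
  obtain ⟨m, hm, hmq⟩ := S'.exists_mem_source hy₀.2
  obtain ⟨z, hz⟩ := exists_smul_eq_of_proj_eq (hmq.trans (S.quotientChart_symm y₀)).symm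
  have h1 : ContMDiffAt (𝓡 7) (𝓡 8) ∞ (fun y => z • S.slice y) y₀ :=
    ((contMDiff_smul_left z) _).comp y₀
      (S.contMDiffOn_slice.contMDiffAt (Metric.isOpen_ball.mem_nhds hy₀.1))
  have hsrc : z • S.slice y₀ ∈ S'.chart.source := hz ▸ hm
  have h2 : ContMDiffAt (𝓡 7) (𝓡 8) ∞ (fun y => S'.chart (z • S.slice y)) y₀ :=
    ContMDiffAt.comp y₀ (S'.contMDiffOn.contMDiffAt (S'.chart.open_source.mem_nhds hsrc)) h1
  have h3 : ContDiffAt ℝ ∞ (fun y => (S'.split (S'.chart (z • S.slice y))).1) y₀ :=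
    (contDiff_fst.comp S'.split.contDiff).contDiffAt.comp y₀ h2.contDiffAt
  refine (h3.congr_of_eventuallyEq ?_).contDiffWithinAt
  filter_upwards [h1.continuousAt.eventually (S'.chart.open_source.mem_nhds hsrc)] with y hy
  rw [Function.comp_apply, quotientChart_symm, ← S'.quotientChart_proj hy, proj_smul]

end SliceChart

/-- The charts given by the slices form a smooth atlas of the orbit space, and in a slice chart of `M` and
the corresponding chart of the orbit space the projection is `(y, t) ↦ y`. -/
theorem exists_quotient_manifold {M : Type*} [TopologicalSpace M] [T2Space M]
    [ChartedSpace (Euc 8) M] [IsManifold (𝓡 8) ∞ M]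
    [MulAction Circle M] [ContMDiffSMul (𝓡 1) (𝓡 8) ∞ Circle M]
    (hfree : ∀ (z : Circle) (p : M), z • p = p → z = 1) :
    ∃ _ : ChartedSpace (Euc 7) (OrbitSpace M), IsManifold (𝓡 7) ∞ (OrbitSpace M) ∧
      Manifold.IsSubmersion (𝓡 8) (𝓡 7) ∞ (proj M) := by
  have S : ∀ p : M, SliceChart p := fun p => (exists_sliceChart hfree p).some
  let C : ChartedSpace (Euc 7) (OrbitSpace M) :=
    { atlas := Set.range fun p => (S p).quotientChart
      chartAt := fun q => (S (proj_surjective q).choose).quotientChart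
      mem_chart_source := fun q => by
        have h := (S (proj_surjective q).choose).proj_mem_source (S _).mem_source
        rwa [(proj_surjective q).choose_spec] at h
      chart_mem_atlas := fun q => ⟨_, rfl⟩ }
  have hman : IsManifold (𝓡 7) ∞ (OrbitSpace M) := by
    refine isManifold_of_contDiffOn (𝓡 7) ∞ (OrbitSpace M) ?_
    rintro _ _ ⟨p, rfl⟩ ⟨p', rfl⟩
    simpa [Function.comp_def] using (S p).contDiffOn_transition (S p')
  refine ⟨C, hman, Manifold.IsSubmersionOfComplement.isSubmersion (F := ℝ) fun m => ?_⟩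
  refine Manifold.IsSubmersionAtOfComplement.mk_of_continuousAt (continuous_proj M).continuousAt
    (S m).split (S m).chart (S m).quotientChart (S m).mem_source
    ((S m).proj_mem_source (S m).mem_source)
    ((S m).chart.mem_maximalAtlas_of_contMDiffOn (S m).contMDiffOn (S m).contMDiffOn_symm)
    (IsManifold.subset_maximalAtlas ⟨m, rfl⟩) ?_
  intro u hu
  have hu' : u ∈ (S m).chart.target := by simpa using hu
  have h := (S m).quotientChart_proj ((S m).chart.map_target hu')
  rw [(S m).chart.right_inv hu'] at h
  simpa using h

end GTwoQuotient

end

theorem mainTheorem5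
    (M : Type*) [TopologicalSpace M] [T2Space M] [SecondCountableTopology M]
    [ChartedSpace (Euc 8) M] [IsManifold (𝓡 8) ∞ M]
    (o : MOrientation 8 M) (g : RMetric 8 M)
    (Ω : DForm 8 4 M) (hΩ : Ω.IsSmooth)
    (hadm : ∀ p : M, IsAdmissibleWithMetric (o.at_ p) (Ω p) (g.inner p))
    [MulAction Circle M] [ContMDiffSMul (𝓡 1) (𝓡 8) ∞ Circle M]
    (hfree : ∀ (z : Circle) (p : M), z • p = p → z = 1)
    (hinv : ∀ z : Circle, DForm.pullback (fun p : M => z • p) Ω = Ω) :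
    -- the orbit space is a smooth seven-manifold such that the projection is a submersion
    (T2Space (OrbitSpace M) ∧ SecondCountableTopology (OrbitSpace M) ∧
      ∃ _ : ChartedSpace (Euc 7) (OrbitSpace M), IsManifold (𝓡 7) ∞ (OrbitSpace M) ∧
        Manifold.IsSubmersion (𝓡 8) (𝓡 7) ∞ (proj M)) ∧
    ∀ [ChartedSpace (Euc 7) (OrbitSpace M)] [IsManifold (𝓡 7) ∞ (OrbitSpace M)],
      Manifold.IsSubmersion (𝓡 8) (𝓡 7) ∞ (proj M) →
      -- it has a canonical orientation
      (∃! o' : MOrientation 7 (OrbitSpace M), IsInducedOrientation o o') ∧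
      ∀ o' : MOrientation 7 (OrbitSpace M), IsInducedOrientation o o' →
        -- for the generator `X`, the form descends to a unique, smooth and positive form
        (∃ ψ : DForm 7 3 (OrbitSpace M), ψ.IsSmooth ∧
          DForm.pullback (proj M) ψ = contractField g generator Ω ∧
          (∀ ψ' : DForm 7 3 (OrbitSpace M),
            DForm.pullback (proj M) ψ' = contractField g generator Ω → ψ' = ψ) ∧
          ∀ q, IsPositive (o'.at_ q) (ψ q)) ∧
        -- for `v = X / ‖X‖`, moreover, the projection is a Riemannian submersion
        (∃ ψ : DForm 7 3 (OrbitSpace M), ψ.IsSmooth ∧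
          DForm.pullback (proj M) ψ = contractField g (normalizeField g generator) Ω ∧
          (∀ ψ' : DForm 7 3 (OrbitSpace M),
            DForm.pullback (proj M) ψ' = contractField g (normalizeField g generator) Ω → ψ' = ψ) ∧
          (∀ q, IsPositive (o'.at_ q) (ψ q)) ∧
          ∃ h : RMetric 7 (OrbitSpace M),
            (∀ q, IsPositiveWithMetric (o'.at_ q) (ψ q) (h.inner q)) ∧
            IsRiemannianSubmersion g h (proj M)) := by
  refine ⟨⟨t2Space_orbitSpace, secondCountableTopology_orbitSpace,
    exists_quotient_manifold hfree⟩, ?_⟩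
  intro _ _ hsub
  exact quotient_structure o g Ω hΩ hadm hfree hinv hsub
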